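/- **Birkhoff factorization and Grothendieck's splitting theorem.** For an open set $U\subseteq\mathbb C$ let $\mathrm{GL}(n,\mathcal O(U))$ be the group of $n\times n$ matrices of holomorphic functions on $U$ that are invertible at every point of $U$. Let $\mathbb P^1(\mathbb C)=\mathbb C\cup\{\infty\}$ be the Riemann sphere with coordinate $z$ on $\mathbb C$, and for $k\in\mathbb Z$ let $\mathcal O(k)$ be the holomorphic line bundle on $\mathbb P^1(\mathbb C)$ glued from the trivial line bundles on $U_0=\mathbb P^1(\mathbb C)\setminus\{\infty\}$ and $U_1=\mathbb P^1(\mathbb C)\setminus\{0\}$ by the transition function $g_{01}(z)=z^k$ on $U_0\cap U_1=\mathbb C\setminus\{0\}$; its sections are the pairs $(s_0,s_1)$ with $s_0=z^k s_1$ on $U_0\cap U_1$. 1. (Birkhoff's factorization lemma.) Let $R_0>0$ and $T\in\mathrm{GL}(n,\mathcal O(\{|z|>R_0\}))$. Then there are $P\in\mathrm{GL}(n,\mathcal O(\{|\zeta|<1/R_0\}))$, $E\in\mathrm{GL}(n,\mathcal O(\mathbb C))$ and integers $k_1\ge k_2\ge\dots\ge k_n$ such that $$T(z)=P(1/z)\,\operatorname{diag}(z^{k_1},\dots,z^{k_n})\,E(z)\qquad\text{for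 all } |z|>R_0 .$$ 2. Consequently, Grothendieck's splitting theorem holds: (a) every holomorphic vector bundle of rank $n$ on $\mathbb P^1(\mathbb C)$ is holomorphically isomorphic to $\mathcal O(k_1)\oplus\dots\oplus\mathcal O(k_n)$ for some $k_1,\dots,k_n\in\mathbb Z$; (b) $\mathcal O(a_1)\oplus\dots\oplus\mathcal O(a_n)$ and $\mathcal O(b_1)\oplus\dots\oplus\mathcal O(b_l)$ are holomorphically isomorphic if and only if $n=l$ and $(a_1,\dots,a_n)$ equals $(b_1,\dots,b_l)$ up to reordering. -/

import Mathlib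

open scoped Manifold ContDiff Topology Bundle

noncomputable section

/-! ### The Riemann sphere

The complex projective line `ℙ¹(ℂ)` is the one-point compactification `OnePoint ℂ = ℂ ∪ {∞}`, where
`z : ℂ` is the point `[1 : z]` and `∞` is the point `[0 : 1]`. -/

namespace RiemannSphere

/-- The affine coordinate `[z₀ : z₁] ↦ z₁ / z₀` on `ℙ¹(ℂ) \ {∞}` (with dummy value `0` at `∞`). -/
def coord (x : OnePoint ℂ) : ℂ := x.elim 0 id

/-- The involution `z ↦ 1 / z` of `ℙ¹(ℂ)`, which exchanges `0` and `∞`. -/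
def inv (x : OnePoint ℂ) : OnePoint ℂ :=
  x.elim ((0 : ℂ) : OnePoint ℂ) fun z => if z = 0 then OnePoint.infty else ((z⁻¹ : ℂ) : OnePoint ℂ)

@[simp] theorem coord_coe (z : ℂ) : coord z = z := rfl
@[simp] theorem coord_infty : coord OnePoint.infty = 0 := rfl
@[simp] theorem inv_infty : inv OnePoint.infty = ((0 : ℂ) : OnePoint ℂ) := rfl
@[simp] theorem inv_zero : inv ((0 : ℂ) : OnePoint ℂ) = OnePoint.infty := by simp [inv]
theorem inv_coe {z : ℂ} (hz : z ≠ 0) : inv z = ((z⁻¹ : ℂ) : OnePoint ℂ) := by simp [inv, hz]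

theorem inv_inv (x : OnePoint ℂ) : inv (inv x) = x := by
  induction x using OnePoint.rec with
  | infty => simp
  | coe z =>
    by_cases hz : z = 0
    · subst hz; simp
    · rw [inv_coe hz, inv_coe (inv_ne_zero hz), _root_.inv_inv]

theorem continuous_inv : Continuous inv := by
  rw [continuous_iff_continuousAt]
  intro x
  induction x using OnePoint.rec with
  | infty =>
    rw [OnePoint.continuousAt_infty', Filter.coclosedCompact_eq_cocompact,
      ← Metric.cobounded_eq_cocompact]
    have h : Filter.Tendsto (fun z : ℂ => ((z⁻¹ : ℂ) : OnePoint ℂ)) (Bornology.cobounded ℂ)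
        (𝓝 ((0 : ℂ) : OnePoint ℂ)) :=
      (OnePoint.continuous_coe.tendsto _).comp Filter.tendsto_inv₀_cobounded
    refine h.congr' ?_
    have h0 : ∀ᶠ z : ℂ in Bornology.cobounded ℂ, z ≠ 0 := by
      rw [Metric.cobounded_eq_cocompact]
      exact (isCompact_singleton (x := (0 : ℂ))).compl_mem_cocompact
    filter_upwards [h0] with z hz
    exact (inv_coe hz).symm
  | coe z =>
    rw [OnePoint.continuousAt_coe]
    by_cases hz : z = 0
    · subst hz
      rw [continuousAt_iff_punctured_nhds]
      have h : Filter.Tendsto (fun z : ℂ => ((z⁻¹ : ℂ) : OnePoint ℂ)) (𝓝[≠] (0 : ℂ))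
          (𝓝 (OnePoint.infty : OnePoint ℂ)) := by
        refine OnePoint.tendsto_coe_infty.comp ?_
        rw [Filter.coclosedCompact_eq_cocompact, ← Metric.cobounded_eq_cocompact]
        exact Filter.tendsto_inv₀_nhdsNE_zero
      simp only [Function.comp_apply, inv_zero]
      refine h.congr' ?_
      filter_upwards [self_mem_nhdsWithin] with z hz
      exact (inv_coe hz).symm
    · have h : ContinuousAt (fun z : ℂ => ((z⁻¹ : ℂ) : OnePoint ℂ)) z :=
        OnePoint.continuous_coe.continuousAt.comp (continuousAt_inv₀ hz)
      refine h.congr ?_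
      filter_upwards [isOpen_ne.mem_nhds hz] with w hw
      exact (inv_coe hw).symm

/-- The involution `z ↦ 1 / z` as a homeomorphism of `ℙ¹(ℂ)`. -/
def invHomeo : OnePoint ℂ ≃ₜ OnePoint ℂ where
  toFun := inv
  invFun := inv
  left_inv := inv_inv
  right_inv := inv_inv
  continuous_toFun := continuous_inv
  continuous_invFun := continuous_inv

/-- The chart `[z₀ : z₁] ↦ z₁ / z₀` on `U₀ = ℙ¹(ℂ) \ {∞}`. -/
def chartZero : OpenPartialHomeomorph (OnePoint ℂ) ℂ where
  toFun := coord
  invFun := fun z => z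
  source := {OnePoint.infty}ᶜ
  target := Set.univ
  map_source' := fun _ _ => Set.mem_univ _
  map_target' := fun z _ => OnePoint.coe_ne_infty z
  left_inv' := by
    intro x hx
    induction x using OnePoint.rec with
    | infty => exact absurd rfl hx
    | coe z => rfl
  right_inv' := fun _ _ => rfl
  open_source := OnePoint.isClosed_infty.isOpen_compl
  open_target := isOpen_univ
  continuousOn_toFun := by
    intro x hx
    induction x using OnePoint.rec with
    | infty => exact absurd rfl hx
    | coe z => exact ContinuousAt.continuousWithinAt (by
      rw [OnePoint.continuousAt_coe]
      exact continuousAt_id)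
  continuousOn_invFun := OnePoint.continuous_coe.continuousOn

/-- The chart `[z₀ : z₁] ↦ z₀ / z₁` on `U₁ = ℙ¹(ℂ) \ {0}`. -/
def chartInfty : OpenPartialHomeomorph (OnePoint ℂ) ℂ :=
  invHomeo.transOpenPartialHomeomorph chartZero

open Classical in
instance : ChartedSpace ℂ (OnePoint ℂ) where
  atlas := {chartZero, chartInfty}
  chartAt x := if x = OnePoint.infty then chartInfty else chartZero
  mem_chart_source x := by
    split_ifs with h
    · subst h
      exact OnePoint.coe_ne_infty (0 : ℂ)
    · exact h
  chart_mem_atlas x := by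
    split_ifs <;> simp

theorem mem_source_chartInfty {x : OnePoint ℂ} :
    x ∈ chartInfty.source ↔ x ≠ ((0 : ℂ) : OnePoint ℂ) := by
  change inv x ≠ OnePoint.infty ↔ _
  rw [not_iff_not]
  exact ⟨fun h => by rw [← inv_inv x, h, inv_infty], fun h => by rw [h, inv_zero]⟩

instance : IsManifold 𝓘(ℂ) ω (OnePoint ℂ) := by
  have key : ContDiffOn ℂ ω (fun z : ℂ => z⁻¹) {0}ᶜ := fun z hz =>
    (contDiffAt_inv ℂ hz).contDiffWithinAt
  apply isManifold_of_contDiffOn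
  rintro e e' (rfl | rfl) (rfl | rfl)
  · refine contDiffOn_id.congr ?_
    intro z _
    rfl
  · refine (key.mono ?_).congr ?_
    · rintro z hz rfl
      have : ((0 : ℂ) : OnePoint ℂ) ∈ chartInfty.source := hz.1.2
      exact mem_source_chartInfty.1 this rfl
    · intro z hz
      have h : (z : OnePoint ℂ) ∈ chartInfty.source := hz.1.2
      have hz0 : z ≠ 0 := fun h0 => mem_source_chartInfty.1 h (by rw [h0])
      change coord (inv (z : OnePoint ℂ)) = z⁻¹
      rw [inv_coe hz0, coord_coe]
  · refine (key.mono ?_).congr ?_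
    · rintro z hz rfl
      have : inv ((0 : ℂ) : OnePoint ℂ) ∈ chartZero.source := hz.1.2
      exact this inv_zero
    · intro z hz
      have h : inv (z : OnePoint ℂ) ∈ chartZero.source := hz.1.2
      have hz0 : z ≠ 0 := fun h0 => h (by rw [h0, inv_zero]; rfl)
      change coord (inv (z : OnePoint ℂ)) = z⁻¹
      rw [inv_coe hz0, coord_coe]
  · refine contDiffOn_id.congr ?_
    intro z _
    change coord (inv (inv (z : OnePoint ℂ))) = z
    rw [inv_inv, coord_coe]

/-- The members `U₀ = ℙ¹(ℂ) \ {∞}` and `U₁ = ℙ¹(ℂ) \ {0}` of the standard open cover. -/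
def patch (i : Fin 2) : Set (OnePoint ℂ) :=
  if i = 0 then {OnePoint.infty}ᶜ else {((0 : ℂ) : OnePoint ℂ)}ᶜ

theorem isOpen_patch (i : Fin 2) : IsOpen (patch i) := by
  unfold patch
  split_ifs
  · exact OnePoint.isClosed_infty.isOpen_compl
  · exact isOpen_compl_singleton

theorem coord_ne_zero {i j : Fin 2} (hij : i ≠ j) {x : OnePoint ℂ}
    (hx : x ∈ patch i ∩ patch j) : coord x ≠ 0 := by
  have h : x ≠ OnePoint.infty ∧ x ≠ ((0 : ℂ) : OnePoint ℂ) := by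
    fin_cases i <;> fin_cases j <;> simp_all [patch]
  induction x using OnePoint.rec with
  | infty => exact absurd rfl h.1
  | coe z => exact fun h0 => h.2 (congrArg _ h0)

/-- The exponent of the transition function of `𝒪(k)` from the patch `U_i` to the patch `U_j`:
it is `k` from `U₁` to `U₀`, `-k` from `U₀` to `U₁`, and `0` if `i = j`. -/
def expo (k : ℤ) (i j : Fin 2) : ℤ := k * (((i : ℕ) : ℤ) - ((j : ℕ) : ℤ))

@[simp] theorem expo_self (k : ℤ) (i : Fin 2) : expo k i i = 0 := by simp [expo]

theorem continuousOn_coord : ContinuousOn coord {OnePoint.infty}ᶜ := chartZero.continuousOn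

theorem contMDiffOn_coord : ContMDiffOn 𝓘(ℂ) 𝓘(ℂ) ω coord {OnePoint.infty}ᶜ :=
  contMDiffOn_of_mem_maximalAtlas (e := chartZero)
    (IsManifold.subset_maximalAtlas (by exact Or.inl rfl))

theorem contMDiffOn_transition (k : ℤ) (i j : Fin 2) :
    ContMDiffOn 𝓘(ℂ) 𝓘(ℂ, ℂ →L[ℂ] ℂ) ω
      (fun x => (coord x ^ expo k i j) • ContinuousLinearMap.id ℂ ℂ) (patch i ∩ patch j) := by
  by_cases hij : i = j
  · subst hij
    simp only [expo_self, zpow_zero]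
    exact contMDiffOn_const
  · intro x hx
    have hx0 := coord_ne_zero hij hx
    have hxi : x ≠ OnePoint.infty := by
      rintro rfl
      exact hx0 rfl
    have h1 : ContMDiffAt 𝓘(ℂ) 𝓘(ℂ) ω coord x :=
      contMDiffOn_coord.contMDiffAt (OnePoint.isClosed_infty.isOpen_compl.mem_nhds hxi)
    have h2 : ContDiffAt ℂ ω (fun z : ℂ => (z ^ expo k i j) • ContinuousLinearMap.id ℂ ℂ)
        (coord x) :=
      ((analyticAt_id.zpow hx0).contDiffAt).smul contDiffAt_const
    exact (h2.contMDiffAt.comp x h1).contMDiffWithinAt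

/-- The holomorphic line bundle `𝒪(k)` on `ℙ¹(ℂ)`: it is glued from the trivial line bundles on `U₀`
and `U₁` by the transition function `g₀₁ = z ^ k` on `U₀ ∩ U₁ = ℂ \ {0}`, so that its sections are
the pairs `(s₀, s₁)` with `s₀ = z ^ k * s₁` on `U₀ ∩ U₁`. Here `coordChange i j` carries the
coordinate over `U_i` to the coordinate over `U_j`. -/
def lineBundle (k : ℤ) : VectorBundleCore ℂ (OnePoint ℂ) ℂ (Fin 2) where
  baseSet := patch
  isOpen_baseSet := isOpen_patch
  indexAt x := open Classical in if x = OnePoint.infty then 1 else 0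
  mem_baseSet_at x := by
    split_ifs with h
    · subst h
      simp [patch]
    · simpa [patch] using h
  coordChange i j x := (coord x ^ expo k i j) • ContinuousLinearMap.id ℂ ℂ
  coordChange_self i x _ v := by simp
  continuousOn_coordChange i j := (contMDiffOn_transition k i j).continuousOn
  coordChange_comp i j l x hx v := by
    by_cases h : i = j ∧ j = l
    · obtain ⟨rfl, rfl⟩ := h
      simp
    · have hx0 : coord x ≠ 0 := by
        by_cases hij : i = j
        · exact coord_ne_zero (fun hjl => h ⟨hij, hjl⟩) ⟨hx.1.2, hx.2⟩
        · exact coord_ne_zero hij hx.1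
      have he : expo k i l = expo k j l + expo k i j := by simp only [expo]; ring
      simp [he, zpow_add₀ hx0, mul_assoc]

instance (k : ℤ) : (lineBundle k).IsContMDiff 𝓘(ℂ) ω :=
  ⟨contMDiffOn_transition k⟩

end RiemannSphere

/-! ### Finite direct sums of vector bundles -/

namespace VectorBundleCore

variable {B : Type*} [TopologicalSpace B] {J : Type*} [Fintype J] {F : J → Type*}
  [∀ j, NormedAddCommGroup (F j)] [∀ j, NormedSpace ℂ (F j)] {ι : J → Type*}

/-- The direct sum of a finite family of vector bundles given by transition functions: its fiber
is the direct sum of the fibers, it is trivialized wherever all summands are, and its transition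
functions are the block diagonal ones. -/
def finiteDirectSum (Z : ∀ j, VectorBundleCore ℂ B (F j) (ι j)) :
    VectorBundleCore ℂ B (∀ j, F j) (∀ j, ι j) where
  baseSet a := ⋂ j, (Z j).baseSet (a j)
  isOpen_baseSet a := isOpen_iInter_of_finite fun j => (Z j).isOpen_baseSet (a j)
  indexAt x j := (Z j).indexAt x
  mem_baseSet_at x := Set.mem_iInter.2 fun j => (Z j).mem_baseSet_at x
  coordChange a b x := ContinuousLinearMap.pi fun j =>
    ((Z j).coordChange (a j) (b j) x).comp (ContinuousLinearMap.proj j)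
  coordChange_self a x hx v := by
    ext j
    exact (Z j).coordChange_self (a j) x (Set.mem_iInter.1 hx j) (v j)
  continuousOn_coordChange a b := by
    refine (ContinuousLinearMap.piEquivL ℂ (∀ j, F j) F).continuous.comp_continuousOn
      (continuousOn_pi.2 fun j => ?_)
    refine ContinuousOn.clm_comp (((Z j).continuousOn_coordChange (a j) (b j)).mono ?_)
      continuousOn_const
    exact fun x hx => ⟨Set.mem_iInter.1 hx.1 j, Set.mem_iInter.1 hx.2 j⟩
  coordChange_comp a b c x hx v := by
    ext j
    exact (Z j).coordChange_comp (a j) (b j) (c j) x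
      ⟨⟨Set.mem_iInter.1 hx.1.1 j, Set.mem_iInter.1 hx.1.2 j⟩, Set.mem_iInter.1 hx.2 j⟩ (v j)

instance [ChartedSpace ℂ B] (Z : ∀ j, VectorBundleCore ℂ B (F j) (ι j))
    [h : ∀ j, (Z j).IsContMDiff 𝓘(ℂ) ω] : (finiteDirectSum Z).IsContMDiff 𝓘(ℂ) ω where
  contMDiffOn_coordChange a b := by
    refine (ContinuousLinearMap.piEquivL ℂ (∀ j, F j) F).contDiff.contMDiff.comp_contMDiffOn
      (contMDiffOn_pi_space.2 fun j => ?_)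
    refine ContMDiffOn.clm_comp (((h j).contMDiffOn_coordChange (a j) (b j)).mono ?_)
      contMDiffOn_const
    exact fun x hx => ⟨Set.mem_iInter.1 hx.1 j, Set.mem_iInter.1 hx.2 j⟩

end VectorBundleCore

/-- The holomorphic vector bundle `𝒪(k₁) ⊕ … ⊕ 𝒪(kₙ)` on `ℙ¹(ℂ)`. -/
abbrev RiemannSphere.sumLineBundles {n : ℕ} (k : Fin n → ℤ) :
    VectorBundleCore ℂ (OnePoint ℂ) (Fin n → ℂ) (Fin n → Fin 2) :=
  VectorBundleCore.finiteDirectSum fun i => RiemannSphere.lineBundle (k i)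

/-- Two vector bundles over a complex curve are (holomorphically) isomorphic if there is a family of
linear isomorphisms between their fibers which, together with its inverse, is holomorphic as a map
of total spaces. -/
def HolomorphicallyIsomorphic {B : Type*} [TopologicalSpace B] [ChartedSpace ℂ B]
    (F : Type*) [NormedAddCommGroup F] [NormedSpace ℂ F]
    (E : B → Type*) [TopologicalSpace (Bundle.TotalSpace F E)]
    [∀ x, AddCommGroup (E x)] [∀ x, Module ℂ (E x)] [∀ x, TopologicalSpace (E x)]
    [FiberBundle F E]
    (F' : Type*) [NormedAddCommGroup F'] [NormedSpace ℂ F']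
    (E' : B → Type*) [TopologicalSpace (Bundle.TotalSpace F' E')]
    [∀ x, AddCommGroup (E' x)] [∀ x, Module ℂ (E' x)] [∀ x, TopologicalSpace (E' x)]
    [FiberBundle F' E'] : Prop :=
  ∃ φ : ∀ x, E x ≃ₗ[ℂ] E' x,
    ContMDiff (𝓘(ℂ).prod 𝓘(ℂ, F)) (𝓘(ℂ).prod 𝓘(ℂ, F')) ω
      (fun p : Bundle.TotalSpace F E =>
        (⟨p.proj, φ p.proj p.snd⟩ : Bundle.TotalSpace F' E')) ∧
    ContMDiff (𝓘(ℂ).prod 𝓘(ℂ, F')) (𝓘(ℂ).prod 𝓘(ℂ, F)) ω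
      (fun p : Bundle.TotalSpace F' E' =>
        (⟨p.proj, (φ p.proj).symm p.snd⟩ : Bundle.TotalSpace F E))

/-- `T ∈ GL(n, 𝒪(U))` for an open set `U ⊆ ℂ`: the entries of `T` are holomorphic on `U` and `T` is
invertible at every point of `U`. -/
def MemGLHolomorphic {n : ℕ} (U : Set ℂ) (T : ℂ → Matrix (Fin n) (Fin n) ℂ) : Prop :=
  (∀ i j, DifferentiableOn ℂ (fun z => T z i j) U) ∧ ∀ z ∈ U, IsUnit (T z)

end

/-! Birkhoff's factorization rests on Cartan's lemma for the overlapping regions `{r₁ < |z|}` and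
`{|z| < r₂}`. The additive problem `g = g₁ + g₂` on the overlap is solved with bounds: a smooth
cutoff splits `g`, and a Cauchy transform, which inverts `∂/∂z̄`, makes both halves holomorphic.
Iterating this factors matrices close to `1` (`HasBoundedCousinSplitting.exists_factorization`). A
general `T` is compared with a rational approximation `Q / q` (Runge), which gives `A T = (1 + b) Q
/ q` with `A` holomorphic near infinity and close to `1`, so that `A` extends invertibly over
infinity. The rest is algebra over `ℂ[X]`: the zeros of `q` and of `det Q` are sorted between the
two regions (`exists_cartan_factorization`), and column reduction puts the remaining polynomial
matrix into the form `W(1/z) diag(z^k) V⁻¹` with `V` unimodular (`exists_column_reduction`). This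
factors `T` on an annulus, and the equation itself continues `P` and `E` to their full domains.

For the splitting of bundles, the same Cartan lemma glues local frames across slabs, so a bundle is
trivial near every compact subset of the plane (`IsCompact.hasFrameNear`); near infinity it is
trivial by definition. On an annulus the transition matrix between the two frames is factored, `P`
and `E` are absorbed into the frames, and a diagonal transition matrix is left.

For uniqueness, the component `𝒪(aⱼ) → 𝒪(bᵢ)` of an isomorphism is an entire function of the form
`z^(bᵢ - aⱼ) g(1/z)` with `g` entire, so it vanishes by Liouville when `bᵢ < aⱼ`. One fibre then
gives `#{aⱼ ≥ c} ≤ #{bᵢ ≥ c}` for all `c`, and the inverse isomorphism gives equality. -/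

/-! ### The Cauchy transform and the Cauchy–Pompeiu formula -/

section CauchyTransform

open MeasureTheory

variable {E : Type*} [NormedAddCommGroup E] [NormedSpace ℂ E]

/-- The Wirtinger derivative `∂F/∂z̄`. -/
noncomputable def dbar (F : ℂ → E) (z : ℂ) : E :=
  (2⁻¹ : ℂ) • (fderiv ℝ F z 1 + Complex.I • fderiv ℝ F z Complex.I)

/-- The Cauchy transform `z ↦ π⁻¹ ∫ h(w) / (z - w) dA(w)`. -/
noncomputable def cauchyTransform (h : ℂ → E) (z : ℂ) : E :=
  (Real.pi : ℂ)⁻¹ • ∫ w, (z - w)⁻¹ • h w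

/-- The integrand is the derivative of `r ↦ G (r e^{iθ})`, which vanishes for large `r`. -/
theorem integral_polar_fderiv_radial [CompleteSpace E] {G : ℂ → E} (hG : ContDiff ℝ 1 G)
    (hc : HasCompactSupport G) (θ : ℝ) :
    ∫ r in Set.Ioi (0 : ℝ), fderiv ℝ G (r * (Real.cos θ + Real.sin θ * Complex.I))
      (Real.cos θ + Real.sin θ * Complex.I) = -G 0 := by
  set e : ℂ := Real.cos θ + Real.sin θ * Complex.I with he
  have hne : ‖e‖ = 1 := by rw [he]; push_cast; exact Complex.norm_cos_add_sin_mul_I θ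
  have he0 : e ≠ 0 := norm_ne_zero_iff.1 (by rw [hne]; exact one_ne_zero)
  let l : ℝ →L[ℝ] ℂ := (ContinuousLinearMap.id ℝ ℝ).smulRight e
  have hl : ∀ r : ℝ, l r = r * e := fun r => by simp [l]
  have hder : ∀ r : ℝ, HasDerivAt (fun r : ℝ => G (r * e)) (fderiv ℝ G (r * e) e) r := by
    intro r
    have h1 : HasDerivAt (fun r : ℝ => (r : ℂ) * e) e r := by
      simpa using (Complex.ofRealCLM.hasDerivAt (x := r)).mul_const e
    exact ((hG.differentiable one_ne_zero) (r * e)).hasFDerivAt.comp_hasDerivAt r h1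
  have hemb : Topology.IsClosedEmbedding (fun r : ℝ => (r : ℂ) * e) :=
    (Homeomorph.mulRight₀ e he0).isClosedEmbedding.comp Complex.isometry_ofReal.isClosedEmbedding
  have hcs : HasCompactSupport (fun r : ℝ => G (r * e)) := hc.comp_isClosedEmbedding hemb
  have hcs' : HasCompactSupport (fun r : ℝ => fderiv ℝ G (r * e) e) :=
    ((hc.fderiv ℝ).comp_isClosedEmbedding hemb).comp_left (g := fun L : ℂ →L[ℝ] E => L e) (by simp)
  have hcont : Continuous (fun r : ℝ => fderiv ℝ G (r * e) e) := by
    have := hG.continuous_fderiv one_ne_zero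
    fun_prop
  have h0 : Filter.Tendsto (fun r : ℝ => G (r * e)) Filter.atTop (𝓝 0) :=
    (hcs.is_zero_at_infty).mono_left atTop_le_cocompact
  have := integral_Ioi_of_hasDerivAt_of_tendsto (a := 0) (hder 0).continuousAt.continuousWithinAt
    (fun r _ => hder r) (hcont.integrable_of_hasCompactSupport hcs').integrableOn h0
  simpa using this

/-- The integrand is, up to the factor `r⁻¹`, the derivative of the periodic function `θ ↦ G (r
e^{iθ})`, integrated over a full period. -/
theorem integral_polar_fderiv_angular [CompleteSpace E] {G : ℂ → E} (hG : ContDiff ℝ 1 G)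
    {r : ℝ} (hr : 0 < r) :
    ∫ θ in Set.Ioo (-Real.pi) Real.pi, fderiv ℝ G (r * (Real.cos θ + Real.sin θ * Complex.I))
      (Complex.I * (Real.cos θ + Real.sin θ * Complex.I)) = 0 := by
  have hder : ∀ θ : ℝ, HasDerivAt
      (fun θ : ℝ => r⁻¹ • G (r * (Real.cos θ + Real.sin θ * Complex.I)))
      (fderiv ℝ G (r * (Real.cos θ + Real.sin θ * Complex.I))
        (Complex.I * (Real.cos θ + Real.sin θ * Complex.I))) θ := by
    intro θ
    have h1 : HasDerivAt (fun θ : ℝ => (r : ℂ) * (Real.cos θ + Real.sin θ * Complex.I))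
        (r • (Complex.I * (Real.cos θ + Real.sin θ * Complex.I))) θ := by
      have hc := (Real.hasDerivAt_cos θ).ofReal_comp
      have hs := (Real.hasDerivAt_sin θ).ofReal_comp
      refine ((hc.add (hs.mul_const Complex.I)).const_mul (r : ℂ)).congr_deriv ?_
      rw [Complex.real_smul]
      push_cast
      linear_combination -(r : ℂ) * Complex.sin θ * Complex.I_mul_I
    have := (((hG.differentiable one_ne_zero) _).hasFDerivAt.comp_hasDerivAt θ h1).const_smul r⁻¹
    rw [map_smul, smul_smul, inv_mul_cancel₀ hr.ne', one_smul] at this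
    exact this
  have hcont : Continuous (fun θ : ℝ => fderiv ℝ G (r * (Real.cos θ + Real.sin θ * Complex.I))
        (Complex.I * (Real.cos θ + Real.sin θ * Complex.I))) := by
    have := hG.continuous_fderiv one_ne_zero
    fun_prop
  rw [← integral_Ioc_eq_integral_Ioo,
    ← intervalIntegral.integral_of_le (by linarith [Real.pi_pos]),
    intervalIntegral.integral_eq_sub_of_hasDerivAt (fun θ _ => hder θ)
      (hcont.intervalIntegrable _ _)]
  simp

/-- **Cauchy–Pompeiu formula** for compactly supported functions. -/
theorem cauchyTransform_dbar [CompleteSpace E] {F : ℂ → E} (hF : ContDiff ℝ 1 F)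
    (hc : HasCompactSupport F) : cauchyTransform (dbar F) = F := by
  ext z
  set G : ℂ → E := fun ζ => F (z + ζ) with hGdef
  have hG : ContDiff ℝ 1 G := hF.comp (contDiff_const.add contDiff_id)
  have hGc : HasCompactSupport G := hc.comp_homeomorph (Homeomorph.addLeft z)
  have hdG : ∀ ζ, fderiv ℝ F (z + ζ) = fderiv ℝ G ζ := fun ζ => (fderiv_comp_add_left z).symm
  let e : ℝ → ℂ := fun θ => Real.cos θ + Real.sin θ * Complex.I
  have hecont : Continuous e := by fun_prop
  have hne : ∀ θ, ‖e θ‖ = 1 := fun θ => by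
    simp only [e]; push_cast; exact Complex.norm_cos_add_sin_mul_I θ
  have he0 : ∀ θ, e θ ≠ 0 := fun θ => norm_ne_zero_iff.1 (by rw [hne]; exact one_ne_zero)
  let A : ℝ × ℝ → E := fun p => fderiv ℝ G (p.1 * e p.2) (e p.2)
  let B : ℝ × ℝ → E := fun p => fderiv ℝ G (p.1 * e p.2) (Complex.I * e p.2)
  have hfc := hG.continuous_fderiv one_ne_zero
  have hAc : Continuous A := by fun_prop
  have hBc : Continuous B := by fun_prop
  obtain ⟨ρ, hρ⟩ : ∃ ρ : ℝ, ∀ ζ, ρ < ‖ζ‖ → fderiv ℝ G ζ = 0 := by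
    obtain ⟨ρ, hρ⟩ := (hGc.fderiv ℝ).isBounded.subset_closedBall 0
    refine ⟨ρ, fun ζ hζ => image_eq_zero_of_notMem_tsupport fun h => ?_⟩
    have := hρ h
    rw [mem_closedBall_zero_iff] at this
    linarith
  set S : Set (ℝ × ℝ) := Set.Ioi 0 ×ˢ Set.Ioo (-Real.pi) Real.pi with hS
  have hint : ∀ H : ℝ × ℝ → E, Continuous H → (∀ p ∈ S, ρ < p.1 → H p = 0) →
      IntegrableOn H S := by
    intro H hH h0
    have h1 : IntegrableOn H (Set.Icc 0 ρ ×ˢ Set.Icc (-Real.pi) Real.pi) :=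
      hH.continuousOn.integrableOn_compact (isCompact_Icc.prod isCompact_Icc)
    have h2 : IntegrableOn H (S ∩ Set.Icc 0 ρ ×ˢ Set.Icc (-Real.pi) Real.pi) :=
      h1.mono_set Set.inter_subset_right
    refine h2.of_forall_sdiff_eq_zero (measurableSet_Ioi.prod measurableSet_Ioo) ?_
    rintro p ⟨hp, hp'⟩
    refine h0 p hp ?_
    by_contra! hle
    exact hp' ⟨hp, ⟨hp.1.le, hle⟩, hp.2.1.le, hp.2.2.le⟩
  have hzero : ∀ p ∈ S, ρ < p.1 → fderiv ℝ G (p.1 * e p.2) = 0 := by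
    intro p hp h
    refine hρ _ ?_
    rw [norm_mul, hne, mul_one, Complex.norm_real]
    exact h.trans_le (le_abs_self _)
  have hA : IntegrableOn A S := hint A hAc fun p hp h => by simp [A, hzero p hp h]
  have hB : IntegrableOn B S := hint B hBc fun p hp h => by simp [B, hzero p hp h]
  -- With `e = e^{iθ}`, the sum of the derivative along `e` and `i` times the derivative along `i e`
  -- equals `2 e⁻¹ ∂F/∂z̄`. The Jacobian `r` cancels the singularity of `(z - w)⁻¹ = -(r e)⁻¹`, so
  -- the kernel leaves exactly a radial term `A` and an angular term `B`.
  have hpol : ∀ p ∈ S, p.1 • ((z - (z + Complex.polarCoord.symm p))⁻¹ •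
      dbar F (z + Complex.polarCoord.symm p)) = -(2⁻¹ : ℂ) • (A p + Complex.I • B p) := by
    intro p hp
    have hp0 : (p.1 : ℂ) ≠ 0 := Complex.ofReal_ne_zero.2 (ne_of_gt hp.1)
    have hsymm : Complex.polarCoord.symm p = p.1 * e p.2 := Complex.polarCoord_symm_apply p
    have hlin : ∀ (l : ℂ →L[ℝ] E), l (e p.2) + Complex.I • l (Complex.I * e p.2) =
        (e p.2)⁻¹ • (l 1 + Complex.I • l Complex.I) := by
      intro l
      have hl : ∀ a b : ℝ, l (a + b * Complex.I) = (a : ℂ) • l 1 + (b : ℂ) • l Complex.I := by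
        intro a b
        have : (a + b * Complex.I : ℂ) = a • (1 : ℂ) + b • Complex.I := by simp
        rw [this, map_add, map_smul, map_smul]
        simp
      have h2 : Complex.I * e p.2 = ((-Real.sin p.2 : ℝ) : ℂ) + (Real.cos p.2 : ℝ) * Complex.I := by
        simp only [e]; push_cast
        linear_combination Complex.sin p.2 * Complex.I_mul_I
      have hinv : (e p.2)⁻¹ = Real.cos p.2 - Real.sin p.2 * Complex.I := by
        rw [inv_eq_iff_eq_inv, eq_comm, inv_eq_iff_eq_inv, eq_comm]
        apply inv_eq_of_mul_eq_one_left
        simp only [e]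
        have := Complex.cos_sq_add_sin_sq (p.2 : ℂ)
        push_cast
        linear_combination this - Complex.sin p.2 ^ 2 * Complex.I_sq
      rw [h2, hinv, hl, hl]
      match_scalars
      · ring
      · linear_combination (Complex.sin p.2) * Complex.I_sq
    rw [hsymm, dbar, hdG, sub_add_cancel_left, hlin, inv_neg, mul_inv,
      ← Complex.coe_smul (p.1), smul_smul, smul_smul, smul_smul]
    congr 1
    field_simp
  have hdec : ∫ w, (z - w)⁻¹ • dbar F w =
      -(2⁻¹ : ℂ) • ((∫ p in S, A p) + Complex.I • ∫ p in S, B p) := by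
    have hadd : ∫ p in S, (A p + Complex.I • B p) =
        (∫ p in S, A p) + Complex.I • ∫ p in S, B p := by
      rw [integral_add hA (g := fun p => Complex.I • B p) (hB.smul _), integral_smul]
    rw [← integral_add_left_eq_self _ z, ← Complex.integral_comp_polarCoord_symm,
      polarCoord_target, ← hadd, ← integral_smul]
    exact setIntegral_congr_fun (measurableSet_Ioi.prod measurableSet_Ioo) hpol
  have hAint : ∫ p in S, A p = -(2 * Real.pi : ℂ) • F z := by
    rw [hS, Measure.volume_eq_prod, ← setIntegral_prod_swap, setIntegral_prod]
    · have : ∀ θ : ℝ, ∫ r in Set.Ioi (0 : ℝ), A (r, θ) = -G 0 := fun θ =>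
        integral_polar_fderiv_radial hG hGc θ
      simp only [Prod.swap_prod_mk, this, setIntegral_const]
      have hv : volume.real (Set.Ioo (-Real.pi) Real.pi) = 2 * Real.pi := by
        rw [Real.volume_real_Ioo_of_le (by linarith [Real.pi_pos])]; ring
      rw [hv, hGdef, ← Complex.coe_smul]
      simp
    · rw [← Measure.volume_eq_prod]
      have := hA.swap
      exact this
  have hBint : ∫ p in S, B p = 0 := by
    rw [hS, Measure.volume_eq_prod, setIntegral_prod _ hB]
    refine setIntegral_eq_zero_of_forall_eq_zero fun r hr => ?_
    exact integral_polar_fderiv_angular hG hr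
  rw [cauchyTransform, hdec, hAint, hBint, smul_zero, add_zero, smul_smul, smul_smul]
  have : (Real.pi : ℂ) ≠ 0 := Complex.ofReal_ne_zero.2 Real.pi_ne_zero
  have h1 : (Real.pi : ℂ)⁻¹ * -2⁻¹ * -(2 * Real.pi) = 1 := by field_simp
  rw [h1, one_smul]

end CauchyTransform

/-! ### Bounds for the Cauchy transform and local solution of the `∂/∂z̄` equation -/

section CauchyTransformBounds

open MeasureTheory

/-- A function dominating the Cauchy kernel over the disc of radius `ρ`. -/
noncomputable def cauchyKernelBound (ρ : ℝ) (z w : ℂ) : ℝ :=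
  (Metric.ball (0 : ℂ) 1).indicator (fun w => ‖w‖⁻¹) (z - w) +
    (Metric.closedBall (0 : ℂ) ρ).indicator 1 w

theorem norm_inv_sub_le_cauchyKernelBound {ρ : ℝ} {z w : ℂ} (hw : ‖w‖ ≤ ρ) :
    ‖(z - w)⁻¹‖ ≤ cauchyKernelBound ρ z w := by
  rw [cauchyKernelBound, Set.indicator_of_mem (s := Metric.closedBall 0 ρ) (by simpa using hw),
    norm_inv, Pi.one_apply]
  by_cases h : z - w ∈ Metric.ball (0 : ℂ) 1
  · rw [Set.indicator_of_mem h]; linarith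
  · rw [Set.indicator_of_notMem h, zero_add]
    rw [mem_ball_zero_iff, not_lt] at h
    exact inv_le_one_of_one_le₀ h

theorem cauchyKernelBound_nonneg (ρ : ℝ) (z w : ℂ) : 0 ≤ cauchyKernelBound ρ z w :=
  add_nonneg (Set.indicator_nonneg (fun _ _ => inv_nonneg.2 (norm_nonneg _)) _)
    (Set.indicator_nonneg (fun _ _ => zero_le_one) _)

theorem integrable_indicator_norm_inv :
    Integrable ((Metric.ball (0 : ℂ) 1).indicator fun w => ‖w‖⁻¹) := by
  rw [integrable_indicator_iff Metric.isOpen_ball.measurableSet]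
  refine integrableOn_ball_of_norm_le_rpow (C := 1) (α := 1) (by simp) (by simp) ?_
    (by fun_prop)
  refine Filter.Eventually.of_forall fun w => ?_
  rw [Real.rpow_neg (norm_nonneg _), Real.rpow_one, one_mul, norm_inv, norm_norm]

theorem integrable_indicator_closedBall (ρ : ℝ) :
    Integrable ((Metric.closedBall (0 : ℂ) ρ).indicator (1 : ℂ → ℝ)) := by
  rw [integrable_indicator_iff Metric.isClosed_closedBall.measurableSet]
  exact integrableOn_const (isCompact_closedBall _ _).measure_lt_top.ne

theorem integrable_cauchyKernelBound (ρ : ℝ) (z : ℂ) : Integrable (cauchyKernelBound ρ z) :=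
  (integrable_indicator_norm_inv.comp_sub_left z).add (integrable_indicator_closedBall ρ)

/-- The part depending on `z` is a translate (and reflection) of a fixed function. This makes the
sup bound for the Cauchy transform uniform in `z`. -/
theorem integral_cauchyKernelBound (ρ : ℝ) (z : ℂ) :
    ∫ w, cauchyKernelBound ρ z w = ∫ w, cauchyKernelBound ρ 0 w := by
  have h : ∀ z, ∫ w, cauchyKernelBound ρ z w =
      (∫ w, (Metric.ball (0 : ℂ) 1).indicator (fun w => ‖w‖⁻¹) w) +
        ∫ w, (Metric.closedBall (0 : ℂ) ρ).indicator (1 : ℂ → ℝ) w := by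
    intro z
    rw [← integral_sub_left_eq_self ((Metric.ball (0 : ℂ) 1).indicator fun w => ‖w‖⁻¹) volume z]
    exact integral_add (integrable_indicator_norm_inv.comp_sub_left z)
      (integrable_indicator_closedBall ρ)
  rw [h, h]

variable {E : Type*} [NormedAddCommGroup E] [NormedSpace ℂ E]

theorem norm_cauchyKernel_smul_le {h : ℂ → E} {M ρ : ℝ} (hb : ∀ w, ‖h w‖ ≤ M)
    (hs : ∀ w, ρ < ‖w‖ → h w = 0) (z w : ℂ) :
    ‖(z - w)⁻¹ • h w‖ ≤ M * cauchyKernelBound ρ z w := by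
  have hM : 0 ≤ M := (norm_nonneg _).trans (hb 0)
  rcases le_or_gt ‖w‖ ρ with hw | hw
  · rw [norm_smul, mul_comm]
    exact mul_le_mul (hb w) (norm_inv_sub_le_cauchyKernelBound hw) (norm_nonneg _) hM
  · rw [hs w hw, smul_zero, norm_zero]
    exact mul_nonneg hM (cauchyKernelBound_nonneg _ _ _)

theorem integrable_cauchyKernel_smul {h : ℂ → E} {M ρ : ℝ} (hm : AEStronglyMeasurable h)
    (hb : ∀ w, ‖h w‖ ≤ M) (hs : ∀ w, ρ < ‖w‖ → h w = 0) (z : ℂ) :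
    Integrable fun w => (z - w)⁻¹ • h w := by
  refine ((integrable_cauchyKernelBound ρ z).const_mul M).mono' ?_
    (Filter.Eventually.of_forall (norm_cauchyKernel_smul_le hb hs z))
  have : Measurable fun w : ℂ => (z - w)⁻¹ := by fun_prop
  exact this.aestronglyMeasurable.smul hm

/-- The Cauchy transform of a bounded function supported in a disc is bounded. -/
theorem exists_norm_cauchyTransform_le (ρ : ℝ) : ∃ C : ℝ, 0 ≤ C ∧ ∀ (h : ℂ → E) (M : ℝ),
    (∀ w, ‖h w‖ ≤ M) → (∀ w, ρ < ‖w‖ → h w = 0) → ∀ z, ‖cauchyTransform h z‖ ≤ C * M := by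
  refine ⟨Real.pi⁻¹ * ∫ w, cauchyKernelBound ρ 0 w, mul_nonneg (by positivity)
    (integral_nonneg fun w => cauchyKernelBound_nonneg _ _ _), fun h M hb hs z => ?_⟩
  have h1 := norm_integral_le_of_norm_le ((integrable_cauchyKernelBound ρ z).const_mul M)
    (Filter.Eventually.of_forall (norm_cauchyKernel_smul_le hb hs z))
  rw [integral_const_mul, integral_cauchyKernelBound] at h1
  rw [cauchyTransform, norm_smul, norm_inv, Complex.norm_real, Real.norm_of_nonneg Real.pi_pos.le,
    mul_assoc]
  gcongr
  linarith

/-- For `z` near `z₀` the kernel stays away from its pole on the support of `h`, so differentiation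
under the integral sign is legitimate. -/
theorem differentiableAt_cauchyTransform_of_eventuallyEq_zero [CompleteSpace E] {h : ℂ → E}
    (hi : Integrable h) {z₀ : ℂ} (h0 : h =ᶠ[𝓝 z₀] 0) :
    DifferentiableAt ℂ (cauchyTransform h) z₀ := by
  obtain ⟨r, hr, hball⟩ := Metric.eventually_nhds_iff_ball.1 h0
  have hfar : ∀ w, h w ≠ 0 → ∀ z ∈ Metric.ball z₀ (r / 2), r / 2 ≤ ‖z - w‖ := by
    intro w hw z hz
    have h1 : r ≤ dist w z₀ := by
      by_contra! hlt
      exact hw (hball w hlt)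
    have h2 : dist w z₀ ≤ dist w z + dist z z₀ := dist_triangle _ _ _
    have h3 : dist z z₀ < r / 2 := hz
    rw [← dist_eq_norm, dist_comm]
    linarith
  have hmeas : ∀ z : ℂ, AEStronglyMeasurable fun w => (z - w)⁻¹ • h w := fun z =>
    (show Measurable fun w : ℂ => (z - w)⁻¹ by fun_prop).aestronglyMeasurable.smul hi.1
  refine DifferentiableAt.const_smul ?_ _
  refine (hasDerivAt_integral_of_dominated_loc_of_deriv_le
    (F' := fun z w => (-((z - w) ^ 2)⁻¹) • h w) (bound := fun w => ((r / 2) ^ 2)⁻¹ * ‖h w‖)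
    (Metric.ball_mem_nhds z₀ (half_pos hr)) (Filter.Eventually.of_forall hmeas) ?_ ?_ ?_
    (hi.norm.const_mul _) ?_).2.differentiableAt
  · refine (hi.norm.const_mul (r / 2)⁻¹).mono' (hmeas z₀) (Filter.Eventually.of_forall fun w => ?_)
    by_cases hw : h w = 0
    · simp [hw]
    · rw [norm_smul, norm_inv]
      gcongr
      exact hfar w hw z₀ (Metric.mem_ball_self (half_pos hr))
  · exact (show Measurable fun w : ℂ => -((z₀ - w) ^ 2)⁻¹ by
      fun_prop).aestronglyMeasurable.smul hi.1
  · refine Filter.Eventually.of_forall fun w z hz => ?_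
    by_cases hw : h w = 0
    · simp [hw]
    · rw [norm_smul, norm_neg, norm_inv, norm_pow]
      gcongr
      exact hfar w hw z hz
  · refine Filter.Eventually.of_forall fun w z hz => ?_
    by_cases hw : h w = 0
    · simpa [hw] using hasDerivAt_const z (0 : E)
    · have hne : z - w ≠ 0 := fun h0 => by
        have := hfar w hw z hz
        rw [h0, norm_zero] at this
        linarith
      have h1 := ((hasDerivAt_id z).sub_const w).inv hne
      have h2 := h1.smul_const (h w)
      refine h2.congr_deriv ?_
      simp [neg_div]

theorem cauchyTransform_sub {h k : ℂ → E} (hh : ∀ z, Integrable fun w => (z - w)⁻¹ • h w)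
    (hk : ∀ z, Integrable fun w => (z - w)⁻¹ • k w) :
    cauchyTransform (h - k) = cauchyTransform h - cauchyTransform k := by
  ext z
  simp only [cauchyTransform, Pi.sub_apply, smul_sub]
  rw [integral_sub (hh z) (hk z), smul_sub]

theorem cauchyTransform_neg (h : ℂ → E) : cauchyTransform (-h) = -cauchyTransform h := by
  ext z
  simp [cauchyTransform, integral_neg]

theorem Filter.EventuallyEq.dbar {F G : ℂ → E} {z : ℂ} (h : F =ᶠ[𝓝 z] G) :
    dbar F =ᶠ[𝓝 z] dbar G := by
  filter_upwards [h.fderiv (𝕜 := ℝ)] with w hw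
  simp [_root_.dbar, hw]

theorem continuous_dbar {F : ℂ → E} (hF : ContDiff ℝ 1 F) : Continuous (dbar F) := by
  have := hF.continuous_fderiv one_ne_zero
  unfold dbar
  fun_prop

theorem HasCompactSupport.dbar {F : ℂ → E} (hF : HasCompactSupport F) :
    HasCompactSupport (dbar F) :=
  (hF.fderiv ℝ).comp_left
    (g := fun L : ℂ →L[ℝ] E => (2⁻¹ : ℂ) • (L 1 + Complex.I • L Complex.I)) (by simp)

/-- The Cauchy transform of `h` solves `∂u/∂z̄ = h` wherever that equation has a local solution. -/
theorem differentiableAt_sub_cauchyTransform [CompleteSpace E] {h F₀ : ℂ → E} {M ρ : ℝ}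
    (hm : AEStronglyMeasurable h) (hb : ∀ w, ‖h w‖ ≤ M) (hs : ∀ w, ρ < ‖w‖ → h w = 0) {z₀ : ℂ}
    (hF₀ : ContDiffAt ℝ 1 F₀ z₀) (he : h =ᶠ[𝓝 z₀] dbar F₀) :
    DifferentiableAt ℂ (F₀ - cauchyTransform h) z₀ := by
  -- Localize: `F = ψ F₀` has compact support, so it is the Cauchy transform of `dbar F`. Near `z₀`,
  -- therefore, `F₀ - cauchyTransform h` equals `-cauchyTransform (h - dbar F)`, and `h - dbar F`
  -- vanishes there. No regularity of `h` away from `z₀` is needed, which matters because `h` will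
  -- be cut off by an indicator function.
  obtain ⟨ε, hε, hball⟩ := Metric.eventually_nhds_iff_ball.1 (hF₀.eventually (by simp))
  let ψ : ContDiffBump z₀ := ⟨ε / 3, ε / 2, by positivity, by linarith⟩
  have hts : tsupport ψ ⊆ Metric.ball z₀ ε := by
    rw [ψ.tsupport_eq]
    exact Metric.closedBall_subset_ball (by change ε / 2 < ε; linarith)
  set F : ℂ → E := fun z => ψ z • F₀ z with hFdef
  have hF : ContDiff ℝ 1 F := by
    rw [contDiff_iff_contDiffAt]
    intro z
    by_cases hz : z ∈ tsupport ψ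
    · exact ψ.contDiff.contDiffAt.smul (hball z (hts hz))
    · refine (contDiffAt_const (c := (0 : E))).congr_of_eventuallyEq ?_
      filter_upwards [notMem_tsupport_iff_eventuallyEq.1 hz] with w hw
      simp [hFdef, hw]
  have hFc : HasCompactSupport F := ψ.hasCompactSupport.smul_right
  have hFF₀ : F =ᶠ[𝓝 z₀] F₀ := by
    filter_upwards [ψ.eventuallyEq_one] with w hw
    simp [hFdef, hw]
  have hdc := continuous_dbar hF
  obtain ⟨M', hM'⟩ := hFc.dbar.exists_bound_of_continuous hdc
  obtain ⟨ρ', hρ'⟩ := hFc.dbar.isBounded.subset_closedBall 0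
  have hs' : ∀ w, ρ' < ‖w‖ → dbar F w = 0 := fun w hw =>
    image_eq_zero_of_notMem_tsupport fun hmem => by
      have := mem_closedBall_zero_iff.1 (hρ' hmem)
      linarith
  have h1 : cauchyTransform (h - dbar F) = cauchyTransform h - F := by
    rw [cauchyTransform_sub (integrable_cauchyKernel_smul hm hb hs)
      (integrable_cauchyKernel_smul hdc.aestronglyMeasurable hM' hs'), cauchyTransform_dbar hF hFc]
  have hhi : Integrable h := by
    refine (((integrable_indicator_closedBall ρ).const_mul M).mono' hm
      (Filter.Eventually.of_forall fun w => ?_))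
    rcases le_or_gt ‖w‖ ρ with hw | hw
    · rw [Set.indicator_of_mem (by simpa using hw)]
      simpa using hb w
    · rw [hs w hw, norm_zero]
      exact mul_nonneg ((norm_nonneg _).trans (hb 0))
        (Set.indicator_nonneg (fun _ _ => zero_le_one) _)
  have h2 : DifferentiableAt ℂ (cauchyTransform (h - dbar F)) z₀ := by
    refine differentiableAt_cauchyTransform_of_eventuallyEq_zero
      (hhi.sub (hdc.integrable_of_hasCompactSupport hFc.dbar)) ?_
    filter_upwards [he, hFF₀.dbar] with w hw1 hw2
    simp [hw1, hw2]
  rw [h1] at h2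
  refine h2.neg.congr_of_eventuallyEq ?_
  filter_upwards [hFF₀] with w hw
  simp [hw]

/-- Leibniz rule, in which the term with `∂g/∂z̄` drops out because `g` is holomorphic. -/
theorem dbar_smul {χ : ℂ → ℂ} {g : ℂ → E} {z : ℂ} (hχ : DifferentiableAt ℝ χ z)
    (hg : DifferentiableAt ℂ g z) : dbar (fun w => χ w • g w) z = dbar χ z • g z := by
  have h1 := (hχ.hasFDerivAt.smul (hg.hasFDerivAt.restrictScalars ℝ)).fderiv
  rw [dbar, dbar, show (fun w => χ w • g w) = χ • g from rfl, h1]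
  have h3 : ∀ v, fderiv ℂ g z v = v • fderiv ℂ g z 1 := fun v => by
    rw [← map_smul, smul_eq_mul, mul_one]
  simp only [add_apply, smul_apply,
    ContinuousLinearMap.smulRight_apply, ContinuousLinearMap.coe_restrictScalars', smul_eq_mul]
  rw [h3 Complex.I]
  match_scalars
  · linear_combination (2⁻¹ * χ z) * Complex.I_mul_I
  · ring

end CauchyTransformBounds

/-! ### The additive Cousin problem with bounds, and Cartan's lemma near the identity -/

section BoundedCousin

open MeasureTheory

/-- The additive Cousin problem for the pair `L₁`, `L₂` has bounded solutions for bounded data with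
values in `E`. -/
def HasBoundedCousinSplitting (E : Type*) [NormedAddCommGroup E] [NormedSpace ℂ E]
    (L₁ L₂ : Set ℂ) : Prop :=
  ∃ C : ℝ, 0 ≤ C ∧ ∀ (g : ℂ → E) (M : ℝ), 0 ≤ M → DifferentiableOn ℂ g (L₁ ∩ L₂) →
    (∀ z ∈ L₁ ∩ L₂, ‖g z‖ ≤ M) → ∃ g₁ g₂ : ℂ → E,
      DifferentiableOn ℂ g₁ L₁ ∧ DifferentiableOn ℂ g₂ L₂ ∧
      (∀ z ∈ L₁ ∩ L₂, g z = g₁ z + g₂ z) ∧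
      (∀ z, ‖g₁ z‖ ≤ C * M) ∧ (∀ z, ‖g₂ z‖ ≤ C * M)

variable {E : Type*} [NormedAddCommGroup E] [NormedSpace ℂ E]

/-- Near every point of `L₁` the datum `dbar χ • g`, extended by zero, is `∂/∂z̄` of the extended `χ
• g`: on the overlap by the Leibniz rule, and near `L₁ \ L₂` because `χ` vanishes there. On the rest
of the boundary of the overlap the datum may jump, but those points are outside `L₁`. -/
theorem differentiableOn_indicator_sub_cauchyTransform [CompleteSpace E] {L₁ L₂ : Set ℂ}
    (h₁ : IsOpen L₁) (h₂ : IsOpen L₂) {ρ K : ℝ} (hρ : ∀ z ∈ L₁ ∩ L₂, ‖z‖ ≤ ρ) {χ : ℂ → ℂ}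
    (hχ : ContDiff ℝ 1 χ) (h0 : ∀ z ∈ L₁ \ L₂, χ =ᶠ[𝓝 z] 0) (hK : ∀ z ∈ L₁ ∩ L₂, ‖dbar χ z‖ ≤ K)
    {g : ℂ → E} {M : ℝ} (hM : 0 ≤ M) (hK0 : 0 ≤ K) (hg : DifferentiableOn ℂ g (L₁ ∩ L₂))
    (hgM : ∀ z ∈ L₁ ∩ L₂, ‖g z‖ ≤ M) :
    DifferentiableOn ℂ ((L₁ ∩ L₂).indicator (fun z => χ z • g z) -
      cauchyTransform ((L₁ ∩ L₂).indicator fun z => dbar χ z • g z)) L₁ := by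
  have hL : IsOpen (L₁ ∩ L₂) := h₁.inter h₂
  have hm : AEStronglyMeasurable ((L₁ ∩ L₂).indicator fun z => dbar χ z • g z) := by
    rw [aestronglyMeasurable_indicator_iff hL.measurableSet]
    exact ((continuous_dbar hχ).continuousOn.smul hg.continuousOn).aestronglyMeasurable
      hL.measurableSet
  have hb : ∀ w, ‖(L₁ ∩ L₂).indicator (fun z => dbar χ z • g z) w‖ ≤ K * M := by
    intro w
    by_cases hw : w ∈ L₁ ∩ L₂
    · rw [Set.indicator_of_mem hw, norm_smul]
      exact mul_le_mul (hK w hw) (hgM w hw) (norm_nonneg _) hK0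
    · rw [Set.indicator_of_notMem hw, norm_zero]
      positivity
  have hs : ∀ w, ρ < ‖w‖ → (L₁ ∩ L₂).indicator (fun z => dbar χ z • g z) w = 0 := fun w hw =>
    Set.indicator_of_notMem (fun h => (hρ w h).not_gt hw) _
  intro z hz
  refine (differentiableAt_sub_cauchyTransform hm hb hs ?_ ?_).differentiableWithinAt
  all_goals by_cases hz2 : z ∈ L₂
  · have hgz : ContDiffAt ℝ 1 g z :=
      ((hg.analyticOnNhd hL z ⟨hz, hz2⟩).contDiffAt (n := 1)).restrict_scalars ℝ
    refine (hχ.contDiffAt.smul hgz).congr_of_eventuallyEq ?_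
    filter_upwards [hL.mem_nhds ⟨hz, hz2⟩] with w hw
    rw [Set.indicator_of_mem hw, Pi.smul_apply']
  · refine (contDiffAt_const (c := (0 : E))).congr_of_eventuallyEq ?_
    filter_upwards [h0 z ⟨hz, hz2⟩] with w hw
    rw [Set.indicator_apply_eq_zero]
    simp [hw]
  · have h1 : (L₁ ∩ L₂).indicator (fun z => χ z • g z) =ᶠ[𝓝 z] fun z => χ z • g z := by
      filter_upwards [hL.mem_nhds ⟨hz, hz2⟩] with w hw
      rw [Set.indicator_of_mem hw]
    filter_upwards [h1.dbar, hL.mem_nhds ⟨hz, hz2⟩] with w hw hwL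
    rw [hw, Set.indicator_of_mem hwL, dbar_smul ((hχ.differentiable one_ne_zero) w)
      (hg.differentiableAt (hL.mem_nhds hwL))]
  · have h1 : (L₁ ∩ L₂).indicator (fun z => χ z • g z) =ᶠ[𝓝 z] fun _ => (0 : E) := by
      filter_upwards [h0 z ⟨hz, hz2⟩] with w hw
      rw [Set.indicator_apply_eq_zero]
      simp [hw]
    filter_upwards [h1.dbar, (h0 z ⟨hz, hz2⟩).dbar] with w hw hw2
    rw [hw, Set.indicator_apply_eq_zero.2]
    · simp [dbar]
    · intro _
      rw [hw2]
      simp [dbar]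

/-- The bounded additive Cousin problem is solvable whenever there is a smooth cutoff function
separating `L₁ \ L₂` from `L₂ \ L₁`. -/
theorem hasBoundedCousinSplitting_of_cutoff [CompleteSpace E] {L₁ L₂ : Set ℂ}
    (h₁ : IsOpen L₁) (h₂ : IsOpen L₂) (hL : Bornology.IsBounded (L₁ ∩ L₂)) {χ : ℂ → ℂ}
    (hχ : ContDiff ℝ 1 χ) (h0 : ∀ z ∈ L₁ \ L₂, χ =ᶠ[𝓝 z] 0) (h1 : ∀ z ∈ L₂ \ L₁, χ =ᶠ[𝓝 z] 1) :
    HasBoundedCousinSplitting E L₁ L₂ := by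
  obtain ⟨ρ, hρ⟩ := hL.subset_closedBall 0
  have hρ' : ∀ z ∈ L₁ ∩ L₂, ‖z‖ ≤ ρ := fun z hz => mem_closedBall_zero_iff.1 (hρ hz)
  have hcpt := isCompact_closedBall (0 : ℂ) ρ
  obtain ⟨K, hK⟩ := hcpt.exists_bound_of_continuousOn (continuous_dbar hχ).continuousOn
  obtain ⟨B, hB⟩ := hcpt.exists_bound_of_continuousOn hχ.continuous.continuousOn
  obtain ⟨C, hC, hCT⟩ := exists_norm_cauchyTransform_le (E := E) ρ
  have hdb : dbar (fun z => 1 - χ z) = -dbar χ := by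
    ext z
    simp only [dbar, Pi.neg_apply, fderiv_const_sub]
    simp
    ring
  refine ⟨(1 + |B|) + C * |K|, by positivity, fun g M hM hg hgM => ?_⟩
  have hb : ∀ w, ‖(L₁ ∩ L₂).indicator (fun z => dbar χ z • g z) w‖ ≤ |K| * M := by
    intro w
    by_cases hw : w ∈ L₁ ∩ L₂
    · rw [Set.indicator_of_mem hw, norm_smul]
      exact mul_le_mul ((hK w (hρ hw)).trans (le_abs_self _)) (hgM w hw) (norm_nonneg _)
        (abs_nonneg _)
    · rw [Set.indicator_of_notMem hw, norm_zero]
      positivity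
  have hs : ∀ w, ρ < ‖w‖ → (L₁ ∩ L₂).indicator (fun z => dbar χ z • g z) w = 0 := fun w hw =>
    Set.indicator_of_notMem (fun h => (hρ' w h).not_gt hw) _
  have hu := hCT _ _ hb hs
  have hind : ∀ η : ℂ → ℂ, (∀ z ∈ L₁ ∩ L₂, ‖η z‖ ≤ 1 + |B|) → ∀ z,
      ‖(L₁ ∩ L₂).indicator (fun z => η z • g z) z‖ ≤ (1 + |B|) * M := by
    intro η hη z
    by_cases hz : z ∈ L₁ ∩ L₂
    · rw [Set.indicator_of_mem hz, norm_smul]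
      exact mul_le_mul (hη z hz) (hgM z hz) (norm_nonneg _) (by positivity)
    · rw [Set.indicator_of_notMem hz, norm_zero]
      positivity
  have hχB : ∀ z ∈ L₁ ∩ L₂, ‖χ z‖ ≤ |B| := fun z hz => (hB z (hρ hz)).trans (le_abs_self _)
  -- `χ g` and `(1 - χ) g` add up to `g` and have opposite `∂/∂z̄`, so one Cauchy transform, used
  -- with opposite signs, corrects both.
  refine ⟨(L₁ ∩ L₂).indicator (fun z => χ z • g z) -
      cauchyTransform ((L₁ ∩ L₂).indicator fun z => dbar χ z • g z),
    (L₁ ∩ L₂).indicator (fun z => (1 - χ z) • g z) +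
      cauchyTransform ((L₁ ∩ L₂).indicator fun z => dbar χ z • g z), ?_, ?_, ?_, ?_, ?_⟩
  · exact differentiableOn_indicator_sub_cauchyTransform h₁ h₂ hρ' hχ h0
      (fun z hz => (hK z (hρ hz)).trans (le_abs_self K)) hM (abs_nonneg K) hg hgM
  -- The second half follows from the first with `L₁`, `L₂` exchanged and `1 - χ` in place of `χ`.
  · rw [Set.inter_comm] at hρ' hg hgM
    have := differentiableOn_indicator_sub_cauchyTransform (χ := fun z => 1 - χ z) (K := |K|)
      h₂ h₁ hρ' (contDiff_const.sub hχ)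
      (fun z hz => by
        filter_upwards [h1 z hz] with w hw
        simp [hw]) (fun z hz => by
        rw [hdb, Pi.neg_apply, norm_neg]
        exact (hK z (hρ (Set.inter_comm L₁ L₂ ▸ hz))).trans (le_abs_self K))
      hM (abs_nonneg K) hg hgM
    have he : ((L₂ ∩ L₁).indicator fun z => dbar (fun z => 1 - χ z) z • g z) =
        -((L₂ ∩ L₁).indicator fun z => dbar χ z • g z) := by
      rw [← Set.indicator_neg']
      congr 1
      ext z
      simp [hdb]
    rw [he, cauchyTransform_neg, sub_neg_eq_add, Set.inter_comm] at this
    exact this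
  · intro z hz
    simp only [Pi.sub_apply, Pi.add_apply, Set.indicator_of_mem hz]
    module
  · intro z
    have h3 := hind χ (fun z hz => (hχB z hz).trans (by linarith)) z
    calc _ ≤ _ := norm_sub_le _ _
      _ ≤ (1 + |B|) * M + C * (|K| * M) := add_le_add h3 (hu z)
      _ = _ := by ring
  · intro z
    have h3 := hind (fun z => 1 - χ z) (fun z hz => (norm_sub_le _ _).trans (by
      rw [norm_one]; linarith [hχB z hz])) z
    calc _ ≤ _ := norm_add_le _ _
      _ ≤ (1 + |B|) * M + C * (|K| * M) := add_le_add h3 (hu z)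
      _ = _ := by ring

/-- **Cartan's lemma** near the identity, without loss of domain. -/
theorem HasBoundedCousinSplitting.exists_factorization {𝔸 : Type*} [NormedRing 𝔸]
    [NormedAlgebra ℂ 𝔸] [CompleteSpace 𝔸] {L₁ L₂ : Set ℂ} (h₁ : IsOpen L₁) (h₂ : IsOpen L₂)
    (hsplit : HasBoundedCousinSplitting 𝔸 L₁ L₂) {η : ℝ} (hη : 0 < η) :
    ∃ ε : ℝ, 0 < ε ∧ ∀ S : ℂ → 𝔸, DifferentiableOn ℂ S (L₁ ∩ L₂) →
      (∀ z ∈ L₁ ∩ L₂, ‖S z‖ ≤ ε) → ∃ a b : ℂ → 𝔸,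
        DifferentiableOn ℂ a L₁ ∧ DifferentiableOn ℂ b L₂ ∧
        (∀ z, ‖a z‖ ≤ η) ∧ (∀ z, ‖b z‖ ≤ η) ∧
        ∀ z ∈ L₁ ∩ L₂, (1 + b z) * (1 + S z) = 1 + a z := by
  obtain ⟨C, hC, hsp⟩ := hsplit
  -- The first bound halves the error at each step of the iteration; the second keeps the sum of the
  -- corrections, at most `2 C ε`, below `η`.
  set ε := min (1 / (2 * (C + 1))) (η / (2 * (C + 1))) with hε
  have hε0 : 0 < ε := by positivity
  have hCε : C * ε ≤ 1 / 2 := by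
    have : ε ≤ 1 / (2 * (C + 1)) := min_le_left _ _
    rw [le_div_iff₀ (by positivity)] at this
    nlinarith
  have hCη : 2 * (C * ε) ≤ η := by
    have : ε ≤ η / (2 * (C + 1)) := min_le_right _ _
    rw [le_div_iff₀ (by positivity)] at this
    nlinarith
  refine ⟨ε, hε0, fun S hS hSε => ?_⟩
  choose! g₁ g₂ hd₁ hd₂ hsum hb₁ hb₂ using hsp
  -- Start with `g₀ = -S`, split `gₖ = aₖ + bₖ`, and put `gₖ₊₁ = -bₖ S`. The splitting comes from a
  -- choice depending on the function and its bound, so the bound `ε / 2^k` is carried along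
  -- explicitly. Each splitting lives on all of `L₁` and `L₂`, so no domain is lost in the limit.
  let step : (ℂ → 𝔸) × ℕ → ℂ → 𝔸 := fun p z => -(g₂ p.1 (ε * 2⁻¹ ^ p.2) z * S z)
  let g : ℕ → ℂ → 𝔸 := fun k => Nat.rec (fun z => -S z) (fun k gk => step (gk, k)) k
  have hg0 : g 0 = fun z => -S z := rfl
  have hgs : ∀ k, g (k + 1) = fun z => -(g₂ (g k) (ε * 2⁻¹ ^ k) z * S z) := fun k => rfl
  have hMk : ∀ k : ℕ, 0 ≤ ε * (2⁻¹ : ℝ) ^ k := fun k => by positivity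
  have hgk : ∀ k, DifferentiableOn ℂ (g k) (L₁ ∩ L₂) ∧
      ∀ z ∈ L₁ ∩ L₂, ‖g k z‖ ≤ ε * 2⁻¹ ^ k := by
    intro k
    induction k with
    | zero =>
      rw [hg0]
      exact ⟨hS.neg, fun z hz => by simpa using hSε z hz⟩
    | succ k ih =>
      rw [hgs]
      refine ⟨(((hd₂ _ _ (hMk k) ih.1 ih.2).mono Set.inter_subset_right).mul hS).neg,
        fun z hz => ?_⟩
      rw [norm_neg]
      calc _ ≤ ‖g₂ (g k) (ε * 2⁻¹ ^ k) z‖ * ‖S z‖ := norm_mul_le _ _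
        _ ≤ (C * (ε * 2⁻¹ ^ k)) * ε :=
          mul_le_mul (hb₂ _ _ (hMk k) ih.1 ih.2 z) (hSε z hz) (norm_nonneg _)
            (mul_nonneg hC (hMk k))
        _ = (C * ε) * (ε * 2⁻¹ ^ k) := by ring
        _ ≤ 1 / 2 * (ε * 2⁻¹ ^ k) := mul_le_mul_of_nonneg_right hCε (hMk k)
        _ = ε * 2⁻¹ ^ (k + 1) := by ring
  have hsumm : Summable fun k : ℕ => C * (ε * (2⁻¹ : ℝ) ^ k) :=
    ((summable_geometric_of_lt_one (by norm_num) (by norm_num)).mul_left ε).mul_left C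
  have htsum : ∑' k : ℕ, C * (ε * (2⁻¹ : ℝ) ^ k) = 2 * (C * ε) := by
    rw [tsum_mul_left, tsum_mul_left, tsum_geometric_of_lt_one (by norm_num) (by norm_num)]
    norm_num
    ring
  let a₁ : ℕ → ℂ → 𝔸 := fun k => g₁ (g k) (ε * 2⁻¹ ^ k)
  let b₂ : ℕ → ℂ → 𝔸 := fun k => g₂ (g k) (ε * 2⁻¹ ^ k)
  have hba : ∀ k z, ‖a₁ k z‖ ≤ C * (ε * 2⁻¹ ^ k) := fun k z =>
    hb₁ _ _ (hMk k) (hgk k).1 (hgk k).2 z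
  have hbb : ∀ k z, ‖b₂ k z‖ ≤ C * (ε * 2⁻¹ ^ k) := fun k z =>
    hb₂ _ _ (hMk k) (hgk k).1 (hgk k).2 z
  have hsa : ∀ z, Summable fun k => a₁ k z := fun z => hsumm.of_norm_bounded fun k => hba k z
  have hsb : ∀ z, Summable fun k => b₂ k z := fun z => hsumm.of_norm_bounded fun k => hbb k z
  refine ⟨fun z => -∑' k, a₁ k z, fun z => ∑' k, b₂ k z, ?_, ?_, ?_, ?_, ?_⟩
  · exact (Complex.differentiableOn_tsum_of_summable_norm hsumm
      (fun k => hd₁ _ _ (hMk k) (hgk k).1 (hgk k).2) h₁ fun k z _ => hba k z).neg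
  · exact Complex.differentiableOn_tsum_of_summable_norm hsumm
      (fun k => hd₂ _ _ (hMk k) (hgk k).1 (hgk k).2) h₂ fun k z _ => hbb k z
  · intro z
    rw [norm_neg]
    exact (tsum_of_norm_bounded hsumm.hasSum fun k => hba k z).trans (htsum.le.trans hCη)
  · intro z
    exact (tsum_of_norm_bounded hsumm.hasSum fun k => hbb k z).trans (htsum.le.trans hCη)
  · intro z hz
    have hadd : ∀ k, g k z = a₁ k z + b₂ k z := fun k =>
      hsum _ _ (hMk k) (hgk k).1 (hgk k).2 z hz
    have hsg : Summable fun k => g k z := by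
      simp only [hadd]
      exact (hsa z).add (hsb z)
    have h3 : ∑' k, g k z = ∑' k, a₁ k z + ∑' k, b₂ k z := by
      simp only [hadd]
      exact (hsa z).tsum_add (hsb z)
    -- Summing the recursion gives `∑ aₖ + ∑ bₖ = -S - (∑ bₖ) S`, which is the desired product
    -- formula with `b = ∑ bₖ` and `a = -∑ aₖ`.
    have h4 : ∑' k, g k z = -S z - (∑' k, b₂ k z) * S z := by
      rw [hsg.tsum_eq_zero_add, ← (hsb z).tsum_mul_right]
      simp only [hgs, hg0]
      rw [tsum_neg, sub_eq_add_neg]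
    rw [h3] at h4
    have h5 : ∑' k, a₁ k z = -S z - (∑' k, b₂ k z) * S z - ∑' k, b₂ k z := by
      rw [← h4, add_sub_cancel_right]
    beta_reduce
    rw [h5]
    noncomm_ring

end BoundedCousin

/-! ### Runge approximation by rational functions -/

section Runge

open MeasureTheory

/-- The restrictions to `K` of the rational functions without poles in `K`. -/
def rationalFunctionsOn (K : Set ℂ) : Submodule ℂ C(K, ℂ) where
  carrier := {r | ∃ p q : Polynomial ℂ, ∀ z : K, q.eval (z : ℂ) ≠ 0 ∧
    r z = p.eval (z : ℂ) / q.eval (z : ℂ)}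
  zero_mem' := ⟨0, 1, fun z => by simp⟩
  add_mem' := by
    rintro r s ⟨p, q, hr⟩ ⟨p', q', hs⟩
    refine ⟨p * q' + q * p', q * q', fun z => ⟨?_, ?_⟩⟩
    · simp [(hr z).1, (hs z).1]
    · simp [(hr z).2, (hs z).2, div_add_div _ _ (hr z).1 (hs z).1]
  smul_mem' := by
    rintro c r ⟨p, q, hr⟩
    refine ⟨Polynomial.C c * p, q, fun z => ⟨(hr z).1, ?_⟩⟩
    simp [(hr z).2, mul_div_assoc]

/-- A closed convex set contains averages of its points, and the integral is a multiple of an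
average. -/
theorem Submodule.integral_mem_of_isClosed {X E : Type*} [MeasurableSpace X]
    [NormedAddCommGroup E] [NormedSpace ℂ E] [CompleteSpace E] (S : Submodule ℂ E)
    (hS : IsClosed (S : Set E)) {μ : Measure X} [IsFiniteMeasure μ] {f : X → E}
    (hf : Integrable f μ) (h : ∀ x, f x ∈ S) : ∫ x, f x ∂μ ∈ S := by
  rcases eq_or_ne μ 0 with rfl | hμ
  · simp
  · have : NeZero μ := ⟨hμ⟩
    have h1 : (⨍ x, f x ∂μ) ∈ (S.restrictScalars ℝ : Set E) :=
      Convex.average_mem (S.restrictScalars ℝ).convex hS (Filter.Eventually.of_forall h) hf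
    rw [← measure_smul_average]
    exact (S.restrictScalars ℝ).smul_mem _ h1

/-- **Runge's theorem**: a function which is holomorphic near a compact set can be uniformly
approximated there by rational functions. -/
theorem exists_rational_approx {K U : Set ℂ} (hK : IsCompact K) (hU : IsOpen U) (hKU : K ⊆ U)
    {f : ℂ → ℂ} (hf : DifferentiableOn ℂ f U) {ε : ℝ} (hε : 0 < ε) :
    ∃ p q : Polynomial ℂ, ∀ z ∈ K, q.eval z ≠ 0 ∧ ‖f z - p.eval z / q.eval z‖ < ε := by
  obtain ⟨K', hK', hKK', hK'U⟩ := exists_compact_between hK hU hKU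
  obtain ⟨ψ, hψ1, hψ0, -⟩ := exists_contMDiffMap_one_nhds_of_subset_interior 𝓘(ℝ, ℂ) (n := 1)
    hK.isClosed hKK'
  have hψ : ContDiff ℝ 1 ψ := ψ.contMDiff.contDiff
  set F : ℂ → ℂ := fun z => (ψ z : ℂ) • f z with hFdef
  have hsupp : tsupport ψ ⊆ K' := closure_minimal (fun z hz => by
    by_contra h
    exact hz (hψ0 z h)) hK'.isClosed
  have hψc : HasCompactSupport ψ := hK'.of_isClosed_subset (isClosed_tsupport _) hsupp
  have hF : ContDiff ℝ 1 F := by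
    rw [contDiff_iff_contDiffAt]
    intro z
    by_cases hz : z ∈ tsupport ψ
    · have hfz : ContDiffAt ℝ 1 f z :=
        ((hf.analyticOnNhd hU z (hK'U (hsupp hz))).contDiffAt (n := 1)).restrict_scalars ℝ
      exact (Complex.ofRealCLM.contDiff.comp hψ).contDiffAt.smul hfz
    · refine (contDiffAt_const (c := (0 : ℂ))).congr_of_eventuallyEq ?_
      filter_upwards [notMem_tsupport_iff_eventuallyEq.1 hz] with w hw
      simp [hFdef, hw]
  have hFc : HasCompactSupport F := hψc.mono fun z hz => by
    contrapose! hz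
    simp only [Function.mem_support, not_not] at hz ⊢
    simp [hFdef, hz]
  have hFf : ∀ z ∈ K, F =ᶠ[𝓝 z] f := fun z hz => by
    filter_upwards [Filter.Eventually.filter_mono (nhds_le_nhdsSet hz) hψ1] with w hw
    simp [hFdef, hw]
  set Q : Set ℂ := tsupport (dbar F) with hQdef
  have hQ : IsCompact Q := hFc.dbar
  have hQK : ∀ w ∈ Q, w ∉ K := by
    intro w hw hwK
    refine notMem_tsupport_iff_eventuallyEq.2 ?_ hw
    filter_upwards [(hFf w hwK).dbar, hU.mem_nhds (hKU hwK)] with v hv hvU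
    have hd := hf.differentiableAt (hU.mem_nhds hvU)
    have h1 := dbar_smul (χ := fun _ => (1 : ℂ)) (differentiableAt_const _) hd
    simp only [one_smul] at h1
    rw [hv, h1]
    simp [dbar]
  have : CompactSpace K := isCompact_iff_compactSpace.1 hK
  have : CompactSpace Q := isCompact_iff_compactSpace.1 hQ
  have hQm : MeasurableSet Q := (isClosed_tsupport _).measurableSet
  let μ : Measure Q := volume.comap ((↑) : Q → ℂ)
  have hμ : IsFiniteMeasure μ := by
    refine ⟨?_⟩
    rw [comap_subtype_coe_apply hQm]
    simpa using hQ.measure_lt_top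
  -- The Cauchy–Pompeiu formula for `F` is read as a Bochner integral in `C(K, ℂ)` over the support
  -- `Q` of `dbar F`. Since `Q` misses `K`, each value of the integrand is a rational function with
  -- its pole off `K`, so the integral lies in the closure of the rational functions.
  let κ : C(Q × K, ℂ) := ⟨fun p => ((p.2 : ℂ) - p.1)⁻¹ • dbar F p.1, by
    have hd := continuous_dbar hF
    have hne : ∀ p : Q × K, (p.2 : ℂ) - p.1 ≠ 0 := fun p h =>
      hQK p.1 p.1.2 (by rw [← sub_eq_zero.1 h]; exact p.2.2)
    exact (Continuous.inv₀ (by fun_prop) hne).smul (by fun_prop)⟩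
  have hint : Integrable κ.curry μ := by
    refine .of_bound κ.curry.continuous.aestronglyMeasurable ‖κ.curry‖
      (Filter.Eventually.of_forall fun w => κ.curry.norm_coe_le_norm w)
  set S := (rationalFunctionsOn K).topologicalClosure
  have hmem : (Real.pi : ℂ)⁻¹ • ∫ w, κ.curry w ∂μ ∈ S := by
    refine S.smul_mem _ (S.integral_mem_of_isClosed
      (Submodule.isClosed_topologicalClosure _) hint fun w => ?_)
    refine Submodule.le_topologicalClosure _
      ⟨Polynomial.C (dbar F w), Polynomial.X - Polynomial.C (w : ℂ), fun z => ⟨?_, ?_⟩⟩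
    · have : (z : ℂ) - w ≠ 0 := fun h => hQK w w.2 (by rw [← sub_eq_zero.1 h]; exact z.2)
      simpa using this
    · simp [κ, div_eq_inv_mul]
  have hval : ∀ z : K, ((Real.pi : ℂ)⁻¹ • ∫ w, κ.curry w ∂μ) z = f z := by
    intro z
    have h1 : (∫ w, κ.curry w ∂μ) z = ∫ w, κ.curry w z ∂μ :=
      ((ContinuousMap.evalCLM ℂ z).integral_comp_comm hint).symm
    have h2 : ∫ w, κ.curry w z ∂μ = ∫ w in Q, ((z : ℂ) - w)⁻¹ • dbar F w :=
      integral_subtype_comap hQm fun w : ℂ => ((z : ℂ) - w)⁻¹ • dbar F w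
    have h3 : ∫ w in Q, ((z : ℂ) - w)⁻¹ • dbar F w = ∫ w, ((z : ℂ) - w)⁻¹ • dbar F w :=
      setIntegral_eq_integral_of_forall_compl_eq_zero fun w hw => by
        rw [image_eq_zero_of_notMem_tsupport hw, smul_zero]
    rw [ContinuousMap.smul_apply, h1, h2, h3]
    have := congrFun (cauchyTransform_dbar hF hFc) z
    rw [cauchyTransform] at this
    rw [this, (hFf z z.2).eq_of_nhds]
  obtain ⟨r, ⟨p, q, hr⟩, hdist⟩ := Metric.mem_closure_iff.1 hmem ε hε
  refine ⟨p, q, fun z hz => ⟨(hr ⟨z, hz⟩).1, ?_⟩⟩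
  have h1 := (ContinuousMap.dist_apply_le_dist (⟨z, hz⟩ : K)).trans_lt hdist
  rw [hval, (hr ⟨z, hz⟩).2, dist_eq_norm] at h1
  exact h1

end Runge

/-! ### Polynomial matrices: column reduction and splitting off zeros of determinants -/

section PolynomialMatrices

open Polynomial Matrix

/-- The value of a polynomial matrix at a point. -/
noncomputable abbrev evalMatrix {n : ℕ} (z : ℂ) :
    Matrix (Fin n) (Fin n) ℂ[X] →+* Matrix (Fin n) (Fin n) ℂ :=
  (evalRingHom z).mapMatrix

theorem det_evalMatrix {n : ℕ} (z : ℂ) (S : Matrix (Fin n) (Fin n) ℂ[X]) :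
    (evalMatrix z S).det = S.det.eval z :=
  (RingHom.map_det (evalRingHom z) S).symm

theorem det_one_updateRow {n : ℕ} {R : Type*} [CommRing R] (i : Fin n) (v : Fin n → R) :
    ((1 : Matrix (Fin n) (Fin n) R).updateRow i v).det = v i := by
  rw [← cramer_transpose_apply, transpose_one, cramer_one]
  rfl

theorem det_one_updateCol {n : ℕ} {R : Type*} [CommRing R] (i : Fin n) (v : Fin n → R) :
    ((1 : Matrix (Fin n) (Fin n) R).updateCol i v).det = v i := by
  rw [← cramer_apply, cramer_one]
  rfl

/-- A root in `A` is not in `B`, so its linear factor can be moved into `q₂`; what remains when no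
root in `A` is left is `q₁`. -/
theorem Polynomial.exists_mul_of_no_common_roots (A B : Set ℂ) (q : ℂ[X]) (hq : q ≠ 0)
    (h : ∀ z ∈ A ∩ B, q.eval z ≠ 0) :
    ∃ q₁ q₂ : ℂ[X], q = q₁ * q₂ ∧ (∀ z ∈ A, q₁.eval z ≠ 0) ∧ ∀ z ∈ B, q₂.eval z ≠ 0 := by
  induction hd : q.natDegree using Nat.strong_induction_on generalizing q with
  | _ d ih =>
    by_cases hA : ∀ z ∈ A, q.eval z ≠ 0
    · exact ⟨q, 1, by simp, hA, by simp⟩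
    · push Not at hA
      obtain ⟨a, haA, ha⟩ := hA
      obtain ⟨p, rfl⟩ := dvd_iff_isRoot.2 ha
      have hp : p ≠ 0 := right_ne_zero_of_mul hq
      have hdeg : p.natDegree < d := by
        rw [← hd, natDegree_mul (X_sub_C_ne_zero a) hp, natDegree_X_sub_C]
        omega
      obtain ⟨q₁, q₂, rfl, h₁, h₂⟩ := ih _ hdeg p hp
        (fun z hz => right_ne_zero_of_mul (by simpa using h z hz)) rfl
      refine ⟨q₁, (X - C a) * q₂, by ring, h₁, fun z hz => ?_⟩
      have hza : z - a ≠ 0 := fun h0 => by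
        rw [sub_eq_zero.1 h0] at hz
        exact h a ⟨haA, hz⟩ ha
      simpa [hza] using h₂ z hz

/-- A polynomial matrix with nonzero determinant can be column reduced by unimodular column
operations. -/
theorem exists_column_reduction {n : ℕ} (S : Matrix (Fin n) (Fin n) ℂ[X]) (hS : S.det ≠ 0) :
    ∃ (W V : Matrix (Fin n) (Fin n) ℂ[X]) (k : Fin n → ℕ), IsUnit V.det ∧
      (evalMatrix 0 W).det ≠ 0 ∧
      ∀ z : ℂ, z ≠ 0 → evalMatrix z (S * V) = evalMatrix z⁻¹ W * diagonal fun i => z ^ k i := by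
  obtain ⟨k, hk⟩ : ∃ k : Fin n → ℕ, ∀ i j, (S i j).natDegree ≤ k j :=
    ⟨fun j => Finset.univ.sup fun i => (S i j).natDegree, fun i j =>
      Finset.le_sup (f := fun i => (S i j).natDegree) (Finset.mem_univ i)⟩
  induction hN : ∑ j, k j using Nat.strong_induction_on generalizing S k with
  | _ N ih =>
    -- The coefficients at the prescribed column degree bounds `k j`. If this matrix is singular, a
    -- kernel vector lets the top coefficients cancel in a column of largest bound among those
    -- involved, and the sum of the bounds drops. If not, it is the value at `0` of the matrix `W`
    -- sought.
    let Lc : Matrix (Fin n) (Fin n) ℂ := of fun i j => (S i j).coeff (k j)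
    by_cases hLc : Lc.det = 0
    · obtain ⟨v, hv0, hv⟩ := exists_mulVec_eq_zero_iff.2 hLc
      obtain ⟨j₁, hj₁⟩ := Function.ne_iff.1 hv0
      obtain ⟨j₀, hj₀, hmax⟩ := Finset.exists_max_image (Finset.univ.filter fun j => v j ≠ 0) k
        ⟨j₁, by simpa using hj₁⟩
      have hvj₀ : v j₀ ≠ 0 := (Finset.mem_filter.1 hj₀).2
      have hle : ∀ j, v j ≠ 0 → k j ≤ k j₀ := fun j hj => hmax j (by simpa using hj)
      let w : Fin n → ℂ[X] := fun j => C (v j) * X ^ (k j₀ - k j)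
      let V₁ : Matrix (Fin n) (Fin n) ℂ[X] := (1 : Matrix (Fin n) (Fin n) ℂ[X]).updateCol j₀ w
      have hV₁ : V₁.det = C (v j₀) := by simp [V₁, det_one_updateCol, w]
      have hV₁u : IsUnit V₁.det := by
        rw [hV₁, isUnit_C]
        exact hvj₀.isUnit
      have hSV : S * V₁ = S.updateCol j₀ (S *ᵥ w) := by
        ext1 i j
        by_cases hj : j = j₀
        · subst hj
          simp [V₁, mul_apply, mulVec, dotProduct]
        · simp [V₁, mul_apply, hj, one_apply]
      have hcoeff : ∀ i m, k j₀ ≤ m → ((S *ᵥ w) i).coeff m = 0 := by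
        intro i m hm
        have h1 : ∀ j, (S i j * w j).coeff m = if m = k j₀ then Lc i j * v j else 0 := by
          intro j
          by_cases hvj : v j = 0
          · simp [w, hvj]
          have hkj := hle j hvj
          have h2 : (S i j * w j).coeff m = (S i j).coeff (m - (k j₀ - k j)) * v j := by
            rw [show S i j * w j = S i j * C (v j) * X ^ (k j₀ - k j) by simp only [w]; ring,
              coeff_mul_X_pow', if_pos (by omega), coeff_mul_C]
          rw [h2]
          split_ifs with h
          · rw [show m - (k j₀ - k j) = k j by omega]
            rfl
          · rw [coeff_eq_zero_of_natDegree_lt, zero_mul]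
            have := hk i j
            omega
        rw [mulVec, dotProduct, finsetSum_coeff]
        simp only [h1]
        split_ifs
        · exact congrFun hv i
        · simp
      have hdetSV : (S * V₁).det ≠ 0 := by
        rw [det_mul]
        exact mul_ne_zero hS hV₁u.ne_zero
      -- With bound `0` the cancellation would make the new column zero, contradicting the nonzero
      -- determinant; hence the bound can be lowered by one.
      have hpos : 0 < k j₀ := by
        by_contra! h0
        refine hdetSV (det_eq_zero_of_column_eq_zero j₀ fun i => ?_)
        rw [hSV, updateCol_self]
        ext m
        exact hcoeff i m (by omega)
      obtain ⟨W, V, k', hV, hW, h⟩ := ih (∑ j, Function.update k j₀ (k j₀ - 1) j) (by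
        rw [← hN]
        refine Finset.sum_lt_sum (fun j _ => ?_) ⟨j₀, Finset.mem_univ _, ?_⟩
        · by_cases hj : j = j₀
          · subst hj; simp
          · simp [hj]
        · simpa using hpos) (S * V₁) hdetSV (Function.update k j₀ (k j₀ - 1)) (by
        intro i j
        rw [hSV]
        by_cases hj : j = j₀
        · subst hj
          rw [updateCol_self, Function.update_self, natDegree_le_iff_coeff_eq_zero]
          intro m hm
          exact hcoeff i m (by omega)
        · rw [updateCol_ne hj, Function.update_of_ne hj]
          exact hk i j) rfl
      refine ⟨W, V₁ * V, k', by rw [det_mul]; exact hV₁u.mul hV, hW, fun z hz => ?_⟩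
      rw [← Matrix.mul_assoc]
      exact h z hz
    · refine ⟨of fun i j => reflect (k j) (S i j), 1, k, by simp, ?_, fun z hz => ?_⟩
      · convert hLc using 2
        ext i j
        change eval 0 (reflect (k j) (S i j)) = (S i j).coeff (k j)
        rw [← coeff_zero_eq_eval_zero, coeff_reflect, revAt_zero]
      · ext i j
        let _ := invertibleOfNonzero hz
        have := eval₂_reflect_mul_pow (RingHom.id ℂ) z (k j) (S i j) (hk i j)
        rw [invOf_eq_inv] at this
        rw [Matrix.mul_one, mul_diagonal]
        exact this.symm

/-- Zeros of the determinant of a holomorphic matrix can be split off as a polynomial factor. -/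
theorem exists_polynomial_mul_of_det_eq {n : ℕ} {L : Set ℂ} (hL : IsOpen L) (p : ℂ[X])
    (hp : p ≠ 0) (M : ℂ → Matrix (Fin n) (Fin n) ℂ)
    (hM : ∀ i j, DifferentiableOn ℂ (fun z => M z i j) L) (u : ℂ → ℂ) (hu : ContinuousOn u L)
    (hu0 : ∀ z ∈ L, u z ≠ 0) (hdet : ∀ z ∈ L, (M z).det = p.eval z * u z) :
    ∃ (S : Matrix (Fin n) (Fin n) ℂ[X]) (E : ℂ → Matrix (Fin n) (Fin n) ℂ),
      MemGLHolomorphic L E ∧ (∀ z ∈ L, M z = evalMatrix z S * E z) ∧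
      ∀ z, S.det.eval z = 0 → z ∈ L ∧ p.eval z = 0 := by
  induction hd : p.natDegree using Nat.strong_induction_on generalizing p M u with
  | _ d ih =>
    by_cases hL0 : ∀ z ∈ L, p.eval z ≠ 0
    · refine ⟨1, M, ⟨hM, fun z hz => ?_⟩, by simp, by simp⟩
      rw [isUnit_iff_isUnit_det, isUnit_iff_ne_zero, hdet z hz]
      exact mul_ne_zero (hL0 z hz) (hu0 z hz)
    push Not at hL0
    obtain ⟨a, haL, ha⟩ := hL0
    obtain ⟨p₁, rfl⟩ := dvd_iff_isRoot.2 ha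
    have hp₁ : p₁ ≠ 0 := right_ne_zero_of_mul hp
    have hdeg : p₁.natDegree < d := by
      rw [← hd, natDegree_mul (X_sub_C_ne_zero a) hp₁, natDegree_X_sub_C]
      omega
    -- At a zero `a` of the determinant some row combination `v ᵥ* M z` vanishes at `a`. Replacing a
    -- row with nonzero weight in `v` by this combination divided by `z - a` keeps the matrix
    -- holomorphic and removes one factor `z - a` from the determinant.
    obtain ⟨v, hv0, hv⟩ := exists_vecMul_eq_zero_iff.2 (show (M a).det = 0 by
      rw [hdet a haL, ha, zero_mul])
    obtain ⟨i, hi⟩ := Function.ne_iff.1 hv0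
    let N' : Fin n → ℂ → ℂ := fun j => dslope (fun z => (v ᵥ* M z) j) a
    have hN' : ∀ j, DifferentiableOn ℂ (N' j) L := fun j => by
      rw [Complex.differentiableOn_dslope (hL.mem_nhds haL)]
      simp only [vecMul, dotProduct]
      exact DifferentiableOn.fun_sum fun l _ => (hM l j).const_mul _
    have hN'eq : ∀ j z, (z - a) * N' j z = (v ᵥ* M z) j := fun j z => by
      have := sub_smul_dslope (fun z => (v ᵥ* M z) j) a z
      rw [hv, Pi.zero_apply, sub_zero, smul_eq_mul] at this
      exact this
    let M' : ℂ → Matrix (Fin n) (Fin n) ℂ := fun z => (M z).updateRow i fun j => N' j z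
    have hM' : ∀ l j, DifferentiableOn ℂ (fun z => M' z l j) L := fun l j => by
      by_cases hl : l = i
      · subst hl
        simpa [M'] using hN' j
      · simpa [M', hl] using hM l j
    let R : Matrix (Fin n) (Fin n) ℂ := (1 : Matrix (Fin n) (Fin n) ℂ).updateRow i v
    have hR : IsUnit R.det := by
      rw [det_one_updateRow]
      exact (show v i ≠ 0 from hi).isUnit
    let D : ℂ → Matrix (Fin n) (Fin n) ℂ := fun z => diagonal (Function.update 1 i (z - a))
    have hRM : ∀ z, R * M z = D z * M' z := fun z => by
      ext l j
      rw [diagonal_mul]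
      by_cases hl : l = i
      · subst hl
        simp [R, M', hN'eq, mul_apply, vecMul, dotProduct]
      · simp [R, M', mul_apply, hl, one_apply]
    have hdetD : ∀ z, (D z).det = z - a := fun z => by
      simp [D, det_diagonal, Finset.prod_update_of_mem]
    have hdetM' : ∀ z ∈ L, z ≠ a → (M' z).det = p₁.eval z * (v i * u z) := by
      intro z hz hza
      have h1 := congrArg det (hRM z)
      rw [det_mul, det_mul, hdetD, det_one_updateRow, hdet z hz] at h1
      simp only [eval_mul, eval_sub, eval_X, eval_C] at h1
      apply mul_left_cancel₀ (sub_ne_zero.2 hza)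
      rw [← h1]
      ring
    have hcont : ContinuousOn (fun z => (M' z).det) L := by
      refine (continuous_id.matrix_det).comp_continuousOn ?_
      exact continuousOn_pi.2 fun l => continuousOn_pi.2 fun j => (hM' l j).continuousOn
    have hcont2 : ContinuousOn (fun z => p₁.eval z * (v i * u z)) L :=
      p₁.continuous.continuousOn.mul (continuousOn_const.mul hu)
    -- Cancelling `z - a` is impossible at `a` itself; there the identity follows by continuity,
    -- which is why `u` is required to be continuous.
    have hdetM'a : ∀ z ∈ L, (M' z).det = p₁.eval z * (v i * u z) := by
      intro z hz
      by_cases hza : z = a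
      · subst hza
        have h1 := ((hcont.continuousAt (hL.mem_nhds hz)).tendsto.mono_left
          (nhdsWithin_le_nhds (s := {z}ᶜ)))
        have h2 := ((hcont2.continuousAt (hL.mem_nhds hz)).tendsto.mono_left
          (nhdsWithin_le_nhds (s := {z}ᶜ)))
        refine tendsto_nhds_unique_of_eventuallyEq h1 h2 ?_
        filter_upwards [self_mem_nhdsWithin, nhdsWithin_le_nhds (hL.mem_nhds hz)] with w hw hwL
        exact hdetM' w hwL hw
      · exact hdetM' z hz hza
    obtain ⟨S, E, hE, hS, hSdet⟩ := ih _ hdeg p₁ hp₁ M' hM' (fun z => v i * u z)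
      (continuousOn_const.mul hu) (fun z hz => mul_ne_zero hi (hu0 z hz)) hdetM'a rfl
    refine ⟨(C : ℂ →+* ℂ[X]).mapMatrix R⁻¹ * diagonal (Function.update 1 i (X - C a)) * S, E, hE,
      fun z hz => ?_, fun z hz => ?_⟩
    · have h1 : evalMatrix z ((C : ℂ →+* ℂ[X]).mapMatrix R⁻¹) = R⁻¹ := by
        ext l j
        simp
      have h2 : evalMatrix z (diagonal (Function.update 1 i (X - C a))) = D z := by
        ext l j
        simp only [RingHom.mapMatrix_apply, D, diagonal_apply, map_apply]
        by_cases hl : l = i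
        · subst hl
          split_ifs <;> simp
        · split_ifs <;> simp [hl]
      rw [map_mul, map_mul, h1, h2, Matrix.mul_assoc, ← hS z hz, Matrix.mul_assoc, ← hRM,
        ← Matrix.mul_assoc, nonsing_inv_mul _ hR, Matrix.one_mul]
    · have hdR : ((C : ℂ →+* ℂ[X]).mapMatrix R⁻¹).det = C R⁻¹.det := (RingHom.map_det C _).symm
      have hR' : R⁻¹.det ≠ 0 := by
        rw [det_nonsing_inv]
        exact (hR.ringInverse).ne_zero
      rw [det_mul, det_mul, hdR, det_diagonal, Finset.prod_update_of_mem (Finset.mem_univ i)] at hz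
      simp only [Pi.one_apply, Finset.prod_const_one, mul_one, eval_mul, eval_C, eval_sub, eval_X,
        mul_eq_zero, hR', false_or] at hz
      rcases hz with hz | hz
      · rw [sub_eq_zero.1 hz]
        exact ⟨haL, ha⟩
      · exact ⟨(hSdet z hz).1, by simp [(hSdet z hz).2]⟩

end PolynomialMatrices

/-! ### Holomorphic matrices and Cartan's lemma up to a rational factor -/

section HolomorphicMatrices

open Matrix

theorem DifferentiableOn.matrix_det {n : ℕ} {U : Set ℂ} {M : ℂ → Matrix (Fin n) (Fin n) ℂ}
    (hM : ∀ i j, DifferentiableOn ℂ (fun z => M z i j) U) :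
    DifferentiableOn ℂ (fun z => (M z).det) U := by
  simp only [det_apply]
  exact DifferentiableOn.fun_sum fun σ _ =>
    (DifferentiableOn.fun_finsetProd fun i _ => hM _ _).const_smul _

theorem DifferentiableOn.matrix_mul {n : ℕ} {U : Set ℂ} {M N : ℂ → Matrix (Fin n) (Fin n) ℂ}
    (hM : ∀ i j, DifferentiableOn ℂ (fun z => M z i j) U)
    (hN : ∀ i j, DifferentiableOn ℂ (fun z => N z i j) U) (i j : Fin n) :
    DifferentiableOn ℂ (fun z => (M z * N z) i j) U := by
  simp only [mul_apply]
  exact DifferentiableOn.fun_sum fun l _ => (hM i l).mul (hN l j)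

theorem MemGLHolomorphic.mul {n : ℕ} {U : Set ℂ} {M N : ℂ → Matrix (Fin n) (Fin n) ℂ}
    (hM : MemGLHolomorphic U M) (hN : MemGLHolomorphic U N) :
    MemGLHolomorphic U fun z => M z * N z :=
  ⟨DifferentiableOn.matrix_mul hM.1 hN.1, fun z hz => (hM.2 z hz).mul (hN.2 z hz)⟩

theorem MemGLHolomorphic.mono {n : ℕ} {U V : Set ℂ} {M : ℂ → Matrix (Fin n) (Fin n) ℂ}
    (hM : MemGLHolomorphic U M) (h : V ⊆ U) : MemGLHolomorphic V M :=
  ⟨fun i j => (hM.1 i j).mono h, fun z hz => hM.2 z (h hz)⟩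

theorem MemGLHolomorphic.congr {n : ℕ} {U : Set ℂ} {M N : ℂ → Matrix (Fin n) (Fin n) ℂ}
    (hM : MemGLHolomorphic U M) (h : ∀ z ∈ U, N z = M z) : MemGLHolomorphic U N :=
  ⟨fun i j => (hM.1 i j).congr fun z hz => by rw [h z hz], fun z hz => by
    rw [h z hz]; exact hM.2 z hz⟩

theorem MemGLHolomorphic.smul {n : ℕ} {U : Set ℂ} {M : ℂ → Matrix (Fin n) (Fin n) ℂ} {c : ℂ → ℂ}
    (hM : MemGLHolomorphic U M) (hc : DifferentiableOn ℂ c U) (hc0 : ∀ z ∈ U, c z ≠ 0) :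
    MemGLHolomorphic U fun z => c z • M z := by
  refine ⟨fun i j => ?_, fun z hz => ?_⟩
  · exact hc.mul (hM.1 i j)
  · exact (isUnit_iff_exists_inv.2 ⟨(c z)⁻¹ • (M z)⁻¹, by
      rw [smul_mul_smul_comm, mul_inv_cancel₀ (hc0 z hz),
        mul_nonsing_inv _ ((isUnit_iff_isUnit_det _).1 (hM.2 z hz)), one_smul]⟩)

theorem MemGLHolomorphic.inv {n : ℕ} {U : Set ℂ} {M : ℂ → Matrix (Fin n) (Fin n) ℂ}
    (hM : MemGLHolomorphic U M) : MemGLHolomorphic U fun z => (M z)⁻¹ := by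
  have hdet : ∀ z ∈ U, (M z).det ≠ 0 := fun z hz =>
    ((isUnit_iff_isUnit_det _).1 (hM.2 z hz)).ne_zero
  refine ⟨fun i j => ?_, fun z hz => ?_⟩
  · simp only [inv_def, Matrix.smul_apply, smul_eq_mul, Ring.inverse_eq_inv', adjugate_apply]
    refine ((DifferentiableOn.matrix_det hM.1).inv hdet).mul (DifferentiableOn.matrix_det ?_)
    intro k l
    by_cases hk : k = j
    · subst hk
      simp
    · simpa [hk] using hM.1 k l
  · rw [isUnit_nonsing_inv_iff]
    exact hM.2 z hz

theorem MemGLHolomorphic.evalMatrix {n : ℕ} {U : Set ℂ}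
    {S : Matrix (Fin n) (Fin n) (Polynomial ℂ)} (hS : ∀ z ∈ U, S.det.eval z ≠ 0) :
    MemGLHolomorphic U fun z => evalMatrix z S := by
  refine ⟨fun i j => (S i j).differentiable.differentiableOn, fun z hz => ?_⟩
  rw [isUnit_iff_isUnit_det, det_evalMatrix]
  exact (hS z hz).isUnit

theorem MemGLHolomorphic.comp {n : ℕ} {U V : Set ℂ} {M : ℂ → Matrix (Fin n) (Fin n) ℂ} {f : ℂ → ℂ}
    (hM : MemGLHolomorphic U M) (hf : DifferentiableOn ℂ f V) (h : Set.MapsTo f V U) :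
    MemGLHolomorphic V fun z => M (f z) :=
  ⟨fun i j => (hM.1 i j).comp hf h, fun _ hz => hM.2 _ (h hz)⟩

attribute [local instance] Matrix.linftyOpNormedRing Matrix.linftyOpNormedAlgebra

theorem matrix_eq_sum_smul_single {n : ℕ} (M : Matrix (Fin n) (Fin n) ℂ) :
    M = ∑ i, ∑ j, M i j • single i j (1 : ℂ) := by
  conv_lhs => rw [matrix_eq_sum_single M]
  simp

theorem differentiableOn_matrix_iff {n : ℕ} {U : Set ℂ} {M : ℂ → Matrix (Fin n) (Fin n) ℂ} :
    DifferentiableOn ℂ M U ↔ ∀ i j, DifferentiableOn ℂ (fun z => M z i j) U := by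
  refine ⟨fun h i j => ?_, fun h => ?_⟩
  · exact (LinearMap.toContinuousLinearMap
      (Matrix.entryLinearMap ℂ ℂ i j)).differentiable.comp_differentiableOn h
  · rw [show M = fun z => ∑ i, ∑ j, M z i j • single i j (1 : ℂ) from
      funext fun z => matrix_eq_sum_smul_single (M z)]
    exact DifferentiableOn.fun_sum fun i _ => DifferentiableOn.fun_sum fun j _ =>
      (h i j).smul_const _

theorem exists_matrix_norm_le (n : ℕ) : ∃ c : ℝ, 0 < c ∧ ∀ (M : Matrix (Fin n) (Fin n) ℂ) (δ : ℝ),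
    0 ≤ δ → (∀ i j, ‖M i j‖ ≤ δ) → ‖M‖ ≤ c * δ := by
  refine ⟨(∑ i : Fin n, ∑ j : Fin n, ‖single i j (1 : ℂ)‖) + 1, ?_, fun M δ hδ h => ?_⟩
  · exact add_pos_of_nonneg_of_pos (Finset.sum_nonneg fun i _ => Finset.sum_nonneg fun j _ =>
      norm_nonneg _) one_pos
  · rw [matrix_eq_sum_smul_single M, add_mul, one_mul, Finset.sum_mul]
    refine le_add_of_le_of_nonneg ?_ hδ
    refine norm_sum_le_of_le _ fun i _ => ?_
    rw [Finset.sum_mul]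
    refine norm_sum_le_of_le _ fun j _ => ?_
    rw [norm_smul, mul_comm]
    exact mul_le_mul_of_nonneg_left (h i j) (norm_nonneg _)

instance {n : ℕ} : CompleteSpace (Matrix (Fin n) (Fin n) ℂ) := FiniteDimensional.complete ℂ _

theorem isUnit_of_norm_sub_one_le_half {n : ℕ} {M : Matrix (Fin n) (Fin n) ℂ}
    (h : ‖M - 1‖ ≤ 1 / 2) : IsUnit M := by
  have h1 : ‖1 - M‖ < 1 := by
    rw [norm_sub_rev]
    linarith
  simpa using isUnit_one_sub_of_norm_lt_one h1

/-- Runge approximation for holomorphic matrices. -/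
theorem exists_rational_matrix_approx {n : ℕ} {K U : Set ℂ} (hK : IsCompact K) (hU : IsOpen U)
    (hKU : K ⊆ U) {T : ℂ → Matrix (Fin n) (Fin n) ℂ}
    (hT : ∀ i j, DifferentiableOn ℂ (fun z => T z i j) U) {ε : ℝ} (hε : 0 < ε) :
    ∃ (Q : Matrix (Fin n) (Fin n) (Polynomial ℂ)) (q : Polynomial ℂ), ∀ z ∈ K, q.eval z ≠ 0 ∧
      ‖(q.eval z)⁻¹ • evalMatrix z Q - T z‖ ≤ ε := by
  obtain ⟨c, hc, hcM⟩ := exists_matrix_norm_le n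
  have h : ∀ x : Fin n × Fin n, ∃ p q : Polynomial ℂ, ∀ z ∈ K, q.eval z ≠ 0 ∧
      ‖T z x.1 x.2 - p.eval z / q.eval z‖ < ε / c := fun x =>
    exists_rational_approx hK hU hKU (hT x.1 x.2) (div_pos hε hc)
  choose p q hpq using h
  refine ⟨of fun i j => p (i, j) * ∏ x ∈ Finset.univ.erase (i, j), q x, ∏ x, q x,
    fun z hz => ?_⟩
  have hq : ∀ x, (q x).eval z ≠ 0 := fun x => (hpq x z hz).1
  have hprod : ∏ x, (q x).eval z ≠ 0 := Finset.prod_ne_zero_iff.2 fun x _ => hq x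
  refine ⟨by rwa [Polynomial.eval_prod], ?_⟩
  refine (hcM _ (ε / c) (by positivity) fun i j => ?_).trans (mul_div_cancel₀ ε hc.ne').le
  have h1 : ((∏ x, q x).eval z)⁻¹ * (p (i, j) * ∏ x ∈ Finset.univ.erase (i, j), q x).eval z =
      (p (i, j)).eval z / (q (i, j)).eval z := by
    rw [Polynomial.eval_mul, Polynomial.eval_prod, Polynomial.eval_prod,
      ← Finset.mul_prod_erase _ (fun x => (q x).eval z) (Finset.mem_univ (i, j))]
    have h2 : ∏ x ∈ Finset.univ.erase (i, j), (q x).eval z ≠ 0 :=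
      Finset.prod_ne_zero_iff.2 fun x _ => hq x
    have h3 := hq (i, j)
    field_simp
  have h4 := (hpq (i, j) z hz).2.le
  rw [norm_sub_rev, ← h1] at h4
  exact h4

/-- Cartan's lemma for holomorphic matrices near `L₁ ∩ L₂`, up to a rational factor. -/
theorem exists_cartan_factorization {n : ℕ} {L₁ L₂ K U : Set ℂ} (h₁ : IsOpen L₁) (h₂ : IsOpen L₂)
    (hne : (L₁ ∩ L₂).Nonempty) (hK : IsCompact K) (hLK : L₁ ∩ L₂ ⊆ K) (hU : IsOpen U)
    (hKU : K ⊆ U) (hsplit : HasBoundedCousinSplitting (Matrix (Fin n) (Fin n) ℂ) L₁ L₂)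
    {T : ℂ → Matrix (Fin n) (Fin n) ℂ} (hT : MemGLHolomorphic U T) :
    ∃ (A B : ℂ → Matrix (Fin n) (Fin n) ℂ) (S : Matrix (Fin n) (Fin n) (Polynomial ℂ))
      (q : Polynomial ℂ), MemGLHolomorphic L₁ A ∧ (∀ z, ‖A z - 1‖ ≤ 1 / 2) ∧
      MemGLHolomorphic L₂ B ∧ (∀ z ∈ L₁, q.eval z ≠ 0) ∧ (∀ z ∈ L₁, S.det.eval z ≠ 0) ∧
      ∀ z ∈ L₁ ∩ L₂, q.eval z • (A z * T z) = evalMatrix z S * B z := by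
  have hLU := hLK.trans hKU
  obtain ⟨ε, hε, hfac⟩ := hsplit.exists_factorization h₁ h₂ one_half_pos
  have hTi := hT.inv
  obtain ⟨B, hB⟩ := hK.exists_bound_of_continuousOn
    (((differentiableOn_matrix_iff.2 hTi.1).mono hKU).continuousOn)
  have hB' : 0 < |B| + 1 := by positivity
  -- The tolerance is divided by a bound for `T⁻¹` because the lemma near the identity is applied to
  -- `(Q / q) T⁻¹ - 1`.
  obtain ⟨Q, q, hQ⟩ := exists_rational_matrix_approx hK hU hKU hT.1 (div_pos hε hB')
  have hTT : ∀ z ∈ L₁ ∩ L₂, T z * (T z)⁻¹ = 1 := fun z hz =>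
    mul_nonsing_inv _ ((isUnit_iff_isUnit_det _).1 (hT.2 z (hLU hz)))
  have hTT' : ∀ z ∈ L₁ ∩ L₂, (T z)⁻¹ * T z = 1 := fun z hz =>
    nonsing_inv_mul _ ((isUnit_iff_isUnit_det _).1 (hT.2 z (hLU hz)))
  obtain ⟨a, b, ha, hb, haη, hbη, hab⟩ := hfac
    (fun z => ((q.eval z)⁻¹ • evalMatrix z Q - T z) * (T z)⁻¹) (by
      refine DifferentiableOn.fun_mul (DifferentiableOn.fun_sub (DifferentiableOn.fun_smul ?_ ?_) ?_) ?_
      · exact q.differentiable.differentiableOn.inv fun z hz => (hQ z (hLK hz)).1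
      · exact differentiableOn_matrix_iff.2 fun i j => (Q i j).differentiable.differentiableOn
      · exact (differentiableOn_matrix_iff.2 hT.1).mono hLU
      · exact (differentiableOn_matrix_iff.2 hTi.1).mono hLU) (by
      intro z hz
      calc _ ≤ ‖(q.eval z)⁻¹ • evalMatrix z Q - T z‖ * ‖(T z)⁻¹‖ := norm_mul_le _ _
        _ ≤ ε / (|B| + 1) * (|B| + 1) :=
          mul_le_mul (hQ z (hLK hz)).2 ((hB z (hLK hz)).trans (by linarith [le_abs_self B]))
            (norm_nonneg _) (by positivity)
        _ = ε := div_mul_cancel₀ _ hB'.ne')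
  have hA1 : ∀ z, ‖(1 + a z) - 1‖ ≤ 1 / 2 := fun z => by simpa using haη z
  have hB1 : ∀ z, ‖(1 + b z) - 1‖ ≤ 1 / 2 := fun z => by simpa using hbη z
  have hA : MemGLHolomorphic L₁ fun z => 1 + a z :=
    ⟨differentiableOn_matrix_iff.1 (ha.const_add 1), fun z _ =>
      isUnit_of_norm_sub_one_le_half (hA1 z)⟩
  have hBG : MemGLHolomorphic L₂ fun z => 1 + b z :=
    ⟨differentiableOn_matrix_iff.1 (hb.const_add 1), fun z _ =>
      isUnit_of_norm_sub_one_le_half (hB1 z)⟩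
  have hmain : ∀ z ∈ L₁ ∩ L₂, q.eval z • ((1 + a z) * T z) = (1 + b z) * evalMatrix z Q := by
    intro z hz
    have h1 : 1 + ((q.eval z)⁻¹ • evalMatrix z Q - T z) * (T z)⁻¹ =
        (q.eval z)⁻¹ • evalMatrix z Q * (T z)⁻¹ := by
      rw [sub_mul, hTT z hz, add_sub_cancel]
    rw [← hab z hz, h1, Matrix.mul_assoc, Matrix.mul_assoc, hTT' z hz, Matrix.mul_one,
      mul_smul_comm, smul_smul, mul_inv_cancel₀ (hQ z (hLK hz)).1, one_smul]
  have hQdet : ∀ z ∈ L₁ ∩ L₂, Q.det.eval z ≠ 0 := by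
    intro z hz h0
    have h1 := congrArg det (hmain z hz)
    rw [det_mul, det_evalMatrix, h0, mul_zero, det_smul, det_mul] at h1
    have h2 := ((isUnit_iff_isUnit_det _).1 (hA.2 z hz.1)).ne_zero
    have h3 := ((isUnit_iff_isUnit_det _).1 (hT.2 z (hLU hz))).ne_zero
    exact mul_ne_zero (pow_ne_zero _ (hQ z (hLK hz)).1) (mul_ne_zero h2 h3) h1
  obtain ⟨z₀, hz₀⟩ := hne
  have hQ0 : Q.det ≠ 0 := fun h => hQdet z₀ hz₀ (by rw [h, Polynomial.eval_zero])
  have hq0 : q ≠ 0 := fun h => (hQ z₀ (hLK hz₀)).1 (by rw [h, Polynomial.eval_zero])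
  -- All zeros of `det Q` in `L₂` go into the polynomial factor `S`, leaving `E` invertible on `L₂`.
  -- As `det Q` has no zero on the overlap, `det S` has none on `L₁`.
  obtain ⟨S, E, hE, hSE, hS⟩ := exists_polynomial_mul_of_det_eq h₂ Q.det hQ0
    (fun z => (1 + b z) * evalMatrix z Q)
    (DifferentiableOn.matrix_mul hBG.1 fun i j => (Q i j).differentiable.differentiableOn)
    (fun z => (1 + b z).det) (DifferentiableOn.matrix_det hBG.1).continuousOn
    (fun z hz => ((isUnit_iff_isUnit_det _).1 (hBG.2 z hz)).ne_zero)
    (fun z _ => by rw [det_mul, det_evalMatrix, mul_comm])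
  -- The denominator is divided likewise: the factor without zeros in `L₂` is absorbed into `B`, and
  -- the one without zeros in `L₁` remains.
  obtain ⟨q₁, q₂, rfl, hq₁, hq₂⟩ := Polynomial.exists_mul_of_no_common_roots L₁ L₂ q hq0
    fun z hz => (hQ z (hLK hz)).1
  refine ⟨fun z => 1 + a z, fun z => (q₂.eval z)⁻¹ • E z, S, q₁, hA, hA1,
    hE.smul (q₂.differentiable.differentiableOn.inv hq₂) fun z hz => inv_ne_zero (hq₂ z hz),
    hq₁, fun z hz h0 => ?_, fun z hz => ?_⟩
  · obtain ⟨hz2, h0'⟩ := hS z h0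
    exact hQdet z ⟨hz, hz2⟩ h0'
  · have h1 := hmain z hz
    rw [hSE z hz.2, Polynomial.eval_mul, mul_comm, mul_smul] at h1
    rw [mul_smul_comm, ← h1, smul_smul, inv_mul_cancel₀ (hq₂ z hz.2), one_smul]

end HolomorphicMatrices

/-! ### Multiplicative Cousin problem and Birkhoff factorization -/

section Factorization

open Matrix

theorem hasBoundedCousinSplitting_of_levels {E : Type*} [NormedAddCommGroup E] [NormedSpace ℂ E]
    [CompleteSpace E] {R : Set ℂ} (hR : IsOpen R) {l : ℂ → ℝ} (hl : ContDiff ℝ 1 l) {s t : ℝ}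
    (hst : s < t) (hb : Bornology.IsBounded (R ∩ {z | l z < t} ∩ (R ∩ {z | s < l z}))) :
    HasBoundedCousinSplitting E (R ∩ {z | l z < t}) (R ∩ {z | s < l z}) := by
  have hts : 0 < t - s := sub_pos.2 hst
  -- The cutoff `smoothTransition (τ z)` changes only in the middle third of `[s, t]`. The outer
  -- thirds make it constant on neighbourhoods of the points with `l z ≤ s` and of those with `t ≤ l
  -- z`.
  let τ : ℂ → ℝ := fun z => 3 * (l z - s) / (t - s) - 1
  have hτ : ContDiff ℝ 1 τ := by fun_prop
  have hχ : ContDiff ℝ 1 fun z => ((Real.smoothTransition (τ z) : ℝ) : ℂ) :=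
    Complex.ofRealCLM.contDiff.comp (Real.smoothTransition.contDiff.comp hτ)
  refine hasBoundedCousinSplitting_of_cutoff (hR.inter (isOpen_lt hl.continuous continuous_const))
    (hR.inter (isOpen_lt continuous_const hl.continuous)) hb hχ ?_ ?_
  · rintro z ⟨⟨hzR, -⟩, hz⟩
    have hle : l z ≤ s := by
      by_contra! h
      exact hz ⟨hzR, h⟩
    have hneg : τ z < 0 := by
      have : 3 * (l z - s) / (t - s) ≤ 0 := div_nonpos_of_nonpos_of_nonneg (by linarith) hts.le
      simp only [τ]
      linarith
    filter_upwards [hτ.continuous.continuousAt.eventually_lt continuousAt_const hneg] with w hw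
    simp [Real.smoothTransition.zero_of_nonpos hw.le]
  · rintro z ⟨⟨hzR, -⟩, hz⟩
    have hle : t ≤ l z := by
      by_contra! h
      exact hz ⟨hzR, h⟩
    have hpos : 1 < τ z := by
      have : 3 ≤ 3 * (l z - s) / (t - s) := by
        rw [le_div_iff₀ hts]
        linarith
      simp only [τ]
      linarith
    filter_upwards [continuousAt_const.eventually_lt hτ.continuous.continuousAt hpos] with w hw
    simp [Real.smoothTransition.one_of_one_le hw.le]

attribute [local instance] Matrix.linftyOpNormedRing Matrix.linftyOpNormedAlgebra

/-- **Cartan's lemma**: a holomorphic invertible matrix on the overlap of two sets, separated by the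
level sets of a smooth function, is a quotient of holomorphic invertible matrices. -/
theorem exists_multiplicative_cousin {n : ℕ} {R K U : Set ℂ} (hR : IsOpen R) {l : ℂ → ℝ}
    (hl : ContDiff ℝ 1 l) {s t : ℝ} (hst : s < t) (hK : IsCompact K)
    (hLK : R ∩ {z | l z < t} ∩ (R ∩ {z | s < l z}) ⊆ K) (hU : IsOpen U) (hKU : K ⊆ U)
    {T : ℂ → Matrix (Fin n) (Fin n) ℂ} (hT : MemGLHolomorphic U T) :
    ∃ G₁ G₂ : ℂ → Matrix (Fin n) (Fin n) ℂ, MemGLHolomorphic (R ∩ {z | l z < t}) G₁ ∧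
      MemGLHolomorphic (R ∩ {z | s < l z}) G₂ ∧
      ∀ z ∈ R ∩ {z | l z < t} ∩ (R ∩ {z | s < l z}), G₁ z * T z = G₂ z := by
  -- A point of the overlap is what shows that the approximating denominator and determinant are
  -- nonzero polynomials, so an empty overlap is treated separately.
  rcases Set.eq_empty_or_nonempty (R ∩ {z | l z < t} ∩ (R ∩ {z | s < l z})) with he | hne
  · rw [he]
    exact ⟨fun _ => 1, fun _ => 1, ⟨fun i j => differentiableOn_const _, fun _ _ => isUnit_one⟩,
      ⟨fun i j => differentiableOn_const _, fun _ _ => isUnit_one⟩, by simp⟩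
  · obtain ⟨A, B, S, q, hA, -, hB, hq, hS, h⟩ := exists_cartan_factorization
      (hR.inter (isOpen_lt hl.continuous continuous_const))
      (hR.inter (isOpen_lt continuous_const hl.continuous)) hne hK hLK hU hKU
      (hasBoundedCousinSplitting_of_levels hR hl hst (hK.isBounded.subset hLK)) hT
    have hSG := MemGLHolomorphic.evalMatrix hS
    refine ⟨fun z => q.eval z • ((evalMatrix z S)⁻¹ * A z), B,
      (hSG.inv.mul hA).smul q.differentiable.differentiableOn hq, hB, fun z hz => ?_⟩
    rw [smul_mul_assoc, Matrix.mul_assoc, ← mul_smul_comm, h z hz, ← Matrix.mul_assoc,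
      nonsing_inv_mul _ ((isUnit_iff_isUnit_det _).1 (hSG.2 z hz.1)), Matrix.one_mul]

/-- A holomorphic matrix which is close to `1` near infinity extends to infinity. -/
theorem exists_extension_to_infinity {n : ℕ} {r : ℝ} (hr : 0 < r)
    {A : ℂ → Matrix (Fin n) (Fin n) ℂ} (hA : MemGLHolomorphic {z | r < ‖z‖} A)
    (hA1 : ∀ z, ‖A z - 1‖ ≤ 1 / 2) :
    ∃ A' : ℂ → Matrix (Fin n) (Fin n) ℂ, MemGLHolomorphic (Metric.ball 0 (1 / r)) A' ∧
      ∀ z, z ≠ 0 → A' z⁻¹ = A z := by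
  have hball : Metric.ball (0 : ℂ) (1 / r) ∈ 𝓝 (0 : ℂ) := Metric.ball_mem_nhds _ (by positivity)
  have hmaps : Set.MapsTo (fun z : ℂ => z⁻¹) (Metric.ball 0 (1 / r) \ {0}) {z | r < ‖z‖} := by
    rintro z ⟨hz, hz0⟩
    have h0 : 0 < ‖z‖ := norm_pos_iff.2 hz0
    rw [mem_ball_zero_iff, lt_div_iff₀ hr, mul_comm, ← lt_div_iff₀ h0] at hz
    rw [Set.mem_ofPred_eq, norm_inv, ← one_div]
    exact hz
  have hd : DifferentiableOn ℂ (fun z => A z⁻¹) (Metric.ball 0 (1 / r) \ {0}) :=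
    (differentiableOn_matrix_iff.2 hA.1).comp
      (differentiableOn_inv.mono fun z hz => hz.2) hmaps
  -- Closeness to `1` serves twice: it gives the bound for the removable singularity theorem, and,
  -- passing to the limit, it makes the value at the new point invertible.
  have hbdd : BddAbove (norm ∘ (fun z => A z⁻¹) '' (Metric.ball 0 (1 / r) \ {0})) := by
    refine ⟨1 / 2 + ‖(1 : Matrix (Fin n) (Fin n) ℂ)‖, ?_⟩
    rintro _ ⟨z, -, rfl⟩
    have := norm_add_le (A z⁻¹ - 1) 1
    rw [sub_add_cancel] at this
    exact this.trans (by linarith [hA1 z⁻¹])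
  have hext := Complex.differentiableOn_update_limUnder_of_bddAbove hball hd hbdd
  set A' : ℂ → Matrix (Fin n) (Fin n) ℂ := Function.update (fun z => A z⁻¹) 0
    (Filter.limUnder (𝓝[≠] (0 : ℂ)) fun z => A z⁻¹) with hA'
  have hne : ∀ z : ℂ, z ≠ 0 → A' z = A z⁻¹ := fun z hz => Function.update_of_ne hz _ _
  have hA'1 : ∀ z, ‖A' z - 1‖ ≤ 1 / 2 := by
    intro z
    by_cases hz : z = 0
    · subst hz
      have hc : ContinuousAt A' 0 := hext.continuousOn.continuousAt hball
      have ht : Filter.Tendsto (fun z => ‖A' z - 1‖) (𝓝[≠] (0 : ℂ)) (𝓝 ‖A' 0 - 1‖) :=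
        ((hc.sub continuousAt_const).norm).tendsto.mono_left nhdsWithin_le_nhds
      refine le_of_tendsto ht ?_
      filter_upwards [self_mem_nhdsWithin] with z hz
      rw [hne z hz]
      exact hA1 _
    · rw [hne z hz]
      exact hA1 _
  refine ⟨A', ⟨differentiableOn_matrix_iff.1 hext, fun z _ =>
    isUnit_of_norm_sub_one_le_half (hA'1 z)⟩, fun z hz => ?_⟩
  rw [hne _ (inv_ne_zero hz), inv_inv]

/-- Birkhoff's factorization on an annulus. -/
theorem exists_birkhoff_factorization_annulus {n : ℕ} {r₁ r₂ : ℝ} (hr₁ : 0 < r₁) (hr : r₁ < r₂)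
    {U : Set ℂ} (hU : IsOpen U) (hrU : ∀ z : ℂ, r₁ ≤ ‖z‖ → ‖z‖ ≤ r₂ → z ∈ U)
    {T : ℂ → Matrix (Fin n) (Fin n) ℂ} (hT : MemGLHolomorphic U T) :
    ∃ (P E : ℂ → Matrix (Fin n) (Fin n) ℂ) (k : Fin n → ℤ),
      MemGLHolomorphic (Metric.ball 0 (1 / r₁)) P ∧ MemGLHolomorphic (Metric.ball 0 r₂) E ∧
      ∀ z : ℂ, r₁ < ‖z‖ → ‖z‖ < r₂ → T z = P z⁻¹ * diagonal (fun i => z ^ k i) * E z := by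
  have hr₂ : 0 < r₂ := hr₁.trans hr
  -- The level function is `-‖z‖²`: the square makes it smooth at `0`, and the sign makes the
  -- exterior region the first one, where `A` is close to `1` and `q`, `det S` have no zeros.
  have hL₁ : Set.univ ∩ {z : ℂ | -‖z‖ ^ 2 < -r₁ ^ 2} = {z : ℂ | r₁ < ‖z‖} := by
    ext z
    simp [abs_of_pos hr₁, sq_lt_sq]
  have hL₂ : Set.univ ∩ {z : ℂ | -r₂ ^ 2 < -‖z‖ ^ 2} = Metric.ball 0 r₂ := by
    ext z
    simp [abs_of_pos hr₂, sq_lt_sq]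
  let K : Set ℂ := Metric.closedBall 0 r₂ ∩ {z | r₁ ≤ ‖z‖}
  have hK : IsCompact K := (isCompact_closedBall _ _).inter_right
    (isClosed_le continuous_const continuous_norm)
  have hLK : {z : ℂ | r₁ < ‖z‖} ∩ Metric.ball 0 r₂ ⊆ K := fun z hz =>
    ⟨Metric.ball_subset_closedBall hz.2, show r₁ ≤ ‖z‖ from le_of_lt hz.1⟩
  have hsplit : HasBoundedCousinSplitting (Matrix (Fin n) (Fin n) ℂ) {z : ℂ | r₁ < ‖z‖}
      (Metric.ball 0 r₂) := by
    have := hasBoundedCousinSplitting_of_levels (E := Matrix (Fin n) (Fin n) ℂ)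
      (R := Set.univ) isOpen_univ (l := fun z => -‖z‖ ^ 2) (contDiff_norm_sq ℝ).neg
      (s := -r₂ ^ 2) (t := -r₁ ^ 2) (by gcongr)
      (by rw [hL₁, hL₂]; exact hK.isBounded.subset hLK)
    rwa [hL₁, hL₂] at this
  have hne : ({z : ℂ | r₁ < ‖z‖} ∩ Metric.ball 0 r₂).Nonempty := by
    have hpos : 0 < (r₁ + r₂) / 2 := by linarith
    refine ⟨(((r₁ + r₂) / 2 : ℝ) : ℂ), ?_, ?_⟩
    · rw [Set.mem_ofPred_eq, Complex.norm_real, Real.norm_of_nonneg hpos.le]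
      linarith
    · rw [mem_ball_zero_iff, Complex.norm_real, Real.norm_of_nonneg hpos.le]
      linarith
  obtain ⟨A, B, S, q, hA, hA1, hB, hq, hS, h⟩ := exists_cartan_factorization
    (isOpen_lt continuous_const continuous_norm) Metric.isOpen_ball hne hK hLK hU
    (fun z hz => hrU z hz.2 (mem_closedBall_zero_iff.1 hz.1)) hsplit hT
  obtain ⟨A', hA', hAA'⟩ := exists_extension_to_infinity hr₁ hA hA1
  obtain ⟨z₀, hz₀⟩ := hne
  have hS0 : S.det ≠ 0 := fun h0 => hS z₀ hz₀.1 (by rw [h0, Polynomial.eval_zero])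
  have hq0 : q ≠ 0 := fun h0 => hq z₀ hz₀.1 (by rw [h0, Polynomial.eval_zero])
  obtain ⟨W, V, k, hV, hW0, hW⟩ := exists_column_reduction S hS0
  have hVdet : ∀ z : ℂ, V.det.eval z ≠ 0 := fun z => (hV.map (Polynomial.evalRingHom z)).ne_zero
  have hVG : MemGLHolomorphic (Metric.ball 0 r₂) fun z => evalMatrix z V :=
    MemGLHolomorphic.evalMatrix fun z _ => hVdet z
  have hinv : ∀ ζ ∈ Metric.ball (0 : ℂ) (1 / r₁), ζ ≠ 0 → r₁ < ‖ζ⁻¹‖ := by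
    intro ζ hζ hζ0
    have h0 : 0 < ‖ζ‖ := norm_pos_iff.2 hζ0
    rw [mem_ball_zero_iff, lt_div_iff₀ hr₁, mul_comm, ← lt_div_iff₀ h0] at hζ
    rwa [norm_inv, ← one_div]
  -- At `0` column reduction gives invertibility; elsewhere it comes from that of `S V` at `ζ⁻¹`,
  -- which lies in the exterior region.
  have hWG : MemGLHolomorphic (Metric.ball 0 (1 / r₁)) fun ζ => evalMatrix ζ W := by
    refine MemGLHolomorphic.evalMatrix fun ζ hζ => ?_
    by_cases hζ0 : ζ = 0
    · rwa [hζ0, ← det_evalMatrix]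
    · intro h0
      have h1 := congrArg det (hW ζ⁻¹ (inv_ne_zero hζ0))
      rw [inv_inv, det_mul, det_evalMatrix, det_evalMatrix, h0, zero_mul, det_mul,
        Polynomial.eval_mul] at h1
      exact mul_ne_zero (hS _ (hinv ζ hζ hζ0)) (hVdet _) h1
  -- The scalar `q` is itself factored: its reversal is zero-free near infinity in the coordinate
  -- `1/z` and goes into `P`, and the power `z ^ natDegree` is subtracted from the exponents.
  have hqr : ∀ z : ℂ, z ≠ 0 → q.eval z = q.reverse.eval z⁻¹ * z ^ q.natDegree := by
    intro z hz
    let _ := invertibleOfNonzero hz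
    have := Polynomial.eval₂_reverse_mul_pow (RingHom.id ℂ) z q
    rw [invOf_eq_inv] at this
    exact this.symm
  have hqr0 : ∀ ζ ∈ Metric.ball (0 : ℂ) (1 / r₁), q.reverse.eval ζ ≠ 0 := by
    intro ζ hζ
    by_cases hζ0 : ζ = 0
    · rw [hζ0, ← Polynomial.coeff_zero_eq_eval_zero, Polynomial.coeff_zero_reverse]
      exact Polynomial.leadingCoeff_ne_zero.2 hq0
    · intro h0
      have h1 := hqr ζ⁻¹ (inv_ne_zero hζ0)
      rw [inv_inv, h0, zero_mul] at h1
      exact hq _ (hinv ζ hζ hζ0) h1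
  refine ⟨fun ζ => (q.reverse.eval ζ)⁻¹ • ((A' ζ)⁻¹ * evalMatrix ζ W),
    fun z => (evalMatrix z V)⁻¹ * B z, fun i => (k i : ℤ) - q.natDegree,
    (hA'.inv.mul hWG).smul (q.reverse.differentiable.differentiableOn.inv hqr0)
      fun ζ hζ => inv_ne_zero (hqr0 ζ hζ), hVG.inv.mul hB, fun z hz₁ hz₂ => ?_⟩
  have hz : z ∈ {z : ℂ | r₁ < ‖z‖} ∩ Metric.ball 0 r₂ := ⟨hz₁, mem_ball_zero_iff.2 hz₂⟩
  have hz0 : z ≠ 0 := norm_pos_iff.1 (hr₁.trans hz₁)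
  have hdiag : diagonal (fun i => z ^ ((k i : ℤ) - q.natDegree)) =
      (z ^ q.natDegree)⁻¹ • diagonal fun i => z ^ k i := by
    rw [← diagonal_smul]
    congr 1
    ext i
    rw [Pi.smul_apply, smul_eq_mul, zpow_sub₀ hz0, zpow_natCast, zpow_natCast, div_eq_inv_mul]
  have hVV : evalMatrix z V * (evalMatrix z V)⁻¹ = 1 :=
    mul_nonsing_inv _ ((isUnit_iff_isUnit_det _).1 (hVG.2 z hz.2))
  have h1 : evalMatrix z S * B z =
      evalMatrix z⁻¹ W * diagonal (fun i => z ^ k i) * ((evalMatrix z V)⁻¹ * B z) := by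
    rw [← hW z hz0, map_mul, ← Matrix.mul_assoc, Matrix.mul_assoc (evalMatrix z S), hVV,
      Matrix.mul_one]
  have h2 : T z = (q.eval z)⁻¹ • ((A z)⁻¹ * (evalMatrix z S * B z)) := by
    rw [← h z hz, mul_smul_comm, ← Matrix.mul_assoc,
      nonsing_inv_mul _ ((isUnit_iff_isUnit_det _).1 (hA.2 z hz.1)), Matrix.one_mul, smul_smul,
      inv_mul_cancel₀ (hq z hz.1), one_smul]
  beta_reduce
  rw [h2, h1, hAA' z hz0, hdiag, hqr z hz0, mul_inv]
  simp only [smul_mul_assoc, mul_smul_comm, smul_smul, Matrix.mul_assoc]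
  rw [mul_comm]

theorem MemGLHolomorphic.exists_union {n : ℕ} {U V : Set ℂ} (hU : IsOpen U) (hV : IsOpen V)
    {M N : ℂ → Matrix (Fin n) (Fin n) ℂ} (hM : MemGLHolomorphic U M) (hN : MemGLHolomorphic V N)
    (h : ∀ z ∈ U ∩ V, M z = N z) :
    ∃ X : ℂ → Matrix (Fin n) (Fin n) ℂ, MemGLHolomorphic (U ∪ V) X ∧ (∀ z ∈ U, X z = M z) ∧
      ∀ z ∈ V, X z = N z := by
  classical
  let X : ℂ → Matrix (Fin n) (Fin n) ℂ := fun z => if z ∈ U then M z else N z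
  have hXU : ∀ z ∈ U, X z = M z := fun z hz => if_pos hz
  have hXV : ∀ z ∈ V, X z = N z := fun z hz => by
    by_cases hzU : z ∈ U
    · rw [hXU z hzU, h z ⟨hzU, hz⟩]
    · exact if_neg hzU
  have h₁ := hM.congr hXU
  have h₂ := hN.congr hXV
  exact ⟨X, ⟨fun i j => (h₁.1 i j).union_of_isOpen (h₂.1 i j) hU hV,
    fun z hz => hz.elim (h₁.2 z) (h₂.2 z)⟩, hXU, hXV⟩

theorem memGLHolomorphic_diagonal_zpow {n : ℕ} (k : Fin n → ℤ) {U : Set ℂ} (hU : ∀ z ∈ U, z ≠ 0) :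
    MemGLHolomorphic U fun z => diagonal fun i => z ^ k i := by
  refine ⟨fun i j => ?_, fun z hz => ?_⟩
  · by_cases hij : i = j
    · subst hij
      simp only [diagonal_apply_eq]
      exact fun z hz => (differentiableAt_zpow.2 (Or.inl (hU z hz))).differentiableWithinAt
    · simp only [diagonal_apply_ne _ hij]
      exact differentiableOn_const _
  · rw [isUnit_iff_isUnit_det, det_diagonal, isUnit_iff_ne_zero]
    exact Finset.prod_ne_zero_iff.2 fun i _ => zpow_ne_zero _ (hU z hz)

/-- **Birkhoff's factorization lemma**. -/
theorem exists_birkhoff_factorization {n : ℕ} {R₀ : ℝ} (hR₀ : 0 < R₀)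
    {T : ℂ → Matrix (Fin n) (Fin n) ℂ} (hT : MemGLHolomorphic {z : ℂ | R₀ < ‖z‖} T) :
    ∃ (P E : ℂ → Matrix (Fin n) (Fin n) ℂ) (k : Fin n → ℤ),
      MemGLHolomorphic (Metric.ball (0 : ℂ) (1 / R₀)) P ∧ MemGLHolomorphic Set.univ E ∧
      Antitone k ∧
      ∀ z : ℂ, R₀ < ‖z‖ → T z = P (1 / z) * diagonal (fun i => z ^ k i) * E z := by
  have hR₁ : 0 < R₀ + 1 := by linarith
  have hopen : IsOpen {z : ℂ | R₀ < ‖z‖} := isOpen_lt continuous_const continuous_norm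
  -- The annulus is strictly inside the domain of `T`, since its closure must be; the numbers `1`
  -- and `2` are arbitrary.
  obtain ⟨P, E, k, hP, hE, h⟩ := exists_birkhoff_factorization_annulus hR₁
    (show R₀ + 1 < R₀ + 2 by linarith) hopen
    (fun z hz _ => show R₀ < ‖z‖ by linarith) hT
  have hnz : ∀ z ∈ {z : ℂ | R₀ + 1 < ‖z‖}, z ≠ 0 := fun z hz =>
    norm_pos_iff.1 (hR₁.trans hz)
  have hnz' : ∀ z ∈ {z : ℂ | R₀ < ‖z‖}, z ≠ 0 := fun z hz => norm_pos_iff.1 (hR₀.trans hz)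
  have hinvball : ∀ z : ℂ, z ≠ 0 → ∀ r : ℝ, 0 < r →
      (z⁻¹ ∈ Metric.ball (0 : ℂ) (1 / r) ↔ r < ‖z‖) := by
    intro z hz r hr
    rw [mem_ball_zero_iff, norm_inv, ← one_div,
      one_div_lt_one_div (norm_pos_iff.2 hz) hr]
  have hPinv : MemGLHolomorphic {z : ℂ | R₀ + 1 < ‖z‖} fun z => P z⁻¹ :=
    hP.comp (differentiableOn_inv.mono hnz) fun z hz => (hinvball z (hnz z hz) _ hR₁).2 hz
  have hD := memGLHolomorphic_diagonal_zpow k hnz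
  have hD' := memGLHolomorphic_diagonal_zpow k
    (fun z (hz : z ∈ {z : ℂ | R₀ < ‖z‖} ∩ Metric.ball 0 (R₀ + 2)) => hnz' z hz.1)
  have hPD := hPinv.mul hD
  have hinv : ∀ M : Matrix (Fin n) (Fin n) ℂ, IsUnit M → M * M⁻¹ = 1 ∧ M⁻¹ * M = 1 := fun M hM =>
    ⟨mul_nonsing_inv _ ((isUnit_iff_isUnit_det _).1 hM),
      nonsing_inv_mul _ ((isUnit_iff_isUnit_det _).1 hM)⟩
  -- The equation solved for `E`, namely `(P(1/z) D)⁻¹ T`, continues `E` to the whole plane. Solved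
  -- for `P`, as `T (D E)⁻¹` at `1/ζ`, it continues `P` to the disc of radius `1/R₀`.
  obtain ⟨E', hE', hE'₁, hE'₂⟩ := hE.exists_union Metric.isOpen_ball
    (isOpen_lt continuous_const continuous_norm)
    (hPD.inv.mul (hT.mono fun z (hz : R₀ + 1 < ‖z‖) => show R₀ < ‖z‖ by linarith))
    (fun z hz => by
      rw [h z hz.2 (mem_ball_zero_iff.1 hz.1), ← Matrix.mul_assoc,
        (hinv _ (hPD.2 z hz.2)).2, Matrix.one_mul])
  have hDE := hD'.mul (hE.mono Set.inter_subset_right)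
  have hTDE := (hT.mono Set.inter_subset_left).mul hDE.inv
  have hQ := hTDE.comp (V := {ζ : ℂ | ζ ≠ 0 ∧ ζ⁻¹ ∈ {z : ℂ | R₀ < ‖z‖} ∩ Metric.ball 0 (R₀ + 2)})
    (differentiableOn_inv.mono fun ζ hζ => hζ.1) fun ζ hζ => hζ.2
  have hopen2 : IsOpen {ζ : ℂ | ζ ≠ 0 ∧ ζ⁻¹ ∈ {z : ℂ | R₀ < ‖z‖} ∩ Metric.ball 0 (R₀ + 2)} :=
    (continuousOn_inv₀.isOpen_inter_preimage isOpen_compl_singleton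
      (hopen.inter Metric.isOpen_ball))
  obtain ⟨P', hP', hP'₁, hP'₂⟩ := hP.exists_union Metric.isOpen_ball hopen2 hQ
    (fun ζ hζ => by
      obtain ⟨hζ₁, hζ0, hζ₂, hζ₃⟩ := hζ
      have h1 : R₀ + 1 < ‖ζ⁻¹‖ := (hinvball _ (inv_ne_zero hζ0) _ hR₁).1 (by rwa [inv_inv])
      rw [h ζ⁻¹ h1 (mem_ball_zero_iff.1 hζ₃), inv_inv, Matrix.mul_assoc (P ζ),
        Matrix.mul_assoc (P ζ),
        (hinv _ (hDE.2 _ ⟨hζ₂, hζ₃⟩)).1, Matrix.mul_one])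
  have hmain : ∀ z : ℂ, R₀ < ‖z‖ → T z = P' z⁻¹ * diagonal (fun i => z ^ k i) * E' z := by
    intro z hz
    have hz0 := hnz' z hz
    by_cases hz₁ : R₀ + 1 < ‖z‖
    · rw [hP'₁ _ ((hinvball z hz0 _ hR₁).2 hz₁), hE'₂ z hz₁, ← Matrix.mul_assoc,
        (hinv _ (hPD.2 z hz₁)).1, Matrix.one_mul]
    · have hz₂ : z ∈ Metric.ball (0 : ℂ) (R₀ + 2) := mem_ball_zero_iff.2 (by linarith)
      rw [hE'₁ z hz₂, hP'₂ z⁻¹ ⟨inv_ne_zero hz0, by rw [inv_inv]; exact ⟨hz, hz₂⟩⟩, inv_inv,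
        Matrix.mul_assoc, Matrix.mul_assoc, (hinv _ (hDE.2 z ⟨hz, hz₂⟩)).2, Matrix.mul_one]
  have hP'' : MemGLHolomorphic (Metric.ball (0 : ℂ) (1 / R₀)) P' := by
    refine hP'.mono fun ζ hζ => ?_
    by_cases hζ₁ : ζ ∈ Metric.ball (0 : ℂ) (1 / (R₀ + 1))
    · exact Or.inl hζ₁
    · have hζ0 : ζ ≠ 0 := by
        rintro rfl
        exact hζ₁ (Metric.mem_ball_self (by positivity))
      refine Or.inr ⟨hζ0, (hinvball _ (inv_ne_zero hζ0) _ hR₀).1 (by rwa [inv_inv]), ?_⟩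
      rw [mem_ball_zero_iff]
      have h1 : ¬R₀ + 1 < ‖ζ⁻¹‖ := fun h0 =>
        hζ₁ (by simpa using (hinvball _ (inv_ne_zero hζ0) _ hR₁).2 h0)
      linarith
  have hE'' : MemGLHolomorphic Set.univ E' := hE'.mono fun z _ => by
    by_cases hz : ‖z‖ < R₀ + 2
    · exact Or.inl (mem_ball_zero_iff.2 hz)
    · exact Or.inr (show R₀ + 1 < ‖z‖ by linarith)
  have hsign : ∀ σ : Equiv.Perm (Fin n), IsUnit ((Equiv.Perm.sign σ : ℤ) : ℂ) := fun σ => by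
    rcases Int.units_eq_one_or (Equiv.Perm.sign σ) with h | h <;> simp [h]
  -- Sorting `-k` increasingly makes `k` antitone. Permuting the columns of `P` and the rows of `E`
  -- by the same permutation leaves the product unchanged.
  let σ := Tuple.sort fun i => -k i
  refine ⟨fun ζ => (P' ζ).submatrix id σ, fun z => (E' z).submatrix σ id, k ∘ σ,
    ⟨fun i j => hP''.1 i (σ j), fun ζ hζ => ?_⟩, ⟨fun i j => hE''.1 (σ i) j, fun z hz => ?_⟩,
    fun i j hij => neg_le_neg_iff.1 (Tuple.monotone_sort (fun i => -k i) hij), fun z hz => ?_⟩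
  · rw [isUnit_iff_isUnit_det, det_permute']
    exact (hsign σ).mul ((isUnit_iff_isUnit_det _).1 (hP''.2 ζ hζ))
  · rw [isUnit_iff_isUnit_det, det_permute]
    exact (hsign σ).mul ((isUnit_iff_isUnit_det _).1 (hE''.2 z hz))
  · have hdiag : diagonal (fun i => z ^ (k ∘ σ) i) =
        (diagonal fun i => z ^ k i).submatrix σ σ := by
      rw [submatrix_diagonal_equiv]
      rfl
    rw [hmain z hz, one_div, hdiag, submatrix_mul_equiv, submatrix_mul_equiv, submatrix_id_id]

end Factorization

/-! ### Holomorphic frames and their transition matrices -/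

section Frames

open Bundle Matrix

theorem RiemannSphere.contMDiff_coe :
    ContMDiff 𝓘(ℂ) 𝓘(ℂ) ω ((↑) : ℂ → OnePoint ℂ) :=
  contMDiffOn_univ.1 (contMDiffOn_symm_of_mem_maximalAtlas (e := RiemannSphere.chartZero)
    (IsManifold.subset_maximalAtlas (by exact Or.inl rfl)))

theorem RiemannSphere.contMDiff_inv_coe :
    ContMDiff 𝓘(ℂ) 𝓘(ℂ) ω fun z : ℂ => RiemannSphere.inv z := by
  have := contMDiffOn_symm_of_mem_maximalAtlas (I := 𝓘(ℂ)) (n := ω) (e := RiemannSphere.chartInfty)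
    (IsManifold.subset_maximalAtlas (by exact Or.inr rfl))
  have ht : RiemannSphere.chartInfty.target = Set.univ := rfl
  rw [ht, contMDiffOn_univ] at this
  exact this

theorem RiemannSphere.contMDiffOn_coord_inv :
    ContMDiffOn 𝓘(ℂ) 𝓘(ℂ) ω (fun x => RiemannSphere.coord (RiemannSphere.inv x))
      {((0 : ℂ) : OnePoint ℂ)}ᶜ := by
  have := contMDiffOn_of_mem_maximalAtlas (I := 𝓘(ℂ)) (n := ω) (e := RiemannSphere.chartInfty)
    (IsManifold.subset_maximalAtlas (by exact Or.inr rfl))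
  exact this.mono fun x hx => RiemannSphere.mem_source_chartInfty.2 hx

variable {n : ℕ} {V : OnePoint ℂ → Type*} [TopologicalSpace (TotalSpace (Fin n → ℂ) V)]
  [∀ x, AddCommGroup (V x)] [∀ x, Module ℂ (V x)] [∀ x, TopologicalSpace (V x)]
  [FiberBundle (Fin n → ℂ) V]

/-- The family `ψ` of coordinates on the fibers of `V` is a holomorphic frame over `W`. -/
structure IsFrameOn (ψ : ∀ x, V x ≃ₗ[ℂ] (Fin n → ℂ)) (W : Set (OnePoint ℂ)) : Prop where
  contMDiffOn : ContMDiffOn (𝓘(ℂ).prod 𝓘(ℂ, Fin n → ℂ)) 𝓘(ℂ, Fin n → ℂ) ω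
    (fun p : TotalSpace (Fin n → ℂ) V => ψ p.proj p.snd) (TotalSpace.proj ⁻¹' W)
  contMDiffOn_symm : ContMDiffOn (𝓘(ℂ).prod 𝓘(ℂ, Fin n → ℂ)) (𝓘(ℂ).prod 𝓘(ℂ, Fin n → ℂ)) ω
    (fun p : OnePoint ℂ × (Fin n → ℂ) =>
      (⟨p.1, (ψ p.1).symm p.2⟩ : TotalSpace (Fin n → ℂ) V)) (Prod.fst ⁻¹' W)

theorem IsFrameOn.mono {ψ : ∀ x, V x ≃ₗ[ℂ] (Fin n → ℂ)} {W W' : Set (OnePoint ℂ)}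
    (h : IsFrameOn ψ W) (hW : W' ⊆ W) : IsFrameOn ψ W' :=
  ⟨h.contMDiffOn.mono (Set.preimage_mono hW), h.contMDiffOn_symm.mono (Set.preimage_mono hW)⟩

theorem IsFrameOn.congr {ψ ψ' : ∀ x, V x ≃ₗ[ℂ] (Fin n → ℂ)} {W : Set (OnePoint ℂ)}
    (h : IsFrameOn ψ W) (hψ : ∀ x ∈ W, ψ' x = ψ x) : IsFrameOn ψ' W :=
  ⟨h.contMDiffOn.congr fun p hp => by rw [hψ p.proj hp],
    h.contMDiffOn_symm.congr fun p hp => by rw [hψ p.1 hp]⟩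

/-- Local trivializations are holomorphic frames. -/
theorem exists_isFrameOn_baseSet [VectorBundle ℂ (Fin n → ℂ) V]
    [ContMDiffVectorBundle ω (Fin n → ℂ) V 𝓘(ℂ)]
    (e : Trivialization (Fin n → ℂ) (TotalSpace.proj : TotalSpace (Fin n → ℂ) V → OnePoint ℂ))
    [MemTrivializationAtlas e] :
    ∃ ψ : ∀ x, V x ≃ₗ[ℂ] (Fin n → ℂ), IsFrameOn ψ e.baseSet ∧
      ∀ x ∈ e.baseSet, ∀ v, ψ x v = (e ⟨x, v⟩).2 := by
  classical
  -- Frames are families over all of `ℙ¹(ℂ)`; off the base set any linear isomorphism will do as a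
  -- default value.
  let ψ : ∀ x, V x ≃ₗ[ℂ] (Fin n → ℂ) := fun x =>
    if h : x ∈ e.baseSet then e.linearEquivAt ℂ x h
    else (trivializationAt (Fin n → ℂ) V x).linearEquivAt ℂ x
      (mem_baseSet_trivializationAt (Fin n → ℂ) V x)
  have hψ : ∀ x (h : x ∈ e.baseSet), ψ x = e.linearEquivAt ℂ x h := fun x h => dif_pos h
  refine ⟨ψ, ⟨?_, ?_⟩, fun x hx v => by rw [hψ x hx]; rfl⟩
  · have h1 := contMDiff_snd.comp_contMDiffOn (e.contMDiffOn (n := ω) (IB := 𝓘(ℂ)))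
    rw [e.source_eq] at h1
    refine h1.congr fun p hp => ?_
    rw [hψ p.proj hp]
    rfl
  · have h1 := e.contMDiffOn_symm (n := ω) (IB := 𝓘(ℂ))
    have h2 : e.target = Prod.fst ⁻¹' e.baseSet := by
      rw [e.target_eq]
      ext p
      simp
    rw [h2] at h1
    refine h1.congr fun p hp => ?_
    rw [hψ p.1 hp]
    exact e.mk_symm hp p.2

theorem exists_isFrameOn_nhds [VectorBundle ℂ (Fin n → ℂ) V]
    [ContMDiffVectorBundle ω (Fin n → ℂ) V 𝓘(ℂ)] (x : OnePoint ℂ) :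
    ∃ (ψ : ∀ x, V x ≃ₗ[ℂ] (Fin n → ℂ)) (W : Set (OnePoint ℂ)), IsOpen W ∧ x ∈ W ∧
      IsFrameOn ψ W := by
  obtain ⟨ψ, hψ, -⟩ := exists_isFrameOn_baseSet (trivializationAt (Fin n → ℂ) V x)
  exact ⟨ψ, _, (trivializationAt (Fin n → ℂ) V x).open_baseSet,
    mem_baseSet_trivializationAt (Fin n → ℂ) V x, hψ⟩

/-- Two frames differ by a holomorphic invertible matrix. -/
theorem IsFrameOn.memGLHolomorphic_transition {ψ₁ ψ₂ : ∀ x, V x ≃ₗ[ℂ] (Fin n → ℂ)}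
    {W : Set (OnePoint ℂ)} (h₁ : IsFrameOn ψ₁ W) (h₂ : IsFrameOn ψ₂ W) {U : Set ℂ}
    (hU : ∀ z ∈ U, (z : OnePoint ℂ) ∈ W) :
    ∃ T : ℂ → Matrix (Fin n) (Fin n) ℂ, MemGLHolomorphic U T ∧
      ∀ z : ℂ, ∀ v, ψ₁ z v = T z *ᵥ ψ₂ z v := by
  let T : ℂ → Matrix (Fin n) (Fin n) ℂ := fun z =>
    LinearMap.toMatrix' ((ψ₂ z).symm.trans (ψ₁ z)).toLinearMap
  have hT : ∀ z : ℂ, ∀ v, T z *ᵥ v = ψ₁ z ((ψ₂ z).symm v) := fun z v => by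
    rw [← Matrix.toLin'_apply, Matrix.toLin'_toMatrix']
    rfl
  refine ⟨T, ⟨fun i j => ?_, fun z _ => ?_⟩, fun z v => by simp [hT]⟩
  · have h3 : ContMDiffOn 𝓘(ℂ) (𝓘(ℂ).prod 𝓘(ℂ, Fin n → ℂ)) ω
        (fun z : ℂ => ((z : OnePoint ℂ), (Pi.single j 1 : Fin n → ℂ))) U :=
      (RiemannSphere.contMDiff_coe.prodMk contMDiff_const).contMDiffOn
    have h4 := h₁.contMDiffOn.comp (h₂.contMDiffOn_symm.comp h3 hU) hU
    have h5 := (contMDiffOn_iff_contDiffOn.1 h4).differentiableOn (by simp)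
    have h6 := differentiableOn_pi.1 h5 i
    refine h6.congr fun z _ => ?_
    simp [T, LinearMap.toMatrix'_apply]
  · rw [isUnit_iff_isUnit_det]
    have h := LinearEquiv.isUnit_det' ((ψ₂ z).symm.trans (ψ₁ z))
    rwa [← LinearMap.det_toMatrix'] at h

/-- A frame can be changed by a holomorphic invertible matrix. -/
theorem IsFrameOn.exists_mulVec {ψ : ∀ x, V x ≃ₗ[ℂ] (Fin n → ℂ)} {W : Set (OnePoint ℂ)}
    (hψ : IsFrameOn ψ W) {c : OnePoint ℂ → ℂ} (hc : ContMDiffOn 𝓘(ℂ) 𝓘(ℂ) ω c W) {U : Set ℂ}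
    (hU : IsOpen U) (hcU : Set.MapsTo c W U) {G : ℂ → Matrix (Fin n) (Fin n) ℂ}
    (hG : MemGLHolomorphic U G) :
    ∃ ψ' : ∀ x, V x ≃ₗ[ℂ] (Fin n → ℂ), IsFrameOn ψ' W ∧
      ∀ x ∈ W, ∀ v, ψ' x v = G (c x) *ᵥ ψ x v := by
  classical
  have hunit : ∀ x ∈ W, IsUnit (G (c x)).det := fun x hx =>
    (isUnit_iff_isUnit_det _).1 (hG.2 _ (hcU hx))
  let g : OnePoint ℂ → ((Fin n → ℂ) ≃ₗ[ℂ] (Fin n → ℂ)) := fun x =>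
    if h : IsUnit (G (c x)).det then
      Matrix.toLin'OfInv (nonsing_inv_mul _ h) (mul_nonsing_inv _ h) else LinearEquiv.refl ℂ _
  have hg : ∀ x ∈ W, ∀ v, g x v = G (c x) *ᵥ v := fun x hx v => by
    simp only [g, dif_pos (hunit x hx)]
    rfl
  have hg' : ∀ x ∈ W, ∀ v, (g x).symm v = (G (c x))⁻¹ *ᵥ v := fun x hx v => by
    simp only [g, dif_pos (hunit x hx)]
    rfl
  have key : ∀ M : ℂ → Matrix (Fin n) (Fin n) ℂ, MemGLHolomorphic U M →
      ContMDiffOn (𝓘(ℂ).prod 𝓘(ℂ, Fin n → ℂ)) 𝓘(ℂ, Fin n → ℂ) ω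
        (fun p : OnePoint ℂ × (Fin n → ℂ) => M (c p.1) *ᵥ p.2) (Prod.fst ⁻¹' W) := by
    intro M hM
    have hcont : ContDiffOn ℂ ω (fun q : ℂ × (Fin n → ℂ) => M q.1 *ᵥ q.2) (Prod.fst ⁻¹' U) := by
      rw [contDiffOn_pi]
      intro i
      simp only [mulVec, dotProduct]
      refine ContDiffOn.sum fun j _ => ContDiffOn.mul ?_ ?_
      · exact ((hM.1 i j).contDiffOn hU).comp contDiff_fst.contDiffOn fun q hq => hq
      · exact ((contDiff_apply ℂ ℂ j).comp contDiff_snd).contDiffOn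
    have h1 : ContMDiffOn (𝓘(ℂ).prod 𝓘(ℂ, Fin n → ℂ)) 𝓘(ℂ, ℂ × (Fin n → ℂ)) ω
        (fun p : OnePoint ℂ × (Fin n → ℂ) => (c p.1, p.2)) (Prod.fst ⁻¹' W) :=
      (hc.comp contMDiff_fst.contMDiffOn fun p hp => hp).prodMk_space contMDiff_snd.contMDiffOn
    exact hcont.contMDiffOn.comp h1 fun p hp => hcU hp
  refine ⟨fun x => (ψ x).trans (g x), ⟨?_, ?_⟩, fun x hx v => hg x hx _⟩
  · have h1 : ContMDiffOn (𝓘(ℂ).prod 𝓘(ℂ, Fin n → ℂ)) (𝓘(ℂ).prod 𝓘(ℂ, Fin n → ℂ)) ω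
        (fun p : TotalSpace (Fin n → ℂ) V => (p.proj, ψ p.proj p.snd)) (TotalSpace.proj ⁻¹' W) :=
      (Bundle.contMDiff_proj V).contMDiffOn.prodMk hψ.contMDiffOn
    exact ((key G hG).comp h1 fun p hp => hp).congr fun p hp => hg _ hp _
  · have h1 : ContMDiffOn (𝓘(ℂ).prod 𝓘(ℂ, Fin n → ℂ)) (𝓘(ℂ).prod 𝓘(ℂ, Fin n → ℂ)) ω
        (fun p : OnePoint ℂ × (Fin n → ℂ) => (p.1, (G (c p.1))⁻¹ *ᵥ p.2)) (Prod.fst ⁻¹' W) :=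
      contMDiff_fst.contMDiffOn.prodMk (key _ hG.inv)
    refine (hψ.contMDiffOn_symm.comp h1 fun p hp => hp).congr fun p hp => ?_
    simp only [LinearEquiv.trans_symm, LinearEquiv.trans_apply, Function.comp_apply, hg' _ hp]

theorem IsFrameOn.exists_union {ψ₁ ψ₂ : ∀ x, V x ≃ₗ[ℂ] (Fin n → ℂ)} {W₁ W₂ : Set (OnePoint ℂ)}
    (ho₁ : IsOpen W₁) (ho₂ : IsOpen W₂) (h₁ : IsFrameOn ψ₁ W₁) (h₂ : IsFrameOn ψ₂ W₂)
    (h : ∀ x ∈ W₁ ∩ W₂, ∀ v, ψ₁ x v = ψ₂ x v) :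
    ∃ ψ : ∀ x, V x ≃ₗ[ℂ] (Fin n → ℂ), IsFrameOn ψ (W₁ ∪ W₂) := by
  classical
  let ψ : ∀ x, V x ≃ₗ[ℂ] (Fin n → ℂ) := fun x => if x ∈ W₁ then ψ₁ x else ψ₂ x
  have hψ₁ : ∀ x ∈ W₁, ψ x = ψ₁ x := fun x hx => if_pos hx
  have hψ₂ : ∀ x ∈ W₂, ψ x = ψ₂ x := fun x hx => by
    by_cases hx1 : x ∈ W₁
    · rw [hψ₁ x hx1]
      exact LinearEquiv.ext fun v => h x ⟨hx1, hx⟩ v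
    · exact if_neg hx1
  have h₁' := h₁.congr hψ₁
  have h₂' := h₂.congr hψ₂
  have hπ : Continuous (TotalSpace.proj : TotalSpace (Fin n → ℂ) V → OnePoint ℂ) :=
    FiberBundle.continuous_proj _ _
  exact ⟨ψ, h₁'.contMDiffOn.union_of_isOpen h₂'.contMDiffOn (ho₁.preimage hπ) (ho₂.preimage hπ),
    h₁'.contMDiffOn_symm.union_of_isOpen h₂'.contMDiffOn_symm (ho₁.preimage continuous_fst)
      (ho₂.preimage continuous_fst)⟩

variable {V' : OnePoint ℂ → Type*} [TopologicalSpace (TotalSpace (Fin n → ℂ) V')]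
  [∀ x, AddCommGroup (V' x)] [∀ x, Module ℂ (V' x)] [∀ x, TopologicalSpace (V' x)]
  [FiberBundle (Fin n → ℂ) V']

theorem IsFrameOn.contMDiffOn_trans_symm {ψ : ∀ x, V x ≃ₗ[ℂ] (Fin n → ℂ)}
    {ψ' : ∀ x, V' x ≃ₗ[ℂ] (Fin n → ℂ)} {W : Set (OnePoint ℂ)} (h : IsFrameOn ψ W)
    (h' : IsFrameOn ψ' W) :
    ContMDiffOn (𝓘(ℂ).prod 𝓘(ℂ, Fin n → ℂ)) (𝓘(ℂ).prod 𝓘(ℂ, Fin n → ℂ)) ω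
      (fun p : TotalSpace (Fin n → ℂ) V =>
        (⟨p.proj, (ψ' p.proj).symm (ψ p.proj p.snd)⟩ : TotalSpace (Fin n → ℂ) V'))
      (TotalSpace.proj ⁻¹' W) := by
  have h1 : ContMDiffOn (𝓘(ℂ).prod 𝓘(ℂ, Fin n → ℂ)) (𝓘(ℂ).prod 𝓘(ℂ, Fin n → ℂ)) ω
      (fun p : TotalSpace (Fin n → ℂ) V => (p.proj, ψ p.proj p.snd)) (TotalSpace.proj ⁻¹' W) :=
    (Bundle.contMDiff_proj V).contMDiffOn.prodMk h.contMDiffOn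
  exact h'.contMDiffOn_symm.comp h1 fun p hp => hp

/-- Two bundles with frames over the members of an open cover which have the same transition
functions are isomorphic. -/
theorem holomorphicallyIsomorphic_of_frames {ψ₀ ψ₁ : ∀ x, V x ≃ₗ[ℂ] (Fin n → ℂ)}
    {ψ₀' ψ₁' : ∀ x, V' x ≃ₗ[ℂ] (Fin n → ℂ)} {W₀ W₁ : Set (OnePoint ℂ)} (ho₀ : IsOpen W₀)
    (ho₁ : IsOpen W₁) (hW : ∀ x, x ∈ W₀ ∨ x ∈ W₁) (h₀ : IsFrameOn ψ₀ W₀) (h₁ : IsFrameOn ψ₁ W₁)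
    (h₀' : IsFrameOn ψ₀' W₀) (h₁' : IsFrameOn ψ₁' W₁)
    (h : ∀ x ∈ W₀ ∩ W₁, ∀ v, (ψ₀' x).symm (ψ₀ x v) = (ψ₁' x).symm (ψ₁ x v)) :
    HolomorphicallyIsomorphic (Fin n → ℂ) V (Fin n → ℂ) V' := by
  classical
  let φ : ∀ x, V x ≃ₗ[ℂ] V' x := fun x =>
    if x ∈ W₀ then (ψ₀ x).trans (ψ₀' x).symm else (ψ₁ x).trans (ψ₁' x).symm
  have hφ₀ : ∀ x ∈ W₀, φ x = (ψ₀ x).trans (ψ₀' x).symm := fun x hx => if_pos hx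
  have hφ₁ : ∀ x ∈ W₁, φ x = (ψ₁ x).trans (ψ₁' x).symm := fun x hx => by
    by_cases hx0 : x ∈ W₀
    · rw [hφ₀ x hx0]
      exact LinearEquiv.ext fun v => h x ⟨hx0, hx⟩ v
    · exact if_neg hx0
  have hπ : Continuous (TotalSpace.proj : TotalSpace (Fin n → ℂ) V → OnePoint ℂ) :=
    FiberBundle.continuous_proj _ _
  have hπ' : Continuous (TotalSpace.proj : TotalSpace (Fin n → ℂ) V' → OnePoint ℂ) :=
    FiberBundle.continuous_proj _ _
  refine ⟨φ, fun p => ?_, fun p => ?_⟩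
  · rcases hW p.proj with hp | hp
    · exact ((h₀.contMDiffOn_trans_symm h₀').congr fun q hq => by rw [hφ₀ _ hq]; rfl).contMDiffAt
        ((ho₀.preimage hπ).mem_nhds hp)
    · exact ((h₁.contMDiffOn_trans_symm h₁').congr fun q hq => by rw [hφ₁ _ hq]; rfl).contMDiffAt
        ((ho₁.preimage hπ).mem_nhds hp)
  · rcases hW p.proj with hp | hp
    · exact ((h₀'.contMDiffOn_trans_symm h₀).congr fun q hq => by rw [hφ₀ _ hq]; rfl).contMDiffAt
        ((ho₀.preimage hπ').mem_nhds hp)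
    · exact ((h₁'.contMDiffOn_trans_symm h₁).congr fun q hq => by rw [hφ₁ _ hq]; rfl).contMDiffAt
        ((ho₁.preimage hπ').mem_nhds hp)

end Frames

/-! ### Triviality of bundles near compact subsets of the plane -/

section FramesOnCompacts

open Bundle Matrix

/-- The bundle `V` has a holomorphic frame over a neighbourhood of the set `K` of the plane. -/
def HasFrameNear (n : ℕ) (V : OnePoint ℂ → Type*) [TopologicalSpace (TotalSpace (Fin n → ℂ) V)]
    [∀ x, AddCommGroup (V x)] [∀ x, Module ℂ (V x)] [∀ x, TopologicalSpace (V x)]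
    [FiberBundle (Fin n → ℂ) V] (K : Set ℂ) : Prop :=
  ∃ U : Set ℂ, IsOpen U ∧ K ⊆ U ∧ ∃ ψ : ∀ x, V x ≃ₗ[ℂ] (Fin n → ℂ),
    IsFrameOn ψ ((↑) '' U : Set (OnePoint ℂ))

variable {n : ℕ} {V : OnePoint ℂ → Type*} [TopologicalSpace (TotalSpace (Fin n → ℂ) V)]
  [∀ x, AddCommGroup (V x)] [∀ x, Module ℂ (V x)] [∀ x, TopologicalSpace (V x)]
  [FiberBundle (Fin n → ℂ) V]

theorem HasFrameNear.mono {K K' : Set ℂ} (h : HasFrameNear n V K) (hK : K' ⊆ K) :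
    HasFrameNear n V K' := by
  obtain ⟨U, ho, hU, hψ⟩ := h
  exact ⟨U, ho, hK.trans hU, hψ⟩

theorem hasFrameNear_singleton [VectorBundle ℂ (Fin n → ℂ) V]
    [ContMDiffVectorBundle ω (Fin n → ℂ) V 𝓘(ℂ)] (z : ℂ) : HasFrameNear n V {z} := by
  obtain ⟨ψ, W, hW, hz, hψ⟩ := exists_isFrameOn_nhds (n := n) (V := V) (z : OnePoint ℂ)
  exact ⟨_, hW.preimage OnePoint.continuous_coe, Set.singleton_subset_iff.2 hz, ψ,
    hψ.mono (Set.image_preimage_subset _ _)⟩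

/-- Cartan's lemma on a strip around the level `l = m`: if `ψ₁ = T ψ₂` there and `G₁ T = G₂`, then
`G₁ ψ₁` and `G₂ ψ₂` agree and form one frame. -/
theorem HasFrameNear.glue {K : Set ℂ} (hK : IsCompact K) {l : ℂ → ℝ} (hl : ContDiff ℝ 1 l) {m : ℝ}
    (h₁ : HasFrameNear n V (K ∩ {z | l z ≤ m})) (h₂ : HasFrameNear n V (K ∩ {z | m ≤ l z})) :
    HasFrameNear n V K := by
  obtain ⟨U₁, ho₁, hK₁, ψ₁, hψ₁⟩ := h₁
  obtain ⟨U₂, ho₂, hK₂, ψ₂, hψ₂⟩ := h₂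
  have hlc := hl.continuous
  -- By compactness, the points of `K` outside `U₁` have `l` bounded away above `m`, and those
  -- outside `U₂` below `m`. This leaves room for `s < m < t`, and for a compact neighbourhood `L`
  -- of `K` whose part over `[s, t]` lies in both `U₁` and `U₂`.
  obtain ⟨a₁, ha₁, hl₁⟩ := (hK.diff ho₁).exists_forall_le' hlc.continuousOn (a := m)
    fun z hz => lt_of_not_ge fun h => hz.2 (hK₁ ⟨hz.1, h⟩)
  obtain ⟨a₂, ha₂, hl₂⟩ := (hK.diff ho₂).exists_forall_le' hlc.neg.continuousOn (a := -m)
    fun z hz => neg_lt_neg <| lt_of_not_ge fun h => hz.2 (hK₂ ⟨hz.1, h⟩)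
  obtain ⟨t, hmt, hta⟩ := exists_between ha₁
  obtain ⟨s, has, hsm⟩ := exists_between (neg_lt_of_neg_lt ha₂)
  have hst : s < t := hsm.trans hmt
  obtain ⟨L, hL, hKL, hLO⟩ := exists_compact_between hK
    ((ho₁.union (isOpen_lt continuous_const hlc)).inter
      (ho₂.union (isOpen_lt hlc continuous_const)) :
      IsOpen ((U₁ ∪ {z | t < l z}) ∩ (U₂ ∪ {z | l z < s})))
    (fun z hz => by
      constructor
      · by_cases h : z ∈ U₁
        · exact Or.inl h
        · exact Or.inr (hta.trans_le (hl₁ z ⟨hz, h⟩))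
      · by_cases h : z ∈ U₂
        · exact Or.inl h
        · exact Or.inr ((le_neg_of_le_neg (hl₂ z ⟨hz, h⟩)).trans_lt has))
  have hL₁ : ∀ z ∈ L, l z ≤ t → z ∈ U₁ := fun z hz h =>
    (hLO hz).1.resolve_right (not_lt.2 h)
  have hL₂ : ∀ z ∈ L, s ≤ l z → z ∈ U₂ := fun z hz h =>
    (hLO hz).2.resolve_right (not_lt.2 h)
  obtain ⟨T, hT, hTψ⟩ := (hψ₁.mono (W' := (↑) '' (U₁ ∩ U₂))
    (Set.image_mono Set.inter_subset_left)).memGLHolomorphic_transition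
    (hψ₂.mono (Set.image_mono Set.inter_subset_right)) (U := U₁ ∩ U₂)
    (fun z hz => Set.mem_image_of_mem _ hz)
  obtain ⟨G₁, G₂, hG₁, hG₂, hG⟩ := exists_multiplicative_cousin (R := interior L)
    (K := L ∩ (l ⁻¹' Set.Icc s t)) isOpen_interior hl hst
    (hL.inter_right (isClosed_Icc.preimage hlc))
    (fun z hz => ⟨interior_subset hz.1.1, le_of_lt hz.2.2, le_of_lt hz.1.2⟩) (ho₁.inter ho₂)
    (fun z hz => ⟨hL₁ z hz.1 hz.2.2, hL₂ z hz.1 hz.2.1⟩) hT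
  have hoL₁ : IsOpen (interior L ∩ {z | l z < t}) :=
    isOpen_interior.inter (isOpen_lt hlc continuous_const)
  have hoL₂ : IsOpen (interior L ∩ {z | s < l z}) :=
    isOpen_interior.inter (isOpen_lt continuous_const hlc)
  have hcoord : ∀ S : Set ℂ, ContMDiffOn 𝓘(ℂ) 𝓘(ℂ) ω RiemannSphere.coord
      ((↑) '' S : Set (OnePoint ℂ)) := fun S => RiemannSphere.contMDiffOn_coord.mono <| by
    rintro _ ⟨z, -, rfl⟩
    exact OnePoint.coe_ne_infty z
  have hmaps : ∀ S : Set ℂ, Set.MapsTo RiemannSphere.coord ((↑) '' S : Set (OnePoint ℂ)) S := by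
    rintro S _ ⟨z, hz, rfl⟩
    exact hz
  obtain ⟨ψ₁', hψ₁', h₁'⟩ := (hψ₁.mono (Set.image_mono fun z hz =>
    hL₁ z (interior_subset hz.1) (le_of_lt hz.2))).exists_mulVec (hcoord _) hoL₁ (hmaps _) hG₁
  obtain ⟨ψ₂', hψ₂', h₂'⟩ := (hψ₂.mono (Set.image_mono fun z hz =>
    hL₂ z (interior_subset hz.1) (le_of_lt hz.2))).exists_mulVec (hcoord _) hoL₂ (hmaps _) hG₂
  obtain ⟨ψ, hψ⟩ := hψ₁'.exists_union (OnePoint.isOpenMap_coe _ hoL₁)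
    (OnePoint.isOpenMap_coe _ hoL₂) hψ₂' (by
      rintro x hx v
      obtain ⟨z, hz, rfl⟩ := hx.1
      obtain ⟨w, hw, hwz⟩ := hx.2
      obtain rfl := OnePoint.coe_injective hwz
      rw [h₁' _ hx.1, h₂' _ hx.2, RiemannSphere.coord_coe, hTψ, ← hG _ ⟨hz, hw⟩, mulVec_mulVec])
  refine ⟨_, hoL₁.union hoL₂, fun z hz => ?_, ψ, by rwa [Set.image_union]⟩
  rcases lt_or_ge (l z) t with h | h
  · exact Or.inl ⟨hKL hz, h⟩
  · exact Or.inr ⟨hKL hz, hst.trans_le h⟩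

/-- A frame near a level set of `K` is one near a whole slab, by compactness. A fine enough
subdivision of the range of `l` puts consecutive pieces into such slabs, and they are glued one
after another. -/
theorem hasFrameNear_of_levels {K : Set ℂ} (hK : IsCompact K) {l : ℂ → ℝ} (hl : ContDiff ℝ 1 l)
    (h : ∀ t, HasFrameNear n V (K ∩ {z | l z = t})) : HasFrameNear n V K := by
  have hlc := hl.continuous
  have hloc : ∀ t, ∃ δ > 0, HasFrameNear n V (K ∩ {z | |l z - t| < δ}) := fun t => by
    obtain ⟨U, ho, hU, ψ, hψ⟩ := h t
    obtain ⟨δ, hδ, hlδ⟩ := (hK.diff ho).exists_forall_le' (f := fun z => |l z - t|)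
      (by fun_prop) (a := 0)
      fun z hz => abs_pos.2 fun h0 => hz.2 (hU ⟨hz.1, sub_eq_zero.1 h0⟩)
    exact ⟨δ, hδ, U, ho, fun z hz => by_contra fun hzU =>
      (hlδ z ⟨hz.1, hzU⟩).not_gt hz.2, ψ, hψ⟩
  choose δ hδ hframe using hloc
  obtain ⟨C, hC⟩ := hK.exists_bound_of_continuousOn hlc.continuousOn
  have hC' : ∀ z ∈ K, l z ∈ Set.Icc (-|C|) |C| := fun z hz =>
    abs_le.1 ((hC z hz).trans (le_abs_self C))
  obtain ⟨τ, hτ0, hτ, ⟨N, hN⟩, hcover⟩ := exists_monotone_Icc_subset_open_cover_Icc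
    (neg_le_self (abs_nonneg C)) (c := fun t : ℝ => {x | |(x : ℝ) - t| < δ t})
    (fun t => isOpen_lt (by fun_prop) continuous_const)
    (fun x _ => Set.mem_iUnion.2 ⟨x, by simpa using hδ x⟩)
  have key : ∀ k, HasFrameNear n V (K ∩ {z | l z ≤ τ k}) := by
    intro k
    induction k with
    | zero =>
      refine (h (-|C|)).mono fun z hz => ⟨hz.1, le_antisymm ?_ (hC' z hz.1).1⟩
      exact hz.2.trans hτ0.le
    | succ k ih =>
      refine HasFrameNear.glue (hK.inter_right (isClosed_le hlc continuous_const)) hl (m := τ k)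
        (ih.mono fun z hz => ⟨hz.1.1, hz.2⟩) ?_
      obtain ⟨t, ht⟩ := hcover k
      exact (hframe t).mono fun z hz =>
        ⟨hz.1.1, @ht ⟨l z, hC' z hz.1.1⟩ ⟨hz.2, hz.1.2⟩⟩
  refine (key N).mono fun z hz => ⟨hz, ?_⟩
  exact (hC' z hz).2.trans (hN N le_rfl).ge

/-- Slicing by the real part and then by the imaginary part reduces the claim to single points,
where it is local triviality. -/
theorem IsCompact.hasFrameNear [VectorBundle ℂ (Fin n → ℂ) V]
    [ContMDiffVectorBundle ω (Fin n → ℂ) V 𝓘(ℂ)] {K : Set ℂ} (hK : IsCompact K) :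
    HasFrameNear n V K := by
  refine hasFrameNear_of_levels hK Complex.reCLM.contDiff fun s =>
    hasFrameNear_of_levels (hK.inter_right (isClosed_eq Complex.continuous_re continuous_const))
      Complex.imCLM.contDiff fun t => (hasFrameNear_singleton ⟨s, t⟩).mono ?_
  rintro z ⟨⟨-, hs⟩, ht⟩
  exact Complex.ext hs ht

end FramesOnCompacts

/-! ### Grothendieck's theorem: existence and uniqueness of the splitting -/

section Splitting

open RiemannSphere Bundle Matrix

variable {n : ℕ}

/-- The standard frames of a direct sum of line bundles. -/
theorem exists_isFrameOn_sumLineBundles (κ : Fin n → ℤ) :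
    ∃ β₀ β₁ : ∀ x, (sumLineBundles κ).Fiber x ≃ₗ[ℂ] (Fin n → ℂ),
      IsFrameOn β₀ {OnePoint.infty}ᶜ ∧ IsFrameOn β₁ {((0 : ℂ) : OnePoint ℂ)}ᶜ ∧
      ∀ z : ℂ, z ≠ 0 → ∀ v i, β₀ z v i = z ^ κ i * β₁ z v i := by
  have : ∀ i, MemTrivializationAtlas ((sumLineBundles κ).localTriv i) := fun i => ⟨⟨i, rfl⟩⟩
  obtain ⟨β₀, h₀, hβ₀⟩ := exists_isFrameOn_baseSet ((sumLineBundles κ).localTriv fun _ => 0)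
  obtain ⟨β₁, h₁, hβ₁⟩ := exists_isFrameOn_baseSet ((sumLineBundles κ).localTriv fun _ => 1)
  rw [← VectorBundleCore.baseSet_at] at h₀ h₁ hβ₀ hβ₁
  have hb₀ : {OnePoint.infty}ᶜ ⊆ (sumLineBundles κ).baseSet fun _ => 0 := fun x hx =>
    Set.mem_iInter.2 fun j => hx
  have hb₁ : {((0 : ℂ) : OnePoint ℂ)}ᶜ ⊆ (sumLineBundles κ).baseSet fun _ => 1 := fun x hx =>
    Set.mem_iInter.2 fun j => hx
  refine ⟨β₀, β₁, h₀.mono hb₀, h₁.mono hb₁, fun z hz v i => ?_⟩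
  have hz₀ : (z : OnePoint ℂ) ∈ (sumLineBundles κ).baseSet fun _ => 0 :=
    hb₀ (OnePoint.coe_ne_infty z)
  have hz₁ : (z : OnePoint ℂ) ∈ (sumLineBundles κ).baseSet fun _ => 1 :=
    hb₁ fun h => hz (OnePoint.coe_injective h)
  rw [hβ₀ _ hz₀, hβ₁ _ hz₁, VectorBundleCore.localTriv_apply, VectorBundleCore.localTriv_apply]
  have h := (sumLineBundles κ).coordChange_comp ((sumLineBundles κ).indexAt z) (fun _ => 1)
    (fun _ => 0) z ⟨⟨(sumLineBundles κ).mem_baseSet_at z, hz₁⟩, hz₀⟩ v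
  refine (congrFun h i).symm.trans ?_
  generalize (sumLineBundles κ).coordChange ((sumLineBundles κ).indexAt z) (fun _ => 1) z v = w
  change ((coord z ^ expo (κ i) 1 0) • ContinuousLinearMap.id ℂ ℂ) (w i) = _
  simp [expo]

section

variable {V : OnePoint ℂ → Type*} [TopologicalSpace (TotalSpace (Fin n → ℂ) V)]
  [∀ x, AddCommGroup (V x)] [∀ x, Module ℂ (V x)] [∀ x, TopologicalSpace (V x)]
  [FiberBundle (Fin n → ℂ) V]
  {V' : OnePoint ℂ → Type*} [TopologicalSpace (TotalSpace (Fin n → ℂ) V')]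
  [∀ x, AddCommGroup (V' x)] [∀ x, Module ℂ (V' x)] [∀ x, TopologicalSpace (V' x)]
  [FiberBundle (Fin n → ℂ) V']

/-- Bundles with the same diagonal transition functions are isomorphic. -/
theorem holomorphicallyIsomorphic_of_diagonal {ψ₀ ψ₁ : ∀ x, V x ≃ₗ[ℂ] (Fin n → ℂ)}
    {ψ₀' ψ₁' : ∀ x, V' x ≃ₗ[ℂ] (Fin n → ℂ)} {W₀ W₁ : Set (OnePoint ℂ)} (ho₀ : IsOpen W₀)
    (ho₁ : IsOpen W₁) (hW : ∀ x, x ∈ W₀ ∨ x ∈ W₁) (hW₀ : OnePoint.infty ∉ W₀)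
    (hW₁ : ((0 : ℂ) : OnePoint ℂ) ∉ W₁) (h₀ : IsFrameOn ψ₀ W₀) (h₁ : IsFrameOn ψ₁ W₁)
    (h₀' : IsFrameOn ψ₀' W₀) (h₁' : IsFrameOn ψ₁' W₁) (κ : Fin n → ℤ)
    (h : ∀ z : ℂ, z ≠ 0 → (z : OnePoint ℂ) ∈ W₀ → (z : OnePoint ℂ) ∈ W₁ → ∀ v i,
      ψ₀ z v i = z ^ κ i * ψ₁ z v i)
    (h' : ∀ z : ℂ, z ≠ 0 → (z : OnePoint ℂ) ∈ W₀ → (z : OnePoint ℂ) ∈ W₁ → ∀ v i,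
      ψ₀' z v i = z ^ κ i * ψ₁' z v i) :
    HolomorphicallyIsomorphic (Fin n → ℂ) V (Fin n → ℂ) V' := by
  refine holomorphicallyIsomorphic_of_frames ho₀ ho₁ hW h₀ h₁ h₀' h₁' fun x hx v => ?_
  induction x using OnePoint.rec with
  | infty => exact absurd hx.1 hW₀
  | coe z =>
    have hz : z ≠ 0 := by
      rintro rfl
      exact hW₁ hx.2
    refine (ψ₀' z).injective (funext fun i => ?_)
    rw [LinearEquiv.apply_symm_apply, h z hz hx.1 hx.2, h' z hz hx.1 hx.2,
      LinearEquiv.apply_symm_apply]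

variable (V) in
/-- **Grothendieck's splitting theorem**, existence. -/
theorem exists_holomorphicallyIsomorphic_sumLineBundles [VectorBundle ℂ (Fin n → ℂ) V]
    [ContMDiffVectorBundle ω (Fin n → ℂ) V 𝓘(ℂ)] :
    ∃ k : Fin n → ℤ, HolomorphicallyIsomorphic (Fin n → ℂ) V
      (Fin n → ℂ) (sumLineBundles k).Fiber := by
  obtain ⟨ψ₁, W, hW, hinf, hψ₁⟩ := exists_isFrameOn_nhds (n := n) (V := V) OnePoint.infty
  obtain ⟨r₁, hr₁, hr₁W⟩ :=
    ((OnePoint.isOpen_iff_of_mem hinf).1 hW).2.isBounded.subset_ball_lt 0 0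
  have hrW : ∀ z : ℂ, r₁ ≤ ‖z‖ → (z : OnePoint ℂ) ∈ W := fun z hz => by
    by_contra h
    have := hr₁W (show z ∈ ((↑) ⁻¹' W : Set ℂ)ᶜ from h)
    rw [mem_ball_zero_iff] at this
    exact this.not_ge hz
  obtain ⟨U₀, ho₀, hU₀, ψ₀, hψ₀⟩ :=
    (isCompact_closedBall (0 : ℂ) (r₁ + 1)).hasFrameNear (n := n) (V := V)
  obtain ⟨T, hT, hTψ⟩ := (hψ₁.mono (W' := (↑) '' (U₀ ∩ (↑) ⁻¹' W))
    (by rintro _ ⟨z, hz, rfl⟩; exact hz.2)).memGLHolomorphic_transition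
    (hψ₀.mono (Set.image_mono Set.inter_subset_left)) (U := U₀ ∩ (↑) ⁻¹' W)
    (fun z hz => Set.mem_image_of_mem _ hz)
  -- From `ψ₁ = P(1/z) D E ψ₀` on the annulus, the frames `P⁻¹ ψ₁` near infinity and `E ψ₀` on the
  -- disc differ only by the diagonal matrix `D`.
  obtain ⟨P, E, k, hP, hE, hPE⟩ := exists_birkhoff_factorization_annulus hr₁
    (lt_add_one r₁) (ho₀.inter (hW.preimage OnePoint.continuous_coe))
    (fun z h₁ h₂ => ⟨hU₀ (mem_closedBall_zero_iff.2 h₂), hrW z h₁⟩) hT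
  set W₀ : Set (OnePoint ℂ) := (↑) '' Metric.ball (0 : ℂ) (r₁ + 1) with hW₀
  set W₁ : Set (OnePoint ℂ) := RiemannSphere.inv ⁻¹' ((↑) '' Metric.ball (0 : ℂ) (1 / r₁)) with hW₁
  have hmem₀ : ∀ z : ℂ, (z : OnePoint ℂ) ∈ W₀ ↔ ‖z‖ < r₁ + 1 := fun z => by
    rw [hW₀, OnePoint.coe_injective.mem_set_image, mem_ball_zero_iff]
  have hinf₀ : OnePoint.infty ∉ W₀ := OnePoint.infty_notMem_image_coe
  have hzero₁ : ((0 : ℂ) : OnePoint ℂ) ∉ W₁ := by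
    rw [hW₁, Set.mem_preimage, RiemannSphere.inv_zero]
    exact OnePoint.infty_notMem_image_coe
  have hmem₁ : ∀ z : ℂ, (z : OnePoint ℂ) ∈ W₁ ↔ r₁ < ‖z‖ := fun z => by
    by_cases hz : z = 0
    · subst hz
      simp [hzero₁, hr₁.le]
    · rw [hW₁, Set.mem_preimage, inv_coe hz, OnePoint.coe_injective.mem_set_image,
        mem_ball_zero_iff, norm_inv, one_div, inv_lt_inv₀ (norm_pos_iff.2 hz) hr₁]
  have hinf₁ : OnePoint.infty ∈ W₁ :=
    ⟨0, Metric.mem_ball_self (one_div_pos.2 hr₁), RiemannSphere.inv_infty.symm⟩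
  have hoW₀ : IsOpen W₀ := OnePoint.isOpenMap_coe _ Metric.isOpen_ball
  have hoW₁ : IsOpen W₁ :=
    (OnePoint.isOpenMap_coe _ Metric.isOpen_ball).preimage RiemannSphere.continuous_inv
  have hW₁W : W₁ ⊆ W := fun x hx => by
    induction x using OnePoint.rec with
    | infty => exact hinf
    | coe z => exact hrW z ((hmem₁ z).1 hx).le
  have hW₀' : W₀ ⊆ {OnePoint.infty}ᶜ := Set.subset_compl_singleton_iff.2 hinf₀
  have hW₁' : W₁ ⊆ {((0 : ℂ) : OnePoint ℂ)}ᶜ := Set.subset_compl_singleton_iff.2 hzero₁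
  obtain ⟨χ₀, hχ₀, hχ₀E⟩ := (hψ₀.mono (W' := W₀) (Set.image_mono
    (Metric.ball_subset_closedBall.trans hU₀))).exists_mulVec (contMDiffOn_coord.mono hW₀')
    Metric.isOpen_ball (by rintro _ ⟨z, hz, rfl⟩; exact hz) hE
  obtain ⟨χ₁, hχ₁, hχ₁P⟩ := (hψ₁.mono hW₁W).exists_mulVec (contMDiffOn_coord_inv.mono hW₁')
    Metric.isOpen_ball (by rintro x ⟨z, hz, hzx⟩; beta_reduce; rwa [← hzx]) hP.inv
  -- The sign changes because `T` carries the coordinates over the disc to those near infinity,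
  -- whereas the exponent of `𝒪(k)` describes the opposite passage.
  obtain ⟨β₀, β₁, hβ₀, hβ₁, hβ⟩ := exists_isFrameOn_sumLineBundles fun i => -k i
  refine ⟨fun i => -k i, holomorphicallyIsomorphic_of_diagonal hoW₀ hoW₁ (fun x => ?_) hinf₀ hzero₁
    hχ₀ hχ₁ (hβ₀.mono hW₀') (hβ₁.mono hW₁') (fun i => -k i) (fun z hz hz₀ hz₁ v i => ?_)
    fun z hz _ _ v i => hβ z hz v i⟩
  · induction x using OnePoint.rec with
    | infty => exact Or.inr hinf₁
    | coe z =>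
      rw [hmem₀, hmem₁]
      exact (lt_or_ge ‖z‖ (r₁ + 1)).imp_right (lt_add_one r₁).trans_le
  · have hz₁' := (hmem₁ z).1 hz₁
    have hPu : IsUnit (P z⁻¹).det := (isUnit_iff_isUnit_det _).1 <| hP.2 _ <| by
      rw [mem_ball_zero_iff, norm_inv, one_div]
      exact inv_strictAnti₀ hr₁ hz₁'
    have h : χ₁ z v = diagonal (fun i => z ^ k i) *ᵥ χ₀ z v := by
      rw [hχ₁P _ hz₁, hχ₀E _ hz₀, hTψ, inv_coe hz, coord_coe, coord_coe,
        hPE z hz₁' ((hmem₀ z).1 hz₀), mulVec_mulVec, mulVec_mulVec, Matrix.mul_assoc,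
        nonsing_inv_mul_cancel_left _ _ hPu]
    rw [h, mulVec_diagonal, ← mul_assoc, ← zpow_add₀ hz, neg_add_cancel, zpow_zero, one_mul]

end

/-- Permuting the coordinates of both standard frames by one constant matrix turns the transition
function of one sum into that of the other. -/
theorem holomorphicallyIsomorphic_sumLineBundles_of_perm {a b : Fin n → ℤ} (σ : Fin n ≃ Fin n)
    (h : ∀ i, a i = b (σ i)) :
    HolomorphicallyIsomorphic (Fin n → ℂ) (sumLineBundles a).Fiber
      (Fin n → ℂ) (sumLineBundles b).Fiber := by
  obtain ⟨α₀, α₁, hα₀, hα₁, hα⟩ := exists_isFrameOn_sumLineBundles a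
  obtain ⟨β₀, β₁, hβ₀, hβ₁, hβ⟩ := exists_isFrameOn_sumLineBundles b
  have hG : MemGLHolomorphic Set.univ
      fun _ => (1 : Matrix (Fin n) (Fin n) ℂ).submatrix σ (Equiv.refl _) :=
    ⟨fun i j => differentiableOn_const _, fun _ _ => (isUnit_submatrix_equiv σ _).2 isUnit_one⟩
  have hGv : ∀ (w : Fin n → ℂ) i,
      ((1 : Matrix (Fin n) (Fin n) ℂ).submatrix σ (Equiv.refl _) *ᵥ w) i = w (σ i) := fun w i => by
    simp [mulVec, dotProduct, one_apply]
  obtain ⟨γ₀, hγ₀, hγβ₀⟩ := hβ₀.exists_mulVec (c := fun _ => 0) contMDiffOn_const isOpen_univ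
    (Set.mapsTo_univ _ _) hG
  obtain ⟨γ₁, hγ₁, hγβ₁⟩ := hβ₁.exists_mulVec (c := fun _ => 0) contMDiffOn_const isOpen_univ
    (Set.mapsTo_univ _ _) hG
  refine holomorphicallyIsomorphic_of_diagonal OnePoint.isClosed_infty.isOpen_compl
    isOpen_compl_singleton (fun x => ?_) (by simp) (by simp) hα₀ hα₁ hγ₀ hγ₁ a
    (fun z hz _ _ => hα z hz) fun z hz hz₀ hz₁ v i => ?_
  · by_cases hx : x = OnePoint.infty
    · subst hx
      exact Or.inr (OnePoint.infty_ne_coe _)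
    · exact Or.inl hx
  · rw [hγβ₀ _ hz₀, hγβ₁ _ hz₁, hGv, hGv, hβ z hz, h]

variable {l : ℕ}

/-- The matrix entries of a bundle map, read in frames along a parametrized affine line `c`, are
entire; it is used for `c z = z` and `c z = 1/z`. -/
theorem IsFrameOn.differentiable_coordinates {V : OnePoint ℂ → Type*}
    [TopologicalSpace (TotalSpace (Fin n → ℂ) V)] [∀ x, AddCommGroup (V x)] [∀ x, Module ℂ (V x)]
    [∀ x, TopologicalSpace (V x)] [FiberBundle (Fin n → ℂ) V] {V' : OnePoint ℂ → Type*}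
    [TopologicalSpace (TotalSpace (Fin l → ℂ) V')] [∀ x, AddCommGroup (V' x)]
    [∀ x, Module ℂ (V' x)] [∀ x, TopologicalSpace (V' x)] [FiberBundle (Fin l → ℂ) V']
    {ψ : ∀ x, V x ≃ₗ[ℂ] (Fin n → ℂ)} {ψ' : ∀ x, V' x ≃ₗ[ℂ] (Fin l → ℂ)} {W : Set (OnePoint ℂ)}
    (hψ : IsFrameOn ψ W) (hψ' : IsFrameOn ψ' W) {φ : ∀ x, V x ≃ₗ[ℂ] V' x}
    (hφ : ContMDiff (𝓘(ℂ).prod 𝓘(ℂ, Fin n → ℂ)) (𝓘(ℂ).prod 𝓘(ℂ, Fin l → ℂ)) ω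
      (fun p : TotalSpace (Fin n → ℂ) V => (⟨p.proj, φ p.proj p.snd⟩ : TotalSpace (Fin l → ℂ) V')))
    {c : ℂ → OnePoint ℂ} (hc : ContMDiff 𝓘(ℂ) 𝓘(ℂ) ω c) (hcW : ∀ z, c z ∈ W) (v : Fin n → ℂ)
    (i : Fin l) : Differentiable ℂ fun z => ψ' (c z) (φ (c z) ((ψ (c z)).symm v)) i := by
  have h1 : ContMDiffOn 𝓘(ℂ) (𝓘(ℂ).prod 𝓘(ℂ, Fin n → ℂ)) ω (fun z => (c z, v)) Set.univ :=
    (hc.prodMk contMDiff_const).contMDiffOn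
  have h2 := hψ'.contMDiffOn.comp
    (hφ.comp_contMDiffOn (hψ.contMDiffOn_symm.comp h1 fun z _ => hcW z)) fun z _ => hcW z
  have h3 := (contMDiffOn_iff_contDiffOn.1 h2).differentiableOn (by simp)
  exact differentiable_pi.1 (differentiableOn_univ.1 h3) i

/-- An isomorphism `⨁ 𝒪(aⱼ) ≃ ⨁ 𝒪(bᵢ)` has no components from `𝒪(aⱼ)` to `𝒪(bᵢ)` for `bᵢ < aⱼ`. -/
theorem HolomorphicallyIsomorphic.exists_linearEquiv {a : Fin n → ℤ} {b : Fin l → ℤ}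
    {φ : ∀ x, (sumLineBundles a).Fiber x ≃ₗ[ℂ] (sumLineBundles b).Fiber x}
    (hφ : ContMDiff (𝓘(ℂ).prod 𝓘(ℂ, Fin n → ℂ)) (𝓘(ℂ).prod 𝓘(ℂ, Fin l → ℂ)) ω
      (fun p : TotalSpace (Fin n → ℂ) (sumLineBundles a).Fiber =>
        (⟨p.proj, φ p.proj p.snd⟩ : TotalSpace (Fin l → ℂ) (sumLineBundles b).Fiber))) :
    ∃ A : (Fin n → ℂ) ≃ₗ[ℂ] (Fin l → ℂ), ∀ i j, b i < a j → A (Pi.single j 1) i = 0 := by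
  obtain ⟨α₀, α₁, hα₀, hα₁, hα⟩ := exists_isFrameOn_sumLineBundles a
  obtain ⟨β₀, β₁, hβ₀, hβ₁, hβ⟩ := exists_isFrameOn_sumLineBundles b
  refine ⟨((α₀ (0 : ℂ)).symm.trans (φ (0 : ℂ))).trans (β₀ (0 : ℂ)), fun i j hij => ?_⟩
  have hd₀ := hα₀.differentiable_coordinates hβ₀ hφ contMDiff_coe
    (fun z => OnePoint.coe_ne_infty z) (Pi.single j 1) i
  have hd₁ := hα₁.differentiable_coordinates hβ₁ hφ contMDiff_inv_coe
    (fun z h => OnePoint.coe_ne_infty z (by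
      rw [← RiemannSphere.inv_inv z, h, RiemannSphere.inv_zero])) (Pi.single j 1) i
  -- Liouville: the entry in the frames over `U₀` is `z ^ (b i - a j)` times the entry in the frames
  -- over `U₁`. The latter is entire in `1/z`, hence has a limit at infinity, while the power tends
  -- to `0`.
  refine hd₀.apply_eq_of_tendsto_cocompact (0 : ℂ) (c := 0) ?_
  have hlim := (hd₁.continuous.tendsto (0 : ℂ)).comp (Filter.tendsto_inv₀_cobounded (α := ℂ))
  have hpow : Filter.Tendsto (fun z : ℂ => z ^ (b i - a j)) (Bornology.cobounded ℂ) (𝓝 0) := by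
    obtain ⟨m, hm⟩ := Int.eq_ofNat_of_zero_le (show 0 ≤ a j - b i - 1 by omega)
    have h := ((Filter.tendsto_inv₀_cobounded (α := ℂ)).pow (m + 1))
    rw [zero_pow m.succ_ne_zero] at h
    refine h.congr fun z => ?_
    rw [show b i - a j = -((m + 1 : ℕ) : ℤ) by push_cast; omega, _root_.zpow_neg, zpow_natCast, inv_pow]
  have h := hpow.mul hlim
  rw [zero_mul] at h
  rw [← Metric.cobounded_eq_cocompact]
  refine h.congr' ?_
  filter_upwards [Metric.hasBasis_cobounded_compl_closedBall (0 : ℂ) |>.mem_of_mem trivial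
    (i := 0)] with z hz
  have hz0 : z ≠ 0 := by simpa using hz
  have hα' : (α₁ z).symm (Pi.single j 1) = z ^ a j • (α₀ z).symm (Pi.single j 1) := by
    refine (α₀ z).injective (funext fun i' => ?_)
    rw [hα z hz0, map_smul, LinearEquiv.apply_symm_apply, LinearEquiv.apply_symm_apply,
      Pi.smul_apply, smul_eq_mul]
    by_cases hi : i' = j
    · rw [hi]
    · simp [hi]
  simp only [Function.comp_apply]
  rw [inv_coe (inv_ne_zero hz0), _root_.inv_inv, hα', map_smul, map_smul, hβ z hz0, Pi.smul_apply,
    smul_eq_mul, ← mul_assoc, ← zpow_add₀ hz0, sub_add_cancel]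

open Finset in
-- By the vanishing of entries, `A` maps the span of the basis vectors with `c ≤ a j` into the
-- coordinate subspace with `c ≤ b i`; injectivity then compares dimensions.
theorem LinearEquiv.card_filter_le {a : Fin n → ℤ} {b : Fin l → ℤ}
    (A : (Fin n → ℂ) ≃ₗ[ℂ] (Fin l → ℂ)) (hA : ∀ i j, b i < a j → A (Pi.single j 1) i = 0) (c : ℤ) :
    #{j | c ≤ a j} ≤ #{i | c ≤ b i} := by
  have h : Function.Injective ((LinearMap.funLeft ℂ ℂ (Subtype.val : {i // c ≤ b i} → Fin l)) ∘ₗ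
      A.toLinearMap ∘ₗ
        Function.ExtendByZero.linearMap ℂ (Subtype.val : {j // c ≤ a j} → Fin n)) := by
    rw [injective_iff_map_eq_zero]
    intro v hv
    have h0 : A (Function.extend Subtype.val v 0) = 0 := funext fun i => by
      by_cases hi : c ≤ b i
      · exact congrFun hv ⟨i, hi⟩
      · rw [← LinearEquiv.coe_coe, LinearMap.pi_apply_eq_sum_univ, Finset.sum_apply]
        refine Finset.sum_eq_zero fun j _ => ?_
        by_cases hj : c ≤ a j
        · rw [Pi.smul_apply]
          have hs : (fun j' => if j = j' then (1 : ℂ) else 0) = Pi.single j 1 := by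
            ext j'
            simp [Pi.single_apply, eq_comm]
          rw [hs, LinearEquiv.coe_coe, hA i j (by omega), smul_zero]
        · rw [Function.extend_apply' _ _ _ (by simpa using hj), Pi.zero_apply, zero_smul]
          rfl
    have h1 := A.map_eq_zero_iff.1 h0
    funext j
    rw [← Subtype.val_injective.extend_apply v 0 j, h1]
    rfl
  have := LinearMap.finrank_le_finrank_of_injective h
  rwa [Module.finrank_fintype_fun_eq_card, Module.finrank_fintype_fun_eq_card,
    Fintype.card_subtype, Fintype.card_subtype] at this

open Finset in
-- The multiplicity of `c` is the count at level `c` minus the count at `c + 1`, so all fibres of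
-- `a` and `b` have equal size and can be matched.
theorem exists_equiv_of_card_filter_eq {a : Fin n → ℤ} {b : Fin l → ℤ}
    (h : ∀ c, #{j | c ≤ a j} = #{i | c ≤ b i}) : ∃ σ : Fin n ≃ Fin l, ∀ i, a i = b (σ i) := by
  have key : ∀ {m : ℕ} (f : Fin m → ℤ) (c : ℤ),
      #{j | f j = c} + #{j | c + 1 ≤ f j} = #{j | c ≤ f j} := fun f c => by
    rw [← card_union_of_disjoint]
    · congr 1
      ext j
      simp only [mem_union, mem_filter, mem_univ, true_and]
      omega
    · rw [disjoint_filter]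
      intro j _ h1 h2
      omega
  have h' : ∀ c, Nonempty ({j // a j = c} ≃ {i // b i = c}) := fun c => by
    rw [← Fintype.card_eq, Fintype.card_subtype, Fintype.card_subtype]
    have h1 := key a c
    have h2 := key b c
    rw [h, h] at h1
    omega
  exact ⟨Equiv.ofFiberEquiv fun c => (h' c).some, fun i => (Equiv.ofFiberEquiv_map _ i).symm⟩

end Splitting

theorem mainTheorem1 :
    -- Birkhoff's factorization `T(z) = P(1/z) Λ(z) E(z)` on `|z| > R₀`
    (∀ (n : ℕ) (R₀ : ℝ), 0 < R₀ → ∀ T : ℂ → Matrix (Fin n) (Fin n) ℂ,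
      MemGLHolomorphic {z : ℂ | R₀ < ‖z‖} T →
      ∃ (P E : ℂ → Matrix (Fin n) (Fin n) ℂ) (k : Fin n → ℤ),
        MemGLHolomorphic (Metric.ball (0 : ℂ) (1 / R₀)) P ∧
        MemGLHolomorphic Set.univ E ∧
        Antitone k ∧
        ∀ z : ℂ, R₀ < ‖z‖ →
          T z = P (1 / z) * Matrix.diagonal (fun i => z ^ k i) * E z) ∧
    -- every holomorphic vector bundle of rank `n` on `ℙ¹(ℂ)` splits
    (∀ (n : ℕ) (V : OnePoint ℂ → Type*) [TopologicalSpace (Bundle.TotalSpace (Fin n → ℂ) V)]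
      [∀ x, AddCommGroup (V x)] [∀ x, Module ℂ (V x)] [∀ x, TopologicalSpace (V x)]
      [FiberBundle (Fin n → ℂ) V] [VectorBundle ℂ (Fin n → ℂ) V]
      [ContMDiffVectorBundle ω (Fin n → ℂ) V 𝓘(ℂ)],
      ∃ k : Fin n → ℤ, HolomorphicallyIsomorphic (Fin n → ℂ) V
        (Fin n → ℂ) (RiemannSphere.sumLineBundles k).Fiber) ∧
    -- the splitting type is unique up to order
    (∀ (n l : ℕ) (a : Fin n → ℤ) (b : Fin l → ℤ),
      HolomorphicallyIsomorphic (Fin n → ℂ) (RiemannSphere.sumLineBundles a).Fiber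
          (Fin l → ℂ) (RiemannSphere.sumLineBundles b).Fiber ↔
        n = l ∧ ∃ σ : Fin n ≃ Fin l, ∀ i, a i = b (σ i)) := by
  refine ⟨fun n R₀ hR₀ T hT => exists_birkhoff_factorization hR₀ hT,
    fun n V => exists_holomorphicallyIsomorphic_sumLineBundles V, fun n l a b => ⟨?_, ?_⟩⟩
  · rintro ⟨φ, hφ, hφ'⟩
    obtain ⟨A, hA⟩ := HolomorphicallyIsomorphic.exists_linearEquiv hφ
    obtain ⟨A', hA'⟩ := HolomorphicallyIsomorphic.exists_linearEquiv (φ := fun x => (φ x).symm) hφ'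
    obtain ⟨σ, hσ⟩ := exists_equiv_of_card_filter_eq fun c =>
      le_antisymm (A.card_filter_le hA c) (A'.card_filter_le hA' c)
    exact ⟨by simpa using Fintype.card_congr σ, σ, hσ⟩
  · rintro ⟨rfl, σ, hσ⟩
    exact holomorphicallyIsomorphic_sumLineBundles_of_perm σ hσ
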